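/- Let $M$ be a compact smooth manifold without boundary of dimension $2n+1$, $n\ge 0$, with a contact structure $\xi=\ker\alpha$, where $\alpha$ is a contact form (a smooth nowhere vanishing 1-form with $d\alpha$ nondegenerate on $\xi$). A contact isotopy is a family $\{\phi_t\}_{t\in[0,1]}$ of contactomorphisms of $(M,\xi)$ with $\phi_0=\mathrm{id}$, smooth in $(t,x)$. Let $g_t:M\to\mathbb R$ be the function with $\phi_t^*\alpha=e^{g_t}\alpha$ and $\mathrm{gr}(\phi_t)=\{(q,\phi_t(q),g_t(q)) : q\in M\}\subset M\times M\times\mathbb R$. A piece $\{\phi_t\}_{t\in[a,b]}$ is called embedded if $(t,q)\mapsto(q,\phi_t(q),g_t(q))$ is a (topological) embedding of $[a,b]\times M$ into $M\times M\times\mathbb R$; since $M$ is compact, this means that the graphs $\mathrm{gr}(\phi_t)$, $t\in[a,b]$, are pairwise disjoint. Let $\widetilde{\mathrm{Cont}_0}(M,\xi)$ be the universal cover of the identity component of the contactomorphism group: the group of classes $[\{\phi_t\}]$ of contact isotopies up to (smooth) homotopy with fixed endpoints, with product $[\{\phi_t\}][\{\psi_t\}]=[\{\phi_t\circ\psi_t\}]$.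 Let $\widetilde{\mathcal E}$ be the set of elements different from $[\mathrm{id}]$ that are represented by a contact isotopy $\{\phi_t\}_{t\in[0,1]}$ which is embedded on $[0,1]$. Then: 1. Every contact isotopy is homotopic with fixed endpoints to a contact isotopy $\{\psi_t\}$ for which there are an integer $N\ge1$ and a subdivision $0=t_0<t_1<\dots<t_N=1$ such that, for every $i=0,\dots,N-1$, the piece $\{\psi_t\}_{t\in[t_i,t_{i+1}]}$ is embedded and $\bigcup_{t\in[t_i,t_{i+1}]}\mathrm{gr}(\psi_t)$ is a smoothly embedded submanifold with boundary of $M\times M\times\mathbb R$, namely the image of a smooth embedding of $[0,1]\times M$. 2. $\widetilde{\mathcal E}$ generates $\widetilde{\mathrm{Cont}_0}(M,\xi)$, in the sense that $\bigcup_{k\ge0}\widetilde{\mathcal E}^{\,k}=\widetilde{\mathrm{Cont}_0}(M,\xi)$ (with $\widetilde{\mathcal E}^{\,0}=\{1\}$); moreover $\widetilde{\mathcal E}^{-1}=\widetilde{\mathcal E}$, and $\widetilde{\mathcal E}$ is invariant under conjugation. 3. The discriminant norm $\nu(x)=\min\{k\ge0 : x\in\widetilde{\mathcal E}^{\,k}\}$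 is a non-degenerate conjugation-invariant norm: $\nu\ge0$, $\nu(x)=0$ if and only if $x=1$, $\nu(x^{-1})=\nu(x)$, $\nu(xy)\le\nu(x)+\nu(y)$, $\nu(yxy^{-1})=\nu(x)$. Consequently $d(x,y)=\nu(x^{-1}y)$ (the discriminant metric) is a non-degenerate bi-invariant metric on $\widetilde{\mathrm{Cont}_0}(M,\xi)$. 4. $\widetilde{\mathcal E}$, $\nu$ and $d$ do not depend on the choice of the contact form: any contact form $\alpha'$ with $\ker\alpha'=\xi$ gives the same set, norm and metric. -/

import Mathlib

open Set Topology
open scoped Manifold ContDiff Pointwise unitInterval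

noncomputable section

/-! ## Contact forms and hyperplane fields on a manifold of dimension `m` -/

section ContactForms

variable {m : ℕ} {M : Type*} [TopologicalSpace M] [ChartedSpace (EuclideanSpace ℝ (Fin m)) M]

variable (m M) in
/-- A (not necessarily smooth) 1-form on `M`. -/
abbrev OneForm := ∀ x : M, TangentSpace (𝓡 m) x →L[ℝ] ℝ

variable (m M) in
/-- A (not necessarily smooth) field of linear subspaces of the tangent spaces of `M`. -/
abbrev TangentDistribution := ∀ x : M, Submodule ℝ (TangentSpace (𝓡 m) x)

/-- A 1-form is smooth if it is smooth as a function on the tangent bundle. -/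
def OneForm.IsSmooth [IsManifold (𝓡 m) ∞ M] (α : OneForm m M) : Prop :=
  ContMDiff (𝓡 m).tangent 𝓘(ℝ, ℝ) ∞ (fun v : TangentBundle (𝓡 m) M => α v.proj v.snd)

/-- The expression of a 1-form in the preferred chart at `x₀`: its pullback to the model space
by the inverse of that chart. -/
def OneForm.inChart (α : OneForm m M) (x₀ : M) (y : EuclideanSpace ℝ (Fin m)) :
    EuclideanSpace ℝ (Fin m) →L[ℝ] ℝ :=
  (α ((extChartAt (𝓡 m) x₀).symm y)).comp
    (mfderiv 𝓘(ℝ, EuclideanSpace ℝ (Fin m)) (𝓡 m) (extChartAt (𝓡 m) x₀).symm y)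

/-- The exterior derivative `dα` at `x`, evaluated on `v` and `w`, computed in the preferred chart
at `x` by `dα(v, w) = (D_v α)(w) - (D_w α)(v)`. (`TangentSpace (𝓡 m) x` is by definition the model
space, a tangent vector at `x` being identified with its coordinates in the preferred chart
at `x`.) -/
def OneForm.extDerivAt (α : OneForm m M) (x : M) (v w : TangentSpace (𝓡 m) x) : ℝ :=
  let D : EuclideanSpace ℝ (Fin m) →L[ℝ] EuclideanSpace ℝ (Fin m) →L[ℝ] ℝ :=
    fderiv ℝ (α.inChart x) (extChartAt (𝓡 m) x x)
  D v w - D w v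

/-- `α` is a contact form for the hyperplane field `ξ`: it is a smooth nowhere vanishing 1-form
with `ξ = ker α`, and `dα` is nondegenerate on `ξ`. -/
structure IsContactFormFor [IsManifold (𝓡 m) ∞ M] (ξ : TangentDistribution m M) (α : OneForm m M) : Prop where
  smooth : α.IsSmooth
  ne_zero : ∀ x, α x ≠ 0
  ker_eq : ∀ (x : M) (v : TangentSpace (𝓡 m) x), v ∈ ξ x ↔ α x v = 0
  nondegenerate : ∀ (x : M), ∀ v ∈ ξ x, v ≠ 0 → ∃ w ∈ ξ x, α.extDerivAt x v w ≠ 0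

/-- `g` is the conformal exponent of `φ` with respect to `α`: `φ^* α = e^g α`. -/
def IsConformalExponent (α : OneForm m M) (φ : Equiv.Perm M) (g : M → ℝ) : Prop :=
  ∀ (x : M) (v : TangentSpace (𝓡 m) x),
    α (φ x) (mfderiv (𝓡 m) (𝓡 m) φ x v) = Real.exp (g x) * α x v

end ContactForms

/-! ## Contact isotopies and the universal cover of the contactomorphism group -/

section Isotopies

variable {m : ℕ} {M : Type*} [TopologicalSpace M] [ChartedSpace (EuclideanSpace ℝ (Fin m)) M]

/-- A family of bijections of `M`, parametrized by a manifold `P` (possibly with boundary or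
corners), is a smooth family of diffeomorphisms: it is smooth in all variables together,
and so is the family of the inverses. -/
def IsSmoothFamily (m : ℕ) [ChartedSpace (EuclideanSpace ℝ (Fin m)) M]
    {F K P : Type*} [NormedAddCommGroup F] [NormedSpace ℝ F] [TopologicalSpace K]
    (J : ModelWithCorners ℝ F K) [TopologicalSpace P] [ChartedSpace K P]
    (φ : P → Equiv.Perm M) : Prop :=
  ContMDiff (J.prod (𝓡 m)) (𝓡 m) ∞ (fun p : P × M => φ p.1 p.2) ∧
  ContMDiff (J.prod (𝓡 m)) (𝓡 m) ∞ (fun p : P × M => (φ p.1)⁻¹ p.2)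

section SmoothFamily

variable {F K P : Type*} [NormedAddCommGroup F] [NormedSpace ℝ F] [TopologicalSpace K]
  {J : ModelWithCorners ℝ F K} [TopologicalSpace P] [ChartedSpace K P]

theorem IsSmoothFamily.inv {φ : P → Equiv.Perm M} (h : IsSmoothFamily m J φ) :
    IsSmoothFamily m J φ⁻¹ :=
  ⟨h.2, by simpa using h.1⟩

theorem IsSmoothFamily.mul {φ ψ : P → Equiv.Perm M} (h : IsSmoothFamily m J φ)
    (h' : IsSmoothFamily m J ψ) : IsSmoothFamily m J (φ * ψ) := by
  constructor
  · exact h.1.comp (contMDiff_fst.prodMk h'.1)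
  · simpa [Function.comp_def] using h'.2.comp (contMDiff_fst.prodMk h.2)

theorem isSmoothFamily_one : IsSmoothFamily (M := M) m J (1 : P → Equiv.Perm M) :=
  ⟨contMDiff_snd, by simpa using contMDiff_snd⟩

theorem IsSmoothFamily.mdifferentiable {φ : P → Equiv.Perm M} (h : IsSmoothFamily m J φ) (p : P) :
    MDifferentiable (𝓡 m) (𝓡 m) (φ p) :=
  (h.1.comp (contMDiff_const.prodMk contMDiff_id) :
    ContMDiff (𝓡 m) (𝓡 m) ∞ (φ p)).mdifferentiable (by simp)

/-- Reparametrizations of smooth families are smooth. -/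
theorem IsSmoothFamily.comp_param {F' K' P' : Type*} [NormedAddCommGroup F'] [NormedSpace ℝ F']
    [TopologicalSpace K'] {J' : ModelWithCorners ℝ F' K'} [TopologicalSpace P']
    [ChartedSpace K' P'] {φ : P → Equiv.Perm M} (h : IsSmoothFamily m J φ) {u : P' → P}
    (hu : ContMDiff J' J ∞ u) : IsSmoothFamily m J' (φ ∘ u) :=
  ⟨h.1.comp ((hu.comp contMDiff_fst).prodMk contMDiff_snd),
    h.2.comp ((hu.comp contMDiff_fst).prodMk contMDiff_snd)⟩

end SmoothFamily

/-- The differential of `φ` maps `ξ` to itself. For a diffeomorphism `φ` this says that `φ` is a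
contactomorphism. -/
def PreservesDistribution (ξ : TangentDistribution m M) (φ : Equiv.Perm M) : Prop :=
  ∀ (x : M) (v : TangentSpace (𝓡 m) x),
    mfderiv (𝓡 m) (𝓡 m) φ x v ∈ ξ (φ x) ↔ v ∈ ξ x

theorem PreservesDistribution.mul {ξ : TangentDistribution m M} {φ ψ : Equiv.Perm M}
    (h : PreservesDistribution ξ φ) (h' : PreservesDistribution ξ ψ)
    (d : MDifferentiable (𝓡 m) (𝓡 m) φ) (d' : MDifferentiable (𝓡 m) (𝓡 m) ψ) :
    PreservesDistribution ξ (φ * ψ) := by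
  intro x v
  have e : mfderiv (𝓡 m) (𝓡 m) (φ * ψ) x
      = (mfderiv (𝓡 m) (𝓡 m) φ (ψ x)).comp (mfderiv (𝓡 m) (𝓡 m) ψ x) :=
    mfderiv_comp x (d (ψ x)) (d' x)
  rw [e]
  exact (h (ψ x) _).trans (h' x v)

theorem preservesDistribution_one (ξ : TangentDistribution m M) : PreservesDistribution ξ 1 := by
  intro x v
  have e : mfderiv (𝓡 m) (𝓡 m) ((1 : Equiv.Perm M) : M → M) x
      = ContinuousLinearMap.id ℝ (TangentSpace (𝓡 m) x) := mfderiv_id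
  rw [e]
  rfl

theorem PreservesDistribution.inv {ξ : TangentDistribution m M} {φ : Equiv.Perm M}
    (h : PreservesDistribution ξ φ)
    (d : MDifferentiable (𝓡 m) (𝓡 m) φ) (d' : MDifferentiable (𝓡 m) (𝓡 m) (φ⁻¹ : Equiv.Perm M)) :
    PreservesDistribution ξ φ⁻¹ := by
  intro x v
  obtain ⟨y, rfl⟩ := φ.surjective x
  have e : mfderiv (𝓡 m) (𝓡 m) (φ * φ⁻¹ : Equiv.Perm M) (φ y)
      = (mfderiv (𝓡 m) (𝓡 m) φ (φ⁻¹ (φ y))).comp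
        (mfderiv (𝓡 m) (𝓡 m) (φ⁻¹ : Equiv.Perm M) (φ y)) :=
    mfderiv_comp (φ y) (d _) (d' _)
  have h1 := h (φ⁻¹ (φ y)) (mfderiv (𝓡 m) (𝓡 m) (φ⁻¹ : Equiv.Perm M) (φ y) v)
  rw [← h1, ← preservesDistribution_one ξ (φ y) v, ← mul_inv_cancel φ, e]
  rfl

/-- The group (under `(φψ)_t = φ_t ∘ ψ_t`) of contact isotopies `{φ_t}`, `t ∈ [0,1]`, of `(M, ξ)`:
smooth families of contactomorphisms with `φ_0 = id`. -/
def contactIsotopyGroup (ξ : TangentDistribution m M) : Subgroup (I → Equiv.Perm M) where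
  carrier := {φ | IsSmoothFamily m (𝓡∂ 1) φ ∧ (∀ t, PreservesDistribution ξ (φ t)) ∧ φ 0 = 1}
  one_mem' := ⟨isSmoothFamily_one, fun _ => preservesDistribution_one ξ, rfl⟩
  mul_mem' := by
    rintro φ ψ ⟨h1, h2, h3⟩ ⟨h1', h2', h3'⟩
    exact ⟨h1.mul h1', fun t => (h2 t).mul (h2' t) (h1.mdifferentiable t) (h1'.mdifferentiable t),
      by simp [h3, h3']⟩
  inv_mem' := by
    rintro φ ⟨h1, h2, h3⟩
    exact ⟨h1.inv, fun t => (h2 t).inv (h1.mdifferentiable t) (h1.inv.mdifferentiable t),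
      by simp [h3]⟩

/-- A contact isotopy of `(M, ξ)` starting at the identity. -/
abbrev ContactIsotopy (ξ : TangentDistribution m M) : Type _ := ↥(contactIsotopyGroup ξ)

/-- Two contact isotopies are homotopic with fixed endpoints: there is a family `{F_s}`,
`s ∈ [0,1]`, of contact isotopies, smooth in all variables, from the one to the other, with
`F_s(0)` and `F_s(1)` independent of `s` (`F_s(0) = id` holds for every contact isotopy). -/
def ContactIsotopy.Homotopic {ξ : TangentDistribution m M} (φ ψ : ContactIsotopy ξ) : Prop :=
  ∃ F : I → ContactIsotopy ξ,
    IsSmoothFamily m ((𝓡∂ 1).prod (𝓡∂ 1)) (fun p : I × I => (F p.1).1 p.2) ∧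
    F 0 = φ ∧ F 1 = ψ ∧ ∀ s, (F s).1 1 = φ.1 1

namespace ContactIsotopy

variable {ξ : TangentDistribution m M}

theorem Homotopic.refl (φ : ContactIsotopy ξ) : φ.Homotopic φ :=
  ⟨fun _ => φ, φ.2.1.comp_param (u := fun p : I × I => p.2) contMDiff_snd, rfl, rfl, fun _ => rfl⟩

theorem Homotopic.mul {φ φ' ψ ψ' : ContactIsotopy ξ} (h : φ.Homotopic φ') (k : ψ.Homotopic ψ') :
    (φ * ψ).Homotopic (φ' * ψ') := by
  obtain ⟨F, h1, h2, h3, h4⟩ := h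
  obtain ⟨G, k1, k2, k3, k4⟩ := k
  refine ⟨fun s => F s * G s, h1.mul k1, by simp [h2, k2], by simp [h3, k3], fun s => ?_⟩
  change (F s).1 1 * (G s).1 1 = φ.1 1 * ψ.1 1
  rw [h4, k4]

theorem Homotopic.inv {φ φ' : ContactIsotopy ξ} (h : φ.Homotopic φ') :
    φ⁻¹.Homotopic φ'⁻¹ := by
  obtain ⟨F, h1, h2, h3, h4⟩ := h
  refine ⟨fun s => (F s)⁻¹, h1.inv, by simp [h2], by simp [h3], fun s => ?_⟩
  change ((F s).1 1)⁻¹ = (φ.1 1)⁻¹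
  rw [h4]

theorem Homotopic.symm {φ ψ : ContactIsotopy ξ} (h : φ.Homotopic ψ) : ψ.Homotopic φ := by
  have := ((Homotopic.refl φ).mul h.inv).mul (Homotopic.refl ψ)
  simp only [mul_inv_cancel, one_mul, inv_mul_cancel_right] at this
  exact this

theorem Homotopic.trans {φ ψ χ : ContactIsotopy ξ} (h : φ.Homotopic ψ) (k : ψ.Homotopic χ) :
    φ.Homotopic χ := by
  have := (h.mul (Homotopic.refl ψ⁻¹)).mul k
  simp only [mul_inv_cancel, one_mul, inv_mul_cancel_right] at this
  exact this

end ContactIsotopy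

/-- Homotopy with fixed endpoints, as a congruence on the group of contact isotopies. -/
def homotopyCon (ξ : TangentDistribution m M) : Con (ContactIsotopy ξ) where
  r := ContactIsotopy.Homotopic
  iseqv := ⟨.refl, .symm, .trans⟩
  mul' := .mul

/-- The universal cover of the identity component of the contactomorphism group of `(M, ξ)`: the
group of homotopy classes with fixed endpoints of contact isotopies starting at the identity. -/
abbrev UniversalCoverCont (ξ : TangentDistribution m M) := (homotopyCon ξ).Quotient

/-- The class `[{φ_t}]` of a contact isotopy in the universal cover. -/
def ContactIsotopy.toUniversalCover {ξ : TangentDistribution m M} (φ : ContactIsotopy ξ) :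
    UniversalCoverCont ξ :=
  (homotopyCon ξ).mk' φ

end Isotopies

/-! ## Embedded contact isotopies -/

section Embedded

variable {m : ℕ} {M : Type*} [TopologicalSpace M] [ChartedSpace (EuclideanSpace ℝ (Fin m)) M]

/-- The parametrization `(t, q) ↦ (q, φ_t(q), g_t(q))` of the graphs of the `φ_t`. -/
def graphMap (φ : I → Equiv.Perm M) (g : I → M → ℝ) (p : I × M) : M × M × ℝ :=
  (p.2, φ p.1 p.2, g p.1 p.2)

/-- The piece `{φ_t}`, `t ∈ [a,b]`, is embedded: `(t, q) ↦ (q, φ_t(q), g_t(q))`, where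
`φ_t^* α = e^{g_t} α`, is an embedding of `[a,b] × M` into `M × M × ℝ`.
(For compact `M` this means that the graphs `gr(φ_t)`, `t ∈ [a,b]`, are pairwise disjoint.) -/
def IsEmbeddedOn (α : OneForm m M) (φ : I → Equiv.Perm M) (a b : I) : Prop :=
  ∃ g : I → M → ℝ, (∀ t, IsConformalExponent α (φ t) (g t)) ∧
    IsEmbedding ((Icc a b ×ˢ univ).domRestrict (graphMap φ g))

/-- The union of the graphs `gr(φ_t) ⊆ M × M × ℝ`, `t ∈ [a,b]`, is a smoothly embedded compact
submanifold with boundary, diffeomorphic to `[0,1] × M`. -/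
def HasSmoothGraphUnionOn (α : OneForm m M) (φ : I → Equiv.Perm M) (a b : I) : Prop :=
  ∃ g : I → M → ℝ, (∀ t, IsConformalExponent α (φ t) (g t)) ∧
    ∃ Ψ : I × M → M × M × ℝ,
      ContMDiff ((𝓡∂ 1).prod (𝓡 m)) ((𝓡 m).prod ((𝓡 m).prod 𝓘(ℝ, ℝ))) ∞ Ψ ∧
      (∀ p, Function.Injective
        (mfderiv ((𝓡∂ 1).prod (𝓡 m)) ((𝓡 m).prod ((𝓡 m).prod 𝓘(ℝ, ℝ))) Ψ p)) ∧
      IsEmbedding Ψ ∧ range Ψ = graphMap φ g '' (Icc a b ×ˢ univ)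

/-- The set of nontrivial classes in the universal cover that are represented by an embedded
contact isotopy. -/
def embeddedClasses (ξ : TangentDistribution m M) (α : OneForm m M) :
    Set (UniversalCoverCont ξ) :=
  {x | x ≠ 1 ∧ ∃ φ : ContactIsotopy ξ, φ.toUniversalCover = x ∧ IsEmbeddedOn α φ.1 0 1}

end Embedded

/-! ## Word norms and bi-invariant metrics -/

section WordNorm

variable {G : Type*} [Group G]

/-- `S` is a generating set of `G` in the sense that every element of `G` is a product of
finitely many elements of `S` (without inverses). -/
def IsGeneratingSet (S : Set G) : Prop := (⋃ k : ℕ, S ^ k) = univ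

/-- The word norm `ν_S(x) = min {k ≥ 0 | x ∈ S^k}`. -/
def wordNorm (S : Set G) (x : G) : ℕ := sInf {k : ℕ | x ∈ S ^ k}

/-- Non-degenerate conjugation-invariant norms on a group. -/
structure IsConjInvariantNorm (ν : G → ℝ) : Prop where
  nonneg : ∀ x, 0 ≤ ν x
  eq_zero_iff : ∀ x, ν x = 0 ↔ x = 1
  inv : ∀ x, ν x⁻¹ = ν x
  mul_le : ∀ x y, ν (x * y) ≤ ν x + ν y
  conj : ∀ x y, ν (y * x * y⁻¹) = ν x

/-- Bi-invariant (non-degenerate) metrics on a group. -/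
structure IsBiinvariantMetric (d : G → G → ℝ) : Prop where
  eq_zero_iff : ∀ x y, d x y = 0 ↔ x = y
  symm : ∀ x y, d x y = d y x
  triangle : ∀ x y z, d x z ≤ d x y + d y z
  mul_left : ∀ z x y, d (z * x) (z * y) = d x y
  mul_right : ∀ z x y, d (x * z) (y * z) = d x y

end WordNorm

section Discriminant

variable {m : ℕ} {M : Type*} [TopologicalSpace M] [ChartedSpace (EuclideanSpace ℝ (Fin m)) M]

/-- The discriminant norm: the word norm of the set of classes of embedded contact isotopies. -/
def discriminantNorm (ξ : TangentDistribution m M) (α : OneForm m M)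
    (x : UniversalCoverCont ξ) : ℕ :=
  wordNorm (embeddedClasses ξ α) x

/-- The discriminant metric `d(x, y) = ν(x⁻¹ y)`. -/
def discriminantDist (ξ : TangentDistribution m M) (α : OneForm m M)
    (x y : UniversalCoverCont ξ) : ℝ :=
  (discriminantNorm ξ α (x⁻¹ * y) : ℝ)

end Discriminant

end

/-!
The key observation is that a family of diffeomorphisms of a compact manifold which is transverse to
a contact structure at all times has no stationary points, so that within a short time no point
returns to where it was (`exists_pos_forall_eq_of_velocity_ne_zero`). Short pieces of such a family
are therefore embedded, already after projecting the graphs to `M × M`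
(`isEmbeddedOn_and_hasSmoothGraphUnionOn_of_reparam`).

An arbitrary contact isotopy `φ` is a product of such families: with `ρ` the Reeb flow, the family
`ρ_{-Ct}` is negatively transverse, and `φ_t ρ_{Ct}` is positively transverse once `C` is large
(`exists_velocity_comp_reebFlow_ne_zero`). Hence `φ` is homotopic to the concatenation of `ρ_{-Ct}`
and `φ_t ρ_{Ct} ρ_{-C}`, which can be cut into embedded pieces
(`ContactIsotopy.exists_homotopic_subdivision`). In the universal cover, the class of an isotopy is
the product of the classes of its pieces, so that the embedded classes generate.

Embeddedness means that if `φ_s(q) = φ_t(q)` and `g_s(q) = g_t(q)`, then `s = t` (`isEmbeddedOn_iff`).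
This condition is inherited by inverses and conjugates because the conformal exponents form a cocycle,
and it does not depend on the contact form because the exponents with respect to another form differ
by a function of `(q, φ_t(q))`. An isotopy conjugated by another one is homotopic to its conjugate by
the end of that one. The statements about the norm and the metric are formal consequences.

The Reeb flow has to be constructed. Its vector field is smooth since it is obtained by inverting
`v ↦ dα(v, ·) + α(v) α`. Smooth dependence of solutions of differential equations on the initial
value comes from the inverse function theorem in a space of continuous curves, in the guise that
`c ↦ f ∘ c` is smooth there for smooth `f` (`contDiff_continuousMap_comp`,
`exists_smooth_localFlow`). The flow preserves `α` (`pullback_reebFlow_eq`) by Cartan's formula.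
-/

/-! ### Smooth dependence of solutions of ordinary differential equations -/

section Nemytskii

universe u

variable {K : Type*} [TopologicalSpace K] [CompactSpace K]

/-- Pointwise application of a continuous family of operators to a continuous function, as a
bounded bilinear map. -/
noncomputable def pointwiseApplyCLM (K : Type*) [TopologicalSpace K] [CompactSpace K]
    (E F : Type*) [NormedAddCommGroup E] [NormedSpace ℝ E] [NormedAddCommGroup F]
    [NormedSpace ℝ F] : C(K, E →L[ℝ] F) →L[ℝ] C(K, E) →L[ℝ] C(K, F) :=
  LinearMap.mkContinuous₂
    (LinearMap.mk₂ ℝ (fun (A : C(K, E →L[ℝ] F)) (h : C(K, E)) =>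
        (⟨fun t => A t (h t), by fun_prop⟩ : C(K, F)))
      (by intros; ext; simp) (by intros; ext; simp) (by intros; ext; simp)
      (by intros; ext; simp)) 1 (by
    intro A h
    rw [one_mul, ContinuousMap.norm_le _ (by positivity)]
    intro t
    exact ((A t).le_opNorm (h t)).trans
      (mul_le_mul (A.norm_coe_le_norm t) (h.norm_coe_le_norm t) (norm_nonneg _) (norm_nonneg A)))

@[simp]
theorem pointwiseApplyCLM_apply {E F : Type*} [NormedAddCommGroup E] [NormedSpace ℝ E]
    [NormedAddCommGroup F] [NormedSpace ℝ F] (A : C(K, E →L[ℝ] F)) (h : C(K, E)) (t : K) :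
    pointwiseApplyCLM K E F A h t = A t (h t) := rfl

/-- The derivative of postcomposition with `f` is pointwise application of `f'`: by the mean value
inequality the error is controlled by `f' ∘ d - f' ∘ c` for `d` close to `c`. -/
theorem hasFDerivAt_continuousMap_comp {E F : Type*} [NormedAddCommGroup E] [NormedSpace ℝ E]
    [NormedAddCommGroup F] [NormedSpace ℝ F] (f : C(E, F)) (f' : C(E, E →L[ℝ] F))
    (hf : ∀ x, HasFDerivAt f (f' x) x) (c : C(K, E)) :
    HasFDerivAt (fun c : C(K, E) => f.comp c) (pointwiseApplyCLM K E F (f'.comp c)) c := by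
  rw [hasFDerivAt_iff_isLittleO_nhds_zero, Asymptotics.isLittleO_iff]
  intro ε hε
  have hcont : Continuous (fun d : C(K, E) => f'.comp d) := ContinuousMap.continuous_postcomp f'
  obtain ⟨δ, hδ, hd⟩ := (Metric.continuousAt_iff (f := fun d : C(K, E) => f'.comp d) (a := c)).1
    hcont.continuousAt ε hε
  filter_upwards [Metric.ball_mem_nhds (0 : C(K, E)) hδ] with h hh
  rw [ContinuousMap.norm_le _ (by positivity)]
  intro t
  have key : ‖f (c t + h t) - f (c t) - f' (c t) (c t + h t - c t)‖ ≤
      ε * ‖c t + h t - c t‖ := by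
    refine (convex_segment (c t) (c t + h t)).norm_image_sub_le_of_norm_hasFDerivWithin_le'
      (fun x _ => (hf x).hasFDerivWithinAt) ?_ (left_mem_segment ℝ _ _) (right_mem_segment ℝ _ _)
    intro x hx
    obtain ⟨θ, hθ, rfl⟩ := (segment_eq_image' ℝ _ _).subset hx
    have h1 : dist (c + θ • h) c < δ := by
      rw [dist_eq_norm, add_sub_cancel_left, norm_smul, Real.norm_of_nonneg hθ.1]
      exact (mul_le_of_le_one_left (norm_nonneg _) hθ.2).trans_lt (by simpa using hh)
    have h2 := (ContinuousMap.dist_apply_le_dist (f := f'.comp (c + θ • h)) (g := f'.comp c) t).trans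
      (hd h1).le
    simpa [dist_eq_norm] using h2
  rw [add_sub_cancel_left] at key
  refine le_trans ?_ (key.trans
    (mul_le_mul_of_nonneg_left (h.norm_coe_le_norm t) hε.le))
  simp

/-- Composition with a smooth map is a smooth operation on continuous functions. -/
theorem contDiff_continuousMap_comp {E : Type u} [NormedAddCommGroup E] [NormedSpace ℝ E]
    {F : Type u} [NormedAddCommGroup F] [NormedSpace ℝ F] (f : C(E, F)) (hf : ContDiff ℝ ∞ f) :
    ContDiff ℝ ∞ (fun c : C(K, E) => f.comp c) := by
  rw [contDiff_infty]
  intro n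
  induction n generalizing F with
  | zero => exact contDiff_zero.2 (ContinuousMap.continuous_postcomp f)
  | succ n ih =>
    let f' : C(E, E →L[ℝ] F) := ⟨fderiv ℝ f, hf.continuous_fderiv (by simp)⟩
    have hf' : ContDiff ℝ ∞ f' := hf.fderiv_right (m := ∞) (by simp)
    have hd : ∀ c : C(K, E), HasFDerivAt (fun c : C(K, E) => f.comp c)
        (pointwiseApplyCLM K E F (f'.comp c)) c :=
      hasFDerivAt_continuousMap_comp f f'
        (fun x => (hf.differentiable (by simp) x).hasFDerivAt)
    push_cast
    rw [contDiff_succ_iff_fderiv]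
    refine ⟨fun c => (hd c).differentiableAt, by simp, ?_⟩
    rw [show fderiv ℝ (fun c : C(K, E) => f.comp c) =
      fun c => pointwiseApplyCLM K E F (f'.comp c) from funext fun c => (hd c).fderiv]
    exact (pointwiseApplyCLM K E F).contDiff.comp (ih f' hf')

end Nemytskii

section LocalFlow

variable {E : Type*} [NormedAddCommGroup E] [NormedSpace ℝ E]

/-- The primitive vanishing at `0` of a continuous function on `[-1, 1]`. -/
noncomputable def primitiveCLM (E : Type*) [NormedAddCommGroup E] [NormedSpace ℝ E] :
    C(Icc (-1 : ℝ) 1, E) →L[ℝ] C(Icc (-1 : ℝ) 1, E) :=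
  LinearMap.mkContinuous
    { toFun := fun c => ⟨fun t => ∫ x in (0 : ℝ)..t, IccExtend (by norm_num) c x,
        (intervalIntegral.continuous_primitive
          (fun _ _ => (c.continuous.Icc_extend' (h := by norm_num)).intervalIntegrable _ _) 0).comp
          continuous_subtype_val⟩
      map_add' := by
        intro c d
        ext t
        exact intervalIntegral.integral_add
          ((c.continuous.Icc_extend' (h := by norm_num)).intervalIntegrable _ _)
          ((d.continuous.Icc_extend' (h := by norm_num)).intervalIntegrable _ _)
      map_smul' := by
        intro r c
        ext t
        exact intervalIntegral.integral_smul r _ } 1 (by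
    intro c
    rw [one_mul, ContinuousMap.norm_le _ (by positivity)]
    intro t
    refine (intervalIntegral.norm_integral_le_of_norm_le_const (C := ‖c‖)
      (fun x _ => c.norm_coe_le_norm _)).trans ?_
    have := abs_le.2 t.2
    rw [sub_zero]
    exact mul_le_of_le_one_right (norm_nonneg _) this)

theorem norm_primitiveCLM_le (c : C(Icc (-1 : ℝ) 1, E)) : ‖primitiveCLM E c‖ ≤ ‖c‖ :=
  ((primitiveCLM E).le_of_opNorm_le (LinearMap.mkContinuous_norm_le _ zero_le_one _) c).trans_eq
    (one_mul _)

/-- The operator whose value `(0, s, y)` is attained exactly at the rescaled solutions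
`t ↦ γ (s t)`, `t ∈ [-1, 1]`, of `γ' = f γ`, `γ 0 = y`. -/
noncomputable def rescaledSolutionMap (f : C(E, E)) (p : C(Icc (-1 : ℝ) 1, E) × ℝ × E) :
    C(Icc (-1 : ℝ) 1, E) × ℝ × E :=
  (p.1 - ContinuousMap.const _ p.2.2 - p.2.1 • primitiveCLM E (f.comp p.1), p.2.1, p.2.2)

/-- Constant functions, as a continuous linear map. -/
noncomputable def constCLM (E : Type*) [NormedAddCommGroup E] [NormedSpace ℝ E] :
    E →L[ℝ] C(Icc (-1 : ℝ) 1, E) :=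
  ContinuousLinearMap.const ℝ (Icc (-1 : ℝ) 1)

/-- The derivative of `rescaledSolutionMap` at time scale `0`. -/
noncomputable def rescaledSolutionDeriv (w : C(Icc (-1 : ℝ) 1, E)) :
    (C(Icc (-1 : ℝ) 1, E) × ℝ × E) ≃L[ℝ] (C(Icc (-1 : ℝ) 1, E) × ℝ × E) :=
  let c := ContinuousLinearMap.fst ℝ (C(Icc (-1 : ℝ) 1, E)) (ℝ × E)
  let q := ContinuousLinearMap.snd ℝ (C(Icc (-1 : ℝ) 1, E)) (ℝ × E)
  let l : ℝ × E →L[ℝ] C(Icc (-1 : ℝ) 1, E) :=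
    (constCLM E).comp (ContinuousLinearMap.snd ℝ ℝ E) +
      (ContinuousLinearMap.fst ℝ ℝ E).smulRight w
  ContinuousLinearEquiv.equivOfInverse ((c - l.comp q).prod q) ((c + l.comp q).prod q)
    (fun x => by ext <;> simp [c, q]) (fun x => by ext <;> simp [c, q])

theorem contDiff_rescaledSolutionMap (f : C(E, E)) (hf : ContDiff ℝ ∞ f) :
    ContDiff ℝ ∞ (rescaledSolutionMap f) := by
  have h1 : ContDiff ℝ ∞ (fun p : C(Icc (-1 : ℝ) 1, E) × ℝ × E => f.comp p.1) :=
    (contDiff_continuousMap_comp f hf).comp contDiff_fst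
  have h2 : ContDiff ℝ ∞ (fun p : C(Icc (-1 : ℝ) 1, E) × ℝ × E => constCLM E p.2.2) :=
    (constCLM E).contDiff.comp (contDiff_snd.comp contDiff_snd)
  exact ((contDiff_fst.sub h2).sub ((contDiff_fst.comp contDiff_snd).smul
    ((primitiveCLM E).contDiff.comp h1))).prodMk contDiff_snd

theorem hasFDerivAt_rescaledSolutionMap (f : C(E, E)) (hf : ContDiff ℝ ∞ f)
    (c : C(Icc (-1 : ℝ) 1, E)) (y : E) :
    HasFDerivAt (rescaledSolutionMap f)
      (rescaledSolutionDeriv (primitiveCLM E (f.comp c)) :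
        (C(Icc (-1 : ℝ) 1, E) × ℝ × E) →L[ℝ] (C(Icc (-1 : ℝ) 1, E) × ℝ × E)) (c, 0, y) := by
  have h1 : DifferentiableAt ℝ (fun p : C(Icc (-1 : ℝ) 1, E) × ℝ × E =>
      primitiveCLM E (f.comp p.1)) (c, 0, y) :=
    (((primitiveCLM E).contDiff.comp ((contDiff_continuousMap_comp f hf).comp
      contDiff_fst)).differentiable (by simp : (∞ : WithTop ℕ∞) ≠ 0)) _
  have h2 := (hasFDerivAt_snd (𝕜 := ℝ) (p := (c, (0 : ℝ), y)))
  have h3 := (hasFDerivAt_fst (𝕜 := ℝ) (p := (c, (0 : ℝ), y)))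
  have h4 : HasFDerivAt (fun p : C(Icc (-1 : ℝ) 1, E) × ℝ × E => constCLM E p.2.2) _ (c, 0, y) :=
    (constCLM E).hasFDerivAt.comp (c, (0 : ℝ), y) h2.snd
  have := ((h3.sub h4).sub (h2.fst.smul h1.hasFDerivAt)).prodMk h2
  refine this.congr_fderiv ?_
  ext p <;> simp [rescaledSolutionDeriv, sub_sub]

/-- Rescaled solutions of `γ' = f γ` are unique for small time scales. -/
theorem eq_of_rescaledSolutionMap_eq {f : C(E, E)} {L : NNReal} (hf : LipschitzWith L f)
    {s : ℝ} (hs : |s| * L < 1) {y : E} {c d : C(Icc (-1 : ℝ) 1, E)}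
    (hc : c = ContinuousMap.const _ y + s • primitiveCLM E (f.comp c))
    (hd : d = ContinuousMap.const _ y + s • primitiveCLM E (f.comp d)) : c = d := by
  have h1 : c - d = s • primitiveCLM E (f.comp c - f.comp d) := by
    rw [map_sub, smul_sub]
    nth_rw 1 [hc, hd]
    abel
  have h2 : ‖f.comp c - f.comp d‖ ≤ L * ‖c - d‖ := by
    rw [ContinuousMap.norm_le _ (by positivity)]
    intro t
    refine (hf.norm_sub_le (c t) (d t)).trans ?_
    exact mul_le_mul_of_nonneg_left ((c - d).norm_coe_le_norm t) L.2
  have h3 : ‖c - d‖ ≤ |s| * L * ‖c - d‖ := by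
    nth_rw 1 [h1]
    rw [norm_smul, mul_assoc]
    exact mul_le_mul_of_nonneg_left ((norm_primitiveCLM_le _).trans h2) (abs_nonneg s)
  have h4 : ‖c - d‖ = 0 := by
    by_contra h
    have : 0 < ‖c - d‖ := lt_of_le_of_ne (norm_nonneg _) (Ne.symm h)
    nlinarith
  exact sub_eq_zero.1 (norm_eq_zero.1 h4)

/-- Rescaling of the parameter, `t ↦ c (r t)`, for `r ∈ [-1, 1]`. -/
noncomputable def rescale (c : C(Icc (-1 : ℝ) 1, E)) (r : Icc (-1 : ℝ) 1) :
    C(Icc (-1 : ℝ) 1, E) :=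
  ⟨fun t => c ⟨r * t, abs_le.1 (by
    rw [abs_mul]; exact mul_le_one₀ (abs_le.2 r.2) (abs_nonneg _) (abs_le.2 t.2))⟩, by fun_prop⟩

theorem primitiveCLM_rescale (c : C(Icc (-1 : ℝ) 1, E)) (r t : Icc (-1 : ℝ) 1) :
    (r : ℝ) • primitiveCLM E (rescale c r) t = rescale (primitiveCLM E c) r t := by
  change (r : ℝ) • (∫ x in (0 : ℝ)..t, IccExtend (by norm_num) (rescale c r) x) =
    ∫ x in (0 : ℝ)..((r : ℝ) * t), IccExtend (by norm_num) c x
  have h := intervalIntegral.smul_integral_comp_mul_left (a := 0) (b := t)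
    (fun x => IccExtend (by norm_num : (-1 : ℝ) ≤ 1) c x) (r : ℝ)
  rw [mul_zero] at h
  rw [← h]
  congr 1
  refine intervalIntegral.integral_congr fun x hx => ?_
  have hx1 : x ∈ Icc (-1 : ℝ) 1 := by
    rcases uIcc_subset_uIcc (show (0 : ℝ) ∈ uIcc (-1 : ℝ) 1 by simp) (by simp) hx with ⟨h, h'⟩
    simpa using And.intro h h'
  have hx2 : (r : ℝ) * x ∈ Icc (-1 : ℝ) 1 := abs_le.1 (by
    rw [abs_mul]; exact mul_le_one₀ (abs_le.2 r.2) (abs_nonneg _) (abs_le.2 hx1))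
  simp only [IccExtend_of_mem _ _ hx1, IccExtend_of_mem _ _ hx2]
  rfl

/-- The local flow of a Lipschitz smooth vector field on a Banach space is smooth in time and space
together. It is obtained from the inverse function theorem for `rescaledSolutionMap`. -/
theorem exists_smooth_localFlow [CompleteSpace E] (f : E → E) (hf : ContDiff ℝ ∞ f) {L : NNReal}
    (hL : LipschitzWith L f) (y₀ : E) :
    ∃ Ψ : ℝ × E → E, ContDiffAt ℝ ∞ Ψ (0, y₀) ∧ ∃ ε > 0, ∀ y ∈ Metric.ball y₀ ε,
      Ψ (0, y) = y ∧
      ∀ s ∈ Ioo (-ε) ε, HasDerivAt (fun s => Ψ (s, y)) (f (Ψ (s, y))) s := by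
  let F : C(E, E) := ⟨f, hf.continuous⟩
  let p₀ : C(Icc (-1 : ℝ) 1, E) × ℝ × E := (ContinuousMap.const _ y₀, 0, y₀)
  have hG := (contDiff_rescaledSolutionMap F hf).contDiffAt (x := p₀)
  have hG' := hasFDerivAt_rescaledSolutionMap F hf (ContinuousMap.const _ y₀) y₀
  have hGp : rescaledSolutionMap F p₀ = (0, 0, y₀) := by simp [rescaledSolutionMap, p₀]
  let Λ := hG.localInverse hG' (by simp)
  have hΛ : ContDiffAt ℝ ∞ Λ (0, 0, y₀) := hGp ▸ hG.to_localInverse hG' (by simp)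
  have hright : ∀ᶠ q in 𝓝 (0, 0, y₀), rescaledSolutionMap F (Λ q) = q :=
    hGp ▸ (hG.hasStrictFDerivAt' hG' (by simp)).eventually_right_inverse
  let γ : ℝ × E → C(Icc (-1 : ℝ) 1, E) := fun p => (Λ (0, p)).1
  have hγ : ContDiffAt ℝ ∞ γ (0, y₀) := by
    have : ContDiffAt ℝ ∞ (fun p : ℝ × E => Λ (0, p)) (0, y₀) :=
      ContDiffAt.comp (0, y₀) hΛ (contDiffAt_const.prodMk contDiffAt_id)
    exact this.fst
  have hsol : ∀ᶠ p in 𝓝 ((0 : ℝ), y₀),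
      γ p = ContinuousMap.const _ p.2 + p.1 • primitiveCLM E (F.comp (γ p)) := by
    have h1 : Filter.Tendsto (fun p : ℝ × E => ((0 : C(Icc (-1 : ℝ) 1, E)), p)) (𝓝 (0, y₀))
        (𝓝 (0, 0, y₀)) := (continuous_const.prodMk continuous_id).tendsto _
    filter_upwards [h1.eventually hright] with p hp
    have e2 : (Λ (0, p)).2 = p :=
      congrArg Prod.snd (show rescaledSolutionMap F (Λ (0, p)) = (0, p) from hp)
    have e1 := congrArg Prod.fst (show rescaledSolutionMap F (Λ (0, p)) = (0, p) from hp)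
    simp only [rescaledSolutionMap, e2] at e1
    rw [sub_sub] at e1
    exact sub_eq_zero.1 e1
  let one : Icc (-1 : ℝ) 1 := ⟨1, by norm_num⟩
  refine ⟨fun p => γ p one, ?_, ?_⟩
  · exact (ContinuousLinearMap.contDiff
      (ContinuousMap.evalCLM ℝ one : C(Icc (-1 : ℝ) 1, E) →L[ℝ] E)).contDiffAt.comp (0, y₀) hγ
  obtain ⟨ε, hε, hball⟩ := Metric.eventually_nhds_iff_ball.1 hsol
  set δ : ℝ := min (ε / 2) (1 / (2 * (L + 1))) with hδ_def
  have hLpos : (0 : ℝ) < 2 * (L + 1) := by positivity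
  have hδ : 0 < δ := lt_min (by positivity) (by positivity)
  have hδε : δ < ε := (min_le_left _ _).trans_lt (by linarith)
  have hδL : ∀ s : ℝ, |s| ≤ δ → |s| * L < 1 := by
    intro s hs
    have h1 : |s| ≤ 1 / (2 * (L + 1)) := hs.trans (min_le_right _ _)
    rw [le_div_iff₀ hLpos] at h1
    have := abs_nonneg s
    nlinarith [L.2]
  have hmem : ∀ s : ℝ, |s| ≤ δ → ∀ y ∈ Metric.ball y₀ δ, (s, y) ∈ Metric.ball ((0 : ℝ), y₀) ε := by
    intro s hs y hy
    rw [← ball_prod_same]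
    exact ⟨by simpa using hs.trans_lt hδε, Metric.ball_subset_ball hδε.le hy⟩
  refine ⟨δ, hδ, fun y hy => ⟨?_, ?_⟩⟩
  · have := hball _ (hmem 0 (by simpa using hδ.le) y hy)
    simp only at this ⊢
    rw [this]
    simp
  intro s hs
  -- Near `s` the solution of time scale `s` is the restriction of the one of time scale `δ`.
  have hresc : ∀ r : Icc (-1 : ℝ) 1, γ (r * δ, y) = rescale (γ (δ, y)) r := by
    intro r
    have hr : |(r : ℝ) * δ| ≤ δ := by
      rw [abs_mul, abs_of_pos hδ]
      exact mul_le_of_le_one_left hδ.le (abs_le.2 r.2)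
    refine eq_of_rescaledSolutionMap_eq (f := F) hL (hδL _ hr) (hball _ (hmem _ hr y hy)) ?_
    have hδ' := hball _ (hmem δ (by rw [abs_of_pos hδ]) y hy)
    ext t
    have h1 : rescale (γ (δ, y)) r t = y + δ • rescale (primitiveCLM E (F.comp (γ (δ, y)))) r t :=
      congrArg (fun c : C(Icc (-1 : ℝ) 1, E) => rescale c r t) hδ'
    rw [h1, ← primitiveCLM_rescale, smul_smul, mul_comm δ]
    rfl
  have hval : ∀ t ∈ Ioo (-δ) δ, γ (t, y) one = y + ∫ x in (0 : ℝ)..t,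
      IccExtend (by norm_num : (-1 : ℝ) ≤ 1) (F.comp (γ (δ, y))) (δ⁻¹ * x) := by
    intro t ht
    have hr : t / δ ∈ Icc (-1 : ℝ) 1 := by
      constructor
      · rw [le_div_iff₀ hδ]; linarith [ht.1]
      · rw [div_le_iff₀ hδ]; linarith [ht.2]
    have h1 := hresc ⟨t / δ, hr⟩
    simp only [div_mul_cancel₀ t hδ.ne'] at h1
    rw [h1]
    have hδ' := hball _ (hmem δ (by rw [abs_of_pos hδ]) y hy)
    have h2 : rescale (γ (δ, y)) ⟨t / δ, hr⟩ one = γ (δ, y) ⟨t / δ, hr⟩ := by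
      simp [rescale, one]
    rw [h2]
    have h3 := congrArg (fun c : C(Icc (-1 : ℝ) 1, E) => c ⟨t / δ, hr⟩) hδ'
    refine h3.trans ?_
    have h5 := intervalIntegral.integral_comp_mul_left (a := 0) (b := t)
      (fun x => IccExtend (by norm_num : (-1 : ℝ) ≤ 1) (F.comp (γ (δ, y))) x)
      (inv_ne_zero hδ.ne')
    rw [h5, inv_inv, mul_zero, ← div_eq_inv_mul]
    rfl
  have hs' : s / δ ∈ Icc (-1 : ℝ) 1 := by
    constructor
    · rw [le_div_iff₀ hδ]; linarith [hs.1]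
    · rw [div_le_iff₀ hδ]; linarith [hs.2]
  have hcont : Continuous (fun x : ℝ =>
      IccExtend (by norm_num : (-1 : ℝ) ≤ 1) (F.comp (γ (δ, y))) (δ⁻¹ * x)) :=
    ((F.comp (γ (δ, y))).continuous.Icc_extend' (h := by norm_num)).comp (by fun_prop)
  have hder := (hcont.integral_hasStrictDerivAt 0 s).hasDerivAt.const_add y
  have hval_s : IccExtend (by norm_num : (-1 : ℝ) ≤ 1) (F.comp (γ (δ, y))) (δ⁻¹ * s) =
      f (γ (s, y) one) := by
    rw [← div_eq_inv_mul, IccExtend_of_mem _ _ hs']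
    have h1 := hresc ⟨s / δ, hs'⟩
    simp only [div_mul_cancel₀ s hδ.ne'] at h1
    rw [h1]
    simp [rescale, one, F]
  rw [hval_s] at hder
  refine hder.congr_of_eventuallyEq ?_
  filter_upwards [Ioo_mem_nhds hs.1 hs.2] with t ht using hval t ht

end LocalFlow

/-! ### Tangent vectors and vector fields in the preferred charts -/

section Charts

variable {m : ℕ} {M : Type*} [TopologicalSpace M] [ChartedSpace (EuclideanSpace ℝ (Fin m)) M]
  [IsManifold (𝓡 m) ∞ M]

theorem mfderiv_chart_symm_mfderiv_chart {x₀ z : M} (hz : z ∈ (extChartAt (𝓡 m) x₀).source)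
    (v : TangentSpace (𝓡 m) z) :
    mfderiv 𝓘(ℝ, EuclideanSpace ℝ (Fin m)) (𝓡 m) (extChartAt (𝓡 m) x₀).symm
      (extChartAt (𝓡 m) x₀ z) (mfderiv (𝓡 m) 𝓘(ℝ, EuclideanSpace ℝ (Fin m))
        (extChartAt (𝓡 m) x₀) z v) = v := by
  have : IsManifold (𝓡 m) 1 M := IsManifold.of_le (n := ∞) (by simp)
  rw [← mfderivWithin_univ, ← (𝓡 m).range_eq_univ]
  exact DFunLike.congr_fun
    (mfderivWithin_extChartAt_symm_comp_mfderiv_extChartAt' hz) v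

theorem mfderiv_chart_mfderiv_chart_symm {x₀ : M} {y : EuclideanSpace ℝ (Fin m)}
    (hy : y ∈ (extChartAt (𝓡 m) x₀).target) (w : EuclideanSpace ℝ (Fin m)) :
    mfderiv (𝓡 m) 𝓘(ℝ, EuclideanSpace ℝ (Fin m)) (extChartAt (𝓡 m) x₀)
      ((extChartAt (𝓡 m) x₀).symm y) (mfderiv 𝓘(ℝ, EuclideanSpace ℝ (Fin m)) (𝓡 m)
        (extChartAt (𝓡 m) x₀).symm y w) = w := by
  have : IsManifold (𝓡 m) 1 M := IsManifold.of_le (n := ∞) (by simp)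
  rw [← mfderivWithin_univ (f := (extChartAt (𝓡 m) x₀).symm), ← (𝓡 m).range_eq_univ]
  exact DFunLike.congr_fun (mfderiv_extChartAt_comp_mfderivWithin_extChartAt_symm hy) w

theorem contMDiffAt_chart_symm {x₀ : M} {y : EuclideanSpace ℝ (Fin m)}
    (hy : y ∈ (extChartAt (𝓡 m) x₀).target) :
    ContMDiffAt 𝓘(ℝ, EuclideanSpace ℝ (Fin m)) (𝓡 m) ∞ (extChartAt (𝓡 m) x₀).symm y :=
  (contMDiffOn_extChartAt_symm x₀).contMDiffAt ((isOpen_extChartAt_target x₀).mem_nhds hy)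

theorem contMDiffAt_chart {x₀ z : M} (hz : z ∈ (extChartAt (𝓡 m) x₀).source) :
    ContMDiffAt (𝓡 m) 𝓘(ℝ, EuclideanSpace ℝ (Fin m)) ∞ (extChartAt (𝓡 m) x₀) z :=
  contMDiffAt_extChartAt' (by simpa using hz)

/-- A map to the tangent bundle is smooth as soon as its base point and its fiber coordinate in the
preferred chart are. -/
theorem contMDiffOn_tangentBundle_iff {F H N : Type*} [NormedAddCommGroup F] [NormedSpace ℝ F]
    [TopologicalSpace H] {J : ModelWithCorners ℝ F H} [TopologicalSpace N] [ChartedSpace H N]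
    {x₀ : M} {s : Set N} {f : N → TangentBundle (𝓡 m) M}
    (hf : ∀ x ∈ s, (f x).proj ∈ (extChartAt (𝓡 m) x₀).source) :
    ContMDiffOn J (𝓡 m).tangent ∞ f s ↔
      ContMDiffOn J (𝓡 m) ∞ (fun x => (f x).proj) s ∧
      ContMDiffOn J 𝓘(ℝ, EuclideanSpace ℝ (Fin m)) ∞
        (fun x => (mfderiv (𝓡 m) 𝓘(ℝ, EuclideanSpace ℝ (Fin m)) (extChartAt (𝓡 m) x₀) (f x).proj
          (f x).snd : EuclideanSpace ℝ (Fin m))) s := by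
  have : IsManifold (𝓡 m) 1 M := IsManifold.of_le (n := ∞) (by simp)
  let e := trivializationAt (EuclideanSpace ℝ (Fin m)) (TangentSpace (𝓡 m)) x₀
  have hb : ∀ x ∈ s, (f x).proj ∈ (chartAt (EuclideanSpace ℝ (Fin m)) x₀).source := by
    intro x hx
    simpa using hf x hx
  have h := e.contMDiffOn_iff (IB := 𝓡 m) (IM := J) (n := ∞) (f := f) (s := s) (fun x hx => by
    rw [e.mem_source]
    exact hb x hx)
  refine h.trans (and_congr_right fun _ => contMDiffOn_congr fun x hx => ?_)
  refine (?_ : _ = e.continuousLinearMapAt ℝ (f x).proj (f x).snd).trans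
    (DFunLike.congr_fun (TangentBundle.continuousLinearMapAt_trivializationAt (hb x hx)) (f x).snd)
  rw [Bundle.Trivialization.continuousLinearMapAt_apply,
    Bundle.Trivialization.coe_linearMapAt_of_mem _ (by exact hb x hx)]

/-- The expression of a vector field in the preferred chart at `x₀`. -/
noncomputable def fieldInChart (V : ∀ x : M, TangentSpace (𝓡 m) x) (x₀ : M)
    (y : EuclideanSpace ℝ (Fin m)) : EuclideanSpace ℝ (Fin m) :=
  mfderiv (𝓡 m) 𝓘(ℝ, EuclideanSpace ℝ (Fin m)) (extChartAt (𝓡 m) x₀)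
    ((extChartAt (𝓡 m) x₀).symm y) (V ((extChartAt (𝓡 m) x₀).symm y))

theorem contDiffOn_fieldInChart {V : ∀ x : M, TangentSpace (𝓡 m) x}
    (hV : ContMDiff (𝓡 m) (𝓡 m).tangent ∞ (fun x => (⟨x, V x⟩ : TangentBundle (𝓡 m) M))) (x₀ : M) :
    ContDiffOn ℝ ∞ (fieldInChart V x₀) (extChartAt (𝓡 m) x₀).target := by
  rw [← contMDiffOn_iff_contDiffOn]
  exact ((contMDiffOn_tangentBundle_iff (x₀ := x₀)
    (fun y hy => (extChartAt (𝓡 m) x₀).map_target hy)).1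
    (hV.comp_contMDiffOn (contMDiffOn_extChartAt_symm x₀))).2

end Charts

/-! ### The flow of a smooth vector field on a compact manifold -/

section Flow

variable {m : ℕ} {M : Type*} [TopologicalSpace M] [ChartedSpace (EuclideanSpace ℝ (Fin m)) M]
  [IsManifold (𝓡 m) ∞ M]

/-- Cutting off a smooth map, one obtains a globally defined Lipschitz smooth map with the same
germ. -/
theorem ContDiffOn.exists_global_eventuallyEq {E F : Type*} [NormedAddCommGroup E]
    [InnerProductSpace ℝ E] [FiniteDimensional ℝ E] [NormedAddCommGroup F] [NormedSpace ℝ F]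
    {f : E → F} {s : Set E} (hs : IsOpen s) (hf : ContDiffOn ℝ ∞ f s) {y₀ : E} (hy₀ : y₀ ∈ s) :
    ∃ g : E → F, ContDiff ℝ ∞ g ∧ (∃ L, LipschitzWith L g) ∧ g =ᶠ[𝓝 y₀] f := by
  obtain ⟨r, hr, hball⟩ := Metric.isOpen_iff.1 hs y₀ hy₀
  let χ : ContDiffBump y₀ := ⟨r / 4, r / 2, by positivity, by linarith⟩
  have hsub : Metric.closedBall y₀ (r / 2) ⊆ s :=
    (Metric.closedBall_subset_ball (by linarith)).trans hball
  have hg : ContDiff ℝ ∞ (fun y => χ y • f y) := by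
    rw [contDiff_iff_contDiffAt]
    intro y
    by_cases hy : y ∈ s
    · exact χ.contDiff.contDiffAt.smul (hf.contDiffAt (hs.mem_nhds hy))
    · have hy' : y ∉ tsupport χ := fun h => hy (hsub (χ.tsupport_eq ▸ h))
      refine (contDiffAt_const (c := (0 : F))).congr_of_eventuallyEq ?_
      filter_upwards [(isClosed_tsupport χ).isOpen_compl.mem_nhds hy'] with z hz
      rw [image_eq_zero_of_notMem_tsupport hz, zero_smul]
  refine ⟨fun y => χ y • f y, hg, ?_, ?_⟩
  · exact ContDiff.lipschitzWith_of_hasCompactSupport (χ.hasCompactSupport.smul_right) hg (by simp)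
  · filter_upwards [χ.eventuallyEq_one] with y hy
    simp [hy]

/-- Local flows of smooth vector fields are smooth in time and space together. -/
theorem exists_smooth_localFlow_manifold {V : ∀ x : M, TangentSpace (𝓡 m) x}
    (hV : ContMDiff (𝓡 m) (𝓡 m).tangent ∞ (fun x => (⟨x, V x⟩ : TangentBundle (𝓡 m) M))) (x₀ : M) :
    ∃ Φ : ℝ × M → M, ContMDiffAt (𝓘(ℝ, ℝ).prod (𝓡 m)) (𝓡 m) ∞ Φ (0, x₀) ∧
      ∃ ε > 0, ∀ᶠ x in 𝓝 x₀, Φ (0, x) = x ∧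
        IsMIntegralCurveOn (fun t => Φ (t, x)) V (Ioo (-ε) ε) := by
  set φ := extChartAt (𝓡 m) x₀ with hφ
  have hy₀ : φ x₀ ∈ φ.target := mem_extChartAt_target x₀
  have htarget : IsOpen φ.target := isOpen_extChartAt_target x₀
  obtain ⟨f, hf, ⟨L, hL⟩, hfV⟩ :=
    (contDiffOn_fieldInChart hV x₀).exists_global_eventuallyEq htarget hy₀
  obtain ⟨Ψ, hΨ, δ, hδ, hΨflow⟩ := exists_smooth_localFlow f hf hL (φ x₀)
  have hΨ0 : Ψ (0, φ x₀) = φ x₀ := (hΨflow _ (Metric.mem_ball_self hδ)).1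
  have hφ₀ : ContMDiffAt (𝓡 m) 𝓘(ℝ, EuclideanSpace ℝ (Fin m)) ∞ φ x₀ :=
    contMDiffAt_chart (mem_extChartAt_source x₀)
  refine ⟨fun p => φ.symm (Ψ (p.1, φ p.2)), ?_, ?_⟩
  · have h1 : ContMDiffAt (𝓘(ℝ, ℝ).prod (𝓡 m)) (𝓘(ℝ, ℝ × EuclideanSpace ℝ (Fin m))) ∞
        (fun p : ℝ × M => (p.1, φ p.2)) (0, x₀) :=
      contMDiffAt_fst.prodMk_space (hφ₀.comp (0, x₀) contMDiffAt_snd)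
    have h2 : ContMDiffAt (𝓘(ℝ, ℝ).prod (𝓡 m)) 𝓘(ℝ, EuclideanSpace ℝ (Fin m)) ∞
        (fun p : ℝ × M => Ψ (p.1, φ p.2)) (0, x₀) :=
      ContMDiffAt.comp (0, x₀) hΨ.contMDiffAt h1
    refine ContMDiffAt.comp (0, x₀) (g := φ.symm) ?_ h2
    exact contMDiffAt_chart_symm (by rw [hΨ0]; exact hy₀)
  -- near `(0, x₀)` the flow stays where `f` is the expression of `V`
  have hgood : ∀ᶠ y in 𝓝 (φ x₀), y ∈ φ.target ∧ f y = fieldInChart V x₀ y :=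
    (htarget.eventually_mem hy₀).and hfV
  have hgood' : ∀ᶠ p in 𝓝 ((0 : ℝ), φ x₀), Ψ p ∈ φ.target ∧ f (Ψ p) = fieldInChart V x₀ (Ψ p) :=
    hΨ.continuousAt.eventually (by rwa [hΨ0])
  obtain ⟨ε, hε, hball⟩ := Metric.eventually_nhds_iff_ball.1 hgood'
  refine ⟨min ε δ, lt_min hε hδ, ?_⟩
  filter_upwards [hφ₀.continuousAt.eventually
    (Metric.ball_mem_nhds _ (lt_min hε hδ)), (isOpen_extChartAt_source x₀ : IsOpen φ.source).mem_nhds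
      (mem_extChartAt_source x₀)] with x hx hxs
  have hxδ : φ x ∈ Metric.ball (φ x₀) δ := Metric.ball_subset_ball (min_le_right _ _) hx
  refine ⟨?_, fun t ht => ?_⟩
  · rw [(hΨflow _ hxδ).1]
    exact φ.left_inv hxs
  have htδ : t ∈ Ioo (-δ) δ := abs_lt.1 ((abs_lt.2 ht).trans_le (min_le_right _ _))
  have hp : (t, φ x) ∈ Metric.ball ((0 : ℝ), φ x₀) ε := by
    rw [← ball_prod_same]
    refine ⟨?_, Metric.ball_subset_ball (min_le_left _ _) hx⟩
    simpa using (abs_lt.2 ht).trans_le (min_le_left _ _)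
  obtain ⟨hp1, hp2⟩ := hball _ hp
  have hder := (hΨflow _ hxδ).2 t htδ
  rw [hp2] at hder
  have hd := (contMDiffAt_chart_symm hp1).mdifferentiableAt (by simp) |>.hasMFDerivAt
  have hcomp := HasMFDerivAt.comp t hd hder.hasFDerivAt.hasMFDerivAt
  refine (hcomp.congr_mfderiv ?_).hasMFDerivWithinAt
  refine ContinuousLinearMap.ext_ring ?_
  have h3 := mfderiv_chart_symm_mfderiv_chart (φ.map_target hp1) (V (φ.symm (Ψ (t, φ x))))
  rw [φ.right_inv hp1] at h3
  have e1 : ContinuousLinearMap.toSpanSingleton ℝ (fieldInChart V x₀ (Ψ (t, φ x))) 1 =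
      fieldInChart V x₀ (Ψ (t, φ x)) := by simp
  have e2 : (ContinuousLinearMap.smulRight (1 : ℝ →L[ℝ] ℝ) (V (φ.symm (Ψ (t, φ x))))) 1 =
      V (φ.symm (Ψ (t, φ x))) := by simp
  exact ((congrArg _ e1).trans h3).trans e2.symm

/-- Smooth vector fields on compact manifolds have smooth global flows. By compactness the integral
curves exist, and the flow is smooth, on a uniform time interval; the group property of the flow
extends both to all times. -/
theorem exists_smooth_flow [T2Space M] [CompactSpace M] {V : ∀ x : M, TangentSpace (𝓡 m) x}
    (hV : ContMDiff (𝓡 m) (𝓡 m).tangent ∞ (fun x => (⟨x, V x⟩ : TangentBundle (𝓡 m) M))) :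
    ∃ Φ : ℝ × M → M, ContMDiff (𝓘(ℝ, ℝ).prod (𝓡 m)) (𝓡 m) ∞ Φ ∧ (∀ x, Φ (0, x) = x) ∧
      (∀ s t x, Φ (s + t, x) = Φ (s, Φ (t, x))) ∧
      ∀ x, IsMIntegralCurve (fun t => Φ (t, x)) V := by
  have : IsManifold (𝓡 m) 1 M := IsManifold.of_le (n := ∞) (by simp)
  have hV1 : ContMDiff (𝓡 m) (𝓡 m).tangent 1 (fun x => (⟨x, V x⟩ : TangentBundle (𝓡 m) M)) :=
    hV.of_le (by simp)
  choose Φ hΦ ε hε hloc using exists_smooth_localFlow_manifold hV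
  obtain ⟨δ, hδ, hunif⟩ : ∃ δ > 0, ∀ x : M, ∃ γ : ℝ → M, γ 0 = x ∧
      IsMIntegralCurveOn γ V (Ioo (-δ) δ) := by
    have h : ∀ᶠ δ in 𝓝 (0 : ℝ), ∀ x ∈ (univ : Set M), ∃ γ : ℝ → M, γ 0 = x ∧
        IsMIntegralCurveOn γ V (Ioo (-δ) δ) := by
      refine isCompact_univ.eventually_forall_of_forall_eventually fun x₀ _ => ?_
      rw [nhds_prod_eq]
      have h0 : ∀ᶠ δ in 𝓝 (0 : ℝ), δ < ε x₀ := Iio_mem_nhds (hε x₀)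
      filter_upwards [h0.prod_mk (hloc x₀)] with p hp
      exact ⟨_, hp.2.1, hp.2.2.mono (Ioo_subset_Ioo (neg_le_neg hp.1.le) hp.1.le)⟩
    obtain ⟨r, hr, hball⟩ := Metric.eventually_nhds_iff_ball.1 h
    exact ⟨r / 2, half_pos hr, fun x => hball _ (by
      rw [Metric.mem_ball, dist_zero_right, Real.norm_of_nonneg (by positivity)]; linarith) x trivial⟩
  choose γ hγ0 hγ using exists_isMIntegralCurve_of_isMIntegralCurveOn hV1 hδ hunif
  have hadd : ∀ s t x, γ x (s + t) = γ (γ x t) s := by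
    intro s t x
    have h := isMIntegralCurve_Ioo_eq_of_contMDiff_boundaryless (t₀ := 0) hV1
      ((hγ x).comp_add t) (hγ (γ x t)) (by simp [hγ0])
    exact congrFun h s
  let Fl : ℝ × M → M := fun p => γ p.2 p.1
  have hzero : ∀ x₀, ContMDiffAt (𝓘(ℝ, ℝ).prod (𝓡 m)) (𝓡 m) ∞ Fl (0, x₀) := by
    intro x₀
    refine (hΦ x₀).congr_of_eventuallyEq ?_
    have h0 : Ioo (-ε x₀) (ε x₀) ∈ 𝓝 (0 : ℝ) := Ioo_mem_nhds (neg_lt_zero.2 (hε x₀)) (hε x₀)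
    have h1 : ∀ᶠ t in 𝓝 (0 : ℝ), t ∈ Ioo (-ε x₀) (ε x₀) := h0
    rw [Filter.EventuallyEq, nhds_prod_eq]
    filter_upwards [h1.prod_mk (hloc x₀)] with p hp
    exact isMIntegralCurveOn_Ioo_eqOn_of_contMDiff_boundaryless (t₀ := 0)
      ⟨neg_lt_zero.2 (hε x₀), hε x₀⟩ hV1 ((hγ p.2).isMIntegralCurveOn _) hp.2.2
      ((hγ0 p.2).trans hp.2.1.symm) hp.1
  refine ⟨Fl, contMDiff_infty.2 fun n => ?_, hγ0, hadd, hγ⟩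
  have hsmall : ∀ᶠ t in 𝓝 (0 : ℝ), ∀ x ∈ (univ : Set M),
      ContMDiffAt (𝓘(ℝ, ℝ).prod (𝓡 m)) (𝓡 m) n Fl (t, x) := by
    have : IsManifold (𝓡 m) n M := IsManifold.of_le (n := ∞) (by exact_mod_cast le_top)
    refine isCompact_univ.eventually_forall_of_forall_eventually fun x₀ _ => ?_
    have h1 : ContMDiffAt (𝓘(ℝ, ℝ).prod (𝓡 m)) (𝓡 m) n Fl (0, x₀) :=
      (hzero x₀).of_le (by exact_mod_cast le_top)
    exact ((contMDiffAt_iff_contMDiffAt_nhds (by simp)).1 h1)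
  -- smoothness propagates along the flow by the group property
  have hstep : ∀ s t, (∀ x, ContMDiffAt (𝓘(ℝ, ℝ).prod (𝓡 m)) (𝓡 m) n Fl (s, x)) →
      (∀ x, ContMDiffAt (𝓘(ℝ, ℝ).prod (𝓡 m)) (𝓡 m) n Fl (t, x)) →
      ∀ x, ContMDiffAt (𝓘(ℝ, ℝ).prod (𝓡 m)) (𝓡 m) n Fl (s + t, x) := by
    intro s t hs ht x
    have h1 : Fl = fun p => Fl (p.1 - t, Fl (t, p.2)) := by
      funext p
      have := hadd (p.1 - t) t p.2
      rwa [sub_add_cancel] at this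
    rw [h1]
    have h2 : ContMDiffAt (𝓘(ℝ, ℝ).prod (𝓡 m)) (𝓡 m) n (fun p : ℝ × M => Fl (t, p.2)) (s + t, x) :=
      (ht x).comp (s + t, x) (contMDiffAt_const.prodMk contMDiffAt_snd)
    have h3 : ContMDiffAt (𝓘(ℝ, ℝ).prod (𝓡 m)) 𝓘(ℝ, ℝ) n (fun p : ℝ × M => p.1 - t) (s + t, x) :=
      contMDiffAt_fst.sub contMDiffAt_const
    have h4 := hs (Fl (t, x))
    exact ContMDiffAt.comp (s + t, x) (g := Fl) (by simpa using h4) (h3.prodMk h2)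
  obtain ⟨r, hr, hball⟩ := Metric.eventually_nhds_iff_ball.1 hsmall
  rintro ⟨t, x⟩
  obtain ⟨N, hN⟩ := exists_nat_gt (|t| / r)
  have hNpos : 0 < (N : ℝ) := (by positivity : 0 ≤ |t| / r).trans_lt hN
  have hstart : ∀ x, ContMDiffAt (𝓘(ℝ, ℝ).prod (𝓡 m)) (𝓡 m) n Fl (t / N, x) := fun x => by
    refine hball _ ?_ x trivial
    rw [Metric.mem_ball, dist_zero_right, norm_div, Real.norm_eq_abs, Real.norm_natCast,
      div_lt_iff₀ hNpos, mul_comm]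
    exact (div_lt_iff₀ hr).1 hN
  have hall : ∀ k : ℕ, ∀ x, ContMDiffAt (𝓘(ℝ, ℝ).prod (𝓡 m)) (𝓡 m) n Fl (k * (t / N), x) := by
    intro k
    induction k with
    | zero =>
      intro x
      rw [Nat.cast_zero, zero_mul]
      exact (hzero x).of_le (by exact_mod_cast le_top)
    | succ k ih =>
      intro x
      rw [Nat.cast_succ, add_mul, one_mul]
      exact hstep _ _ ih hstart x
  have h := hall N x
  rwa [mul_div_cancel₀ t hNpos.ne'] at h

end Flow

/-! ### One-forms in charts and their exterior derivatives -/

section ExteriorDerivative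

variable {E F : Type*} [NormedAddCommGroup E] [NormedSpace ℝ E] [NormedAddCommGroup F]
  [NormedSpace ℝ F]

/-- The exterior derivative of a 1-form on a normed space, as a bilinear map. -/
noncomputable def extDerivOneForm (β : E → E →L[ℝ] ℝ) (y : E) : E →L[ℝ] E →L[ℝ] ℝ :=
  fderiv ℝ β y - (fderiv ℝ β y).flip

theorem extDerivOneForm_apply (β : E → E →L[ℝ] ℝ) (y v w : E) :
    extDerivOneForm β y v w = fderiv ℝ β y v w - fderiv ℝ β y w v := rfl

/-- The exterior derivative of 1-forms commutes with pullbacks: the second derivative of the map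
is symmetric and drops out. -/
theorem extDerivOneForm_pullback {β : F → F →L[ℝ] ℝ} {τ : E → F} {y : E}
    (hτ : ContDiffAt ℝ 2 τ y) (hβ : DifferentiableAt ℝ β (τ y)) (v w : E) :
    extDerivOneForm (fun y => (β (τ y)).comp (fderiv ℝ τ y)) y v w =
      extDerivOneForm β (τ y) (fderiv ℝ τ y v) (fderiv ℝ τ y w) := by
  have hτ1 : DifferentiableAt ℝ τ y := hτ.differentiableAt (by simp)
  have hτ2 : DifferentiableAt ℝ (fderiv ℝ τ) y :=
    (hτ.fderiv_right (m := 1) (by norm_num)).differentiableAt (by simp)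
  have hd := (hβ.hasFDerivAt.comp y hτ1.hasFDerivAt).clm_comp hτ2.hasFDerivAt
  have hsymm : fderiv ℝ (fderiv ℝ τ) y v w = fderiv ℝ (fderiv ℝ τ) y w v :=
    (hτ.isSymmSndFDerivAt (by simp)).eq v w
  have e : fderiv ℝ (fun y => (β (τ y)).comp (fderiv ℝ τ y)) y = _ := hd.fderiv
  simp only [extDerivOneForm_apply, e]
  simp [hsymm]

end ExteriorDerivative

section OneFormsInCharts

variable {m : ℕ} {M : Type*} [TopologicalSpace M] [ChartedSpace (EuclideanSpace ℝ (Fin m)) M]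
  [IsManifold (𝓡 m) ∞ M]

theorem OneForm.inChart_apply_mfderiv (α : OneForm m M) {x₀ : M} {y : EuclideanSpace ℝ (Fin m)}
    (hy : y ∈ (extChartAt (𝓡 m) x₀).target)
    (u : TangentSpace (𝓡 m) ((extChartAt (𝓡 m) x₀).symm y)) :
    α.inChart x₀ y (mfderiv (𝓡 m) 𝓘(ℝ, EuclideanSpace ℝ (Fin m)) (extChartAt (𝓡 m) x₀)
      ((extChartAt (𝓡 m) x₀).symm y) u) = α ((extChartAt (𝓡 m) x₀).symm y) u := by
  have h := mfderiv_chart_symm_mfderiv_chart ((extChartAt (𝓡 m) x₀).map_target hy) u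
  rw [(extChartAt (𝓡 m) x₀).right_inv hy] at h
  exact congrArg (α ((extChartAt (𝓡 m) x₀).symm y)) h

theorem OneForm.apply_eq_inChart (α : OneForm m M) {x₀ z : M}
    (hz : z ∈ (extChartAt (𝓡 m) x₀).source) (u : TangentSpace (𝓡 m) z) :
    α z u = α.inChart x₀ (extChartAt (𝓡 m) x₀ z)
      (mfderiv (𝓡 m) 𝓘(ℝ, EuclideanSpace ℝ (Fin m)) (extChartAt (𝓡 m) x₀) z u) := by
  obtain ⟨y, hy, rfl⟩ : ∃ y ∈ (extChartAt (𝓡 m) x₀).target, (extChartAt (𝓡 m) x₀).symm y = z :=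
    ⟨_, (extChartAt (𝓡 m) x₀).map_source hz, (extChartAt (𝓡 m) x₀).left_inv hz⟩
  rw [(extChartAt (𝓡 m) x₀).right_inv hy]
  exact (α.inChart_apply_mfderiv hy u).symm

theorem OneForm.IsSmooth.contDiffOn_inChart {α : OneForm m M} (hα : α.IsSmooth) (x₀ : M) :
    ContDiffOn ℝ ∞ (α.inChart x₀) (extChartAt (𝓡 m) x₀).target := by
  rw [contDiffOn_clm_apply]
  intro w
  rw [← contMDiffOn_iff_contDiffOn]
  -- in the chart at `x₀`, the coordinate vector fields have constant coordinates
  have h : ContMDiffOn 𝓘(ℝ, EuclideanSpace ℝ (Fin m)) (𝓡 m).tangent ∞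
      (fun y => (⟨(extChartAt (𝓡 m) x₀).symm y, mfderiv 𝓘(ℝ, EuclideanSpace ℝ (Fin m)) (𝓡 m)
        (extChartAt (𝓡 m) x₀).symm y w⟩ : TangentBundle (𝓡 m) M)) (extChartAt (𝓡 m) x₀).target := by
    rw [contMDiffOn_tangentBundle_iff (x₀ := x₀)
      (fun y hy => (extChartAt (𝓡 m) x₀).map_target hy)]
    refine ⟨contMDiffOn_extChartAt_symm x₀, ?_⟩
    refine (contMDiffOn_const (c := w)).congr fun y hy => ?_
    exact mfderiv_chart_mfderiv_chart_symm hy w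
  exact hα.comp_contMDiffOn h

theorem OneForm.IsSmooth.contDiffAt_inChart {α : OneForm m M} (hα : α.IsSmooth) {x₀ : M}
    {y : EuclideanSpace ℝ (Fin m)} (hy : y ∈ (extChartAt (𝓡 m) x₀).target) :
    ContDiffAt ℝ ∞ (α.inChart x₀) y :=
  (hα.contDiffOn_inChart x₀).contDiffAt ((isOpen_extChartAt_target x₀).mem_nhds hy)

/-- The exterior derivative, defined in the preferred chart at each point, can be computed in any
preferred chart. -/
theorem OneForm.IsSmooth.extDerivAt_eq {α : OneForm m M} (hα : α.IsSmooth) {x₀ x : M}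
    (hx : x ∈ (extChartAt (𝓡 m) x₀).source) (v w : TangentSpace (𝓡 m) x) :
    α.extDerivAt x v w = extDerivOneForm (α.inChart x₀) (extChartAt (𝓡 m) x₀ x)
      (mfderiv (𝓡 m) 𝓘(ℝ, EuclideanSpace ℝ (Fin m)) (extChartAt (𝓡 m) x₀) x v)
      (mfderiv (𝓡 m) 𝓘(ℝ, EuclideanSpace ℝ (Fin m)) (extChartAt (𝓡 m) x₀) x w) := by
  have : IsManifold (𝓡 m) 1 M := IsManifold.of_le (n := ∞) (by simp)
  set φ := extChartAt (𝓡 m) x₀ with hφ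
  set ψ := extChartAt (𝓡 m) x with hψ
  have hyt : ψ x ∈ ψ.target := mem_extChartAt_target x
  have hyx : ψ.symm (ψ x) = x := ψ.left_inv (mem_extChartAt_source x)
  let τ : EuclideanSpace ℝ (Fin m) → EuclideanSpace ℝ (Fin m) := fun y => φ (ψ.symm y)
  have hτy : τ (ψ x) = φ x := by simp only [τ, hyx]
  have hnear : ∀ᶠ y in 𝓝 (ψ x), y ∈ ψ.target ∧ ψ.symm y ∈ φ.source := by
    refine ((isOpen_extChartAt_target x : IsOpen ψ.target).eventually_mem hyt).and ?_
    refine (contMDiffAt_chart_symm hyt).continuousAt.eventually_mem ?_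
    rw [← hψ, hyx]
    exact (isOpen_extChartAt_source x₀).mem_nhds hx
  have hτs : ContDiffAt ℝ ∞ τ (ψ x) := by
    rw [← contMDiffAt_iff_contDiffAt]
    refine ContMDiffAt.comp (ψ x) (g := φ) ?_ (contMDiffAt_chart_symm hyt)
    rw [hyx]
    exact contMDiffAt_chart hx
  have hτ' : ∀ y, y ∈ ψ.target → ψ.symm y ∈ φ.source → ∀ w, fderiv ℝ τ y w =
      mfderiv (𝓡 m) 𝓘(ℝ, EuclideanSpace ℝ (Fin m)) φ (ψ.symm y)
        (mfderiv 𝓘(ℝ, EuclideanSpace ℝ (Fin m)) (𝓡 m) ψ.symm y w) := by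
    intro y hy hy' w
    rw [← mfderiv_eq_fderiv]
    have h := mfderiv_comp y ((contMDiffAt_chart hy').mdifferentiableAt (by simp))
      ((contMDiffAt_chart_symm hy).mdifferentiableAt (by simp))
    exact DFunLike.congr_fun h w
  have hpull : α.inChart x =ᶠ[𝓝 (ψ x)] fun y => (α.inChart x₀ (τ y)).comp (fderiv ℝ τ y) := by
    filter_upwards [hnear] with y hy
    ext1 w
    rw [ContinuousLinearMap.comp_apply, hτ' y hy.1 hy.2]
    exact α.apply_eq_inChart hy.2 _
  have hsymm : ∀ w, mfderiv 𝓘(ℝ, EuclideanSpace ℝ (Fin m)) (𝓡 m) ψ.symm (ψ x) w = w := by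
    intro w
    rw [← mfderivWithin_univ, ← (𝓡 m).range_eq_univ]
    exact DFunLike.congr_fun (mfderivWithin_range_extChartAt_symm (x := x)) w
  let T : M → EuclideanSpace ℝ (Fin m) →L[ℝ] EuclideanSpace ℝ (Fin m) :=
    fun z => mfderiv (𝓡 m) 𝓘(ℝ, EuclideanSpace ℝ (Fin m)) φ z
  have hτx : ∀ w, fderiv ℝ τ (ψ x) w = T x w := by
    intro w
    refine (hτ' _ hyt (by rwa [hyx]) w).trans ((congrArg _ (hsymm w)).trans ?_)
    change T (ψ.symm (ψ x)) w = T x w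
    rw [hyx]
  have hext : extDerivOneForm (α.inChart x) (ψ x) =
      extDerivOneForm (fun y => (α.inChart x₀ (τ y)).comp (fderiv ℝ τ y)) (ψ x) := by
    simp only [extDerivOneForm, hpull.fderiv_eq]
  have key : ∀ v w : EuclideanSpace ℝ (Fin m), extDerivOneForm (α.inChart x) (ψ x) v w =
      extDerivOneForm (α.inChart x₀) (φ x) (T x v) (T x w) := by
    intro v w
    rw [hext, extDerivOneForm_pullback (hτs.of_le ENat.LEInfty.out)
      ((hα.contDiffAt_inChart (by rw [hτy]; exact φ.map_source hx)).differentiableAt (by simp)),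
      hτx, hτx, hτy]
  exact key v w

end OneFormsInCharts

/-! ### The Reeb vector field -/

section Reeb

section LinearAlgebra

variable {E : Type*} [NormedAddCommGroup E] [NormedSpace ℝ E]

/-- The operator `v ↦ η(v, ·) + b(v) b`, for a bilinear form `η` and a linear form `b`. For
`η = dα` and `b = α`, with `α` a contact form, it is invertible and maps the Reeb vector to `α`. -/
noncomputable def reebOperator (η : E →L[ℝ] E →L[ℝ] ℝ) (b : E →L[ℝ] ℝ) : E →L[ℝ] E →L[ℝ] ℝ :=
  η + b.smulRight b

theorem reebOperator_apply (η : E →L[ℝ] E →L[ℝ] ℝ) (b : E →L[ℝ] ℝ) (v w : E) :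
    reebOperator η b v w = η v w + b v * b w := rfl

variable [FiniteDimensional ℝ E]

theorem exists_equiv_reebOperator {η : E →L[ℝ] E →L[ℝ] ℝ} {b : E →L[ℝ] ℝ}
    (halt : ∀ v, η v v = 0)
    (hη : ∀ v, b v = 0 → v ≠ 0 → ∃ w, b w = 0 ∧ η v w ≠ 0) :
    ∃ e : E ≃L[ℝ] (E →L[ℝ] ℝ), (e : E →L[ℝ] E →L[ℝ] ℝ) = reebOperator η b := by
  have hinj : Function.Injective (reebOperator η b) := by
    rw [injective_iff_map_eq_zero]
    intro v hv
    have h : ∀ w, η v w + b v * b w = 0 := fun w => by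
      rw [← reebOperator_apply, hv]; rfl
    have hb : b v = 0 := by
      have := h v
      rw [halt, zero_add] at this
      exact mul_self_eq_zero.1 this
    by_contra hne
    obtain ⟨w, -, hw'⟩ := hη v hb hne
    have := h w
    rw [hb, zero_mul, add_zero] at this
    exact hw' this
  have hdim : Module.finrank ℝ E = Module.finrank ℝ (E →L[ℝ] ℝ) := by
    rw [← LinearMap.toContinuousLinearMap.finrank_eq, Module.finrank_linearMap, Module.finrank_self,
      mul_one]
  exact ⟨(LinearEquiv.ofInjectiveOfFinrankEq (reebOperator η b : E →ₗ[ℝ] (E →L[ℝ] ℝ)) hinj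
    hdim).toContinuousLinearEquiv, by ext; rfl⟩

theorem exists_reeb_vector {η : E →L[ℝ] E →L[ℝ] ℝ} {b : E →L[ℝ] ℝ} (hb : b ≠ 0)
    (halt : ∀ v, η v v = 0) (hη : ∀ v, b v = 0 → v ≠ 0 → ∃ w, b w = 0 ∧ η v w ≠ 0) :
    ∃ r, b r = 1 ∧ ∀ w, η r w = 0 := by
  obtain ⟨e, he⟩ := exists_equiv_reebOperator halt hη
  obtain ⟨r, hr⟩ := e.surjective b
  have h : ∀ w, η r w + b r * b w = b w := fun w => by
    rw [← reebOperator_apply, ← he]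
    exact DFunLike.congr_fun hr w
  have h1 : b r = 1 := by
    have h2 := h r
    rw [halt, zero_add] at h2
    rcases eq_or_ne (b r) 0 with h3 | h3
    swap
    · exact mul_right_cancel₀ h3 (h2.trans (one_mul _).symm)
    exfalso
    have hr0 : r ≠ 0 := by
      rintro rfl
      exact hb (by rw [← hr, map_zero])
    obtain ⟨w, hw, hw'⟩ := hη r h3 hr0
    have := h w
    rw [hw, mul_zero, add_zero] at this
    exact hw' this
  exact ⟨r, h1, fun w => by simpa [h1] using h w⟩

end LinearAlgebra

variable {m : ℕ} {M : Type*} [TopologicalSpace M] [ChartedSpace (EuclideanSpace ℝ (Fin m)) M]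
  [IsManifold (𝓡 m) ∞ M]

/-- `V` is the Reeb vector field of `α`: `α(V) = 1` and `dα(V, ·) = 0`. -/
def IsReebField (α : OneForm m M) (V : ∀ x : M, TangentSpace (𝓡 m) x) : Prop :=
  ∀ x, α x (V x) = 1 ∧ ∀ w, α.extDerivAt x (V x) w = 0

theorem IsContactFormFor.exists_isReebField {ξ : TangentDistribution m M} {α : OneForm m M}
    (hα : IsContactFormFor ξ α) : ∃ V, IsReebField α V := by
  have h : ∀ x, ∃ r : EuclideanSpace ℝ (Fin m), (α x : EuclideanSpace ℝ (Fin m) →L[ℝ] ℝ) r = 1 ∧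
      ∀ w, extDerivOneForm (α.inChart x) (extChartAt (𝓡 m) x x) r w = 0 := by
    intro x
    refine exists_reeb_vector (hα.ne_zero x) (fun v => sub_self _) (fun v hv hv0 => ?_)
    obtain ⟨w, hw, hw'⟩ := hα.nondegenerate x v ((hα.ker_eq x v).2 hv) hv0
    exact ⟨w, (hα.ker_eq x w).1 hw, hw'⟩
  choose V hV using h
  exact ⟨V, hV⟩

theorem IsContactFormFor.exists_equiv_reebOperator_inChart {ξ : TangentDistribution m M}
    {α : OneForm m M} (hα : IsContactFormFor ξ α) {x₀ : M} {y : EuclideanSpace ℝ (Fin m)}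
    (hy : y ∈ (extChartAt (𝓡 m) x₀).target) :
    ∃ e : EuclideanSpace ℝ (Fin m) ≃L[ℝ] (EuclideanSpace ℝ (Fin m) →L[ℝ] ℝ),
      (e : EuclideanSpace ℝ (Fin m) →L[ℝ] EuclideanSpace ℝ (Fin m) →L[ℝ] ℝ) =
        reebOperator (extDerivOneForm (α.inChart x₀) y) (α.inChart x₀ y) := by
  refine exists_equiv_reebOperator (fun v => sub_self _) (fun v hv hv0 => ?_)
  set φ := extChartAt (𝓡 m) x₀
  have hz := φ.map_target hy
  let v' : TangentSpace (𝓡 m) (φ.symm y) :=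
    mfderiv 𝓘(ℝ, EuclideanSpace ℝ (Fin m)) (𝓡 m) φ.symm y v
  have hv' : mfderiv (𝓡 m) 𝓘(ℝ, EuclideanSpace ℝ (Fin m)) φ (φ.symm y) v' = v :=
    mfderiv_chart_mfderiv_chart_symm hy v
  have hv'0 : v' ≠ 0 := by
    intro h
    rw [h, map_zero] at hv'
    exact hv0 hv'.symm
  obtain ⟨w', hw1, hw2⟩ := hα.nondegenerate (φ.symm y) v' ((hα.ker_eq _ _).2 hv) hv'0
  refine ⟨mfderiv (𝓡 m) 𝓘(ℝ, EuclideanSpace ℝ (Fin m)) φ (φ.symm y) w', ?_, ?_⟩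
  · rw [α.inChart_apply_mfderiv hy]
    exact (hα.ker_eq _ _).1 hw1
  · rw [hα.smooth.extDerivAt_eq hz, hv', φ.right_inv hy] at hw2
    exact hw2

theorem IsReebField.fieldInChart {α : OneForm m M} {V : ∀ x : M, TangentSpace (𝓡 m) x}
    (hV : IsReebField α V) (hα : α.IsSmooth) {x₀ : M} {y : EuclideanSpace ℝ (Fin m)}
    (hy : y ∈ (extChartAt (𝓡 m) x₀).target) :
    α.inChart x₀ y (fieldInChart V x₀ y) = 1 ∧
      ∀ w, extDerivOneForm (α.inChart x₀) y (fieldInChart V x₀ y) w = 0 := by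
  refine ⟨(α.inChart_apply_mfderiv hy _).trans (hV _).1, fun w => ?_⟩
  have h := (hV ((extChartAt (𝓡 m) x₀).symm y)).2
    (mfderiv 𝓘(ℝ, EuclideanSpace ℝ (Fin m)) (𝓡 m) (extChartAt (𝓡 m) x₀).symm y w)
  rw [hα.extDerivAt_eq ((extChartAt (𝓡 m) x₀).map_target hy),
    mfderiv_chart_mfderiv_chart_symm hy, (extChartAt (𝓡 m) x₀).right_inv hy] at h
  exact h

theorem ContDiffOn.extDerivOneForm {E : Type*} [NormedAddCommGroup E] [NormedSpace ℝ E]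
    {β : E → E →L[ℝ] ℝ} {s : Set E} (hs : IsOpen s) (hβ : ContDiffOn ℝ ∞ β s) :
    ContDiffOn ℝ ∞ (extDerivOneForm β) s := by
  have hdβ : ContDiffOn ℝ ∞ (fderiv ℝ β) s := hβ.fderiv_of_isOpen hs (by simp)
  have hflip : ContDiff ℝ ∞ (fun A : E →L[ℝ] E →L[ℝ] ℝ => A.flip) :=
    (IsLinearMap.with_bound ⟨fun _ _ => rfl, fun _ _ => rfl⟩ 1
      (fun A => by rw [one_mul]; exact A.opNorm_flip.le)).contDiff
  exact hdβ.sub (hflip.comp_contDiffOn hdβ)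

/-- In a chart, the Reeb vector field is obtained from smooth data by inverting `reebOperator`. -/
theorem IsReebField.contDiffOn_fieldInChart {ξ : TangentDistribution m M} {α : OneForm m M}
    (hα : IsContactFormFor ξ α) {V : ∀ x : M, TangentSpace (𝓡 m) x} (hV : IsReebField α V)
    (x₀ : M) : ContDiffOn ℝ ∞ (_root_.fieldInChart V x₀) (extChartAt (𝓡 m) x₀).target := by
  have hβ := hα.smooth.contDiffOn_inChart x₀
  have hop : ContDiffOn ℝ ∞
      (fun y => reebOperator (extDerivOneForm (α.inChart x₀) y) (α.inChart x₀ y))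
      (extChartAt (𝓡 m) x₀).target :=
    (hβ.extDerivOneForm (isOpen_extChartAt_target x₀)).add (hβ.smulRight hβ)
  have hinv : ContDiffOn ℝ ∞ (fun y => ContinuousLinearMap.inverse
      (reebOperator (extDerivOneForm (α.inChart x₀) y) (α.inChart x₀ y)) (α.inChart x₀ y))
      (extChartAt (𝓡 m) x₀).target := by
    refine ContDiffOn.clm_apply (fun y hy => ?_) hβ
    obtain ⟨e, he⟩ := hα.exists_equiv_reebOperator_inChart hy
    have h1 := contDiffAt_map_inverse (n := ∞) e
    rw [he] at h1
    exact h1.comp_contDiffWithinAt y (hop y hy)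
  refine hinv.congr fun y hy => ?_
  obtain ⟨e, he⟩ := hα.exists_equiv_reebOperator_inChart hy
  rw [← he, ContinuousLinearMap.inverse_equiv, ContinuousLinearEquiv.coe_coe,
    ContinuousLinearEquiv.eq_symm_apply]
  obtain ⟨h1, h2⟩ := hV.fieldInChart hα.smooth hy
  ext1 w
  have h3 : e (_root_.fieldInChart V x₀ y) =
      reebOperator (extDerivOneForm (α.inChart x₀) y) (α.inChart x₀ y)
        (_root_.fieldInChart V x₀ y) := DFunLike.congr_fun he _
  rw [h3, reebOperator_apply, h1, h2, zero_add, one_mul]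

theorem contMDiff_of_contDiffOn_fieldInChart {V : ∀ x : M, TangentSpace (𝓡 m) x}
    (hV : ∀ x₀, ContDiffOn ℝ ∞ (fieldInChart V x₀) (extChartAt (𝓡 m) x₀).target) :
    ContMDiff (𝓡 m) (𝓡 m).tangent ∞ (fun x => (⟨x, V x⟩ : TangentBundle (𝓡 m) M)) := by
  intro x₀
  set φ := extChartAt (𝓡 m) x₀
  have hon : ContMDiffOn (𝓡 m) (𝓡 m).tangent ∞
      (fun x => (⟨x, V x⟩ : TangentBundle (𝓡 m) M)) φ.source := by
    rw [contMDiffOn_tangentBundle_iff (x₀ := x₀) (fun x hx => hx)]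
    refine ⟨contMDiffOn_id, ?_⟩
    have h := (hV x₀).contMDiffOn.comp (t := φ.target) (f := φ)
      (fun x hx => (contMDiffAt_chart hx).contMDiffWithinAt) φ.mapsTo
    refine h.congr fun x hx => ?_
    let W : M → EuclideanSpace ℝ (Fin m) :=
      fun z => mfderiv (𝓡 m) 𝓘(ℝ, EuclideanSpace ℝ (Fin m)) φ z (V z)
    exact congrArg W (φ.left_inv hx).symm
  exact hon.contMDiffAt ((isOpen_extChartAt_source x₀).mem_nhds (mem_extChartAt_source x₀))

theorem IsReebField.contMDiff {ξ : TangentDistribution m M} {α : OneForm m M}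
    (hα : IsContactFormFor ξ α) {V : ∀ x : M, TangentSpace (𝓡 m) x} (hV : IsReebField α V) :
    ContMDiff (𝓡 m) (𝓡 m).tangent ∞ (fun x => (⟨x, V x⟩ : TangentBundle (𝓡 m) M)) :=
  contMDiff_of_contDiffOn_fieldInChart (hV.contDiffOn_fieldInChart hα)

end Reeb

/-! ### The Reeb flow preserves the contact form -/

section ReebFlow

/-- Cartan's formula for a vector field `f` with flow `Ψ` and a 1-form `β` with `β(f) = 1` and
`dβ(f, ·) = 0`: the derivative at time `0` of the pullback of `β` under the flow vanishes. -/
theorem hasDerivAt_pullback_oneForm_flow {E : Type*} [NormedAddCommGroup E] [NormedSpace ℝ E]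
    {Ψ : ℝ × E → E} {f : E → E} {β : E → E →L[ℝ] ℝ} {y₀ : E} (hΨ : ContDiffAt ℝ 2 Ψ (0, y₀))
    (hf : DifferentiableAt ℝ f y₀) (hβ : DifferentiableAt ℝ β y₀)
    (hΨ0 : ∀ᶠ y in 𝓝 y₀, Ψ (0, y) = y)
    (hflow : ∀ᶠ p in 𝓝 ((0 : ℝ), y₀), fderiv ℝ Ψ p (1, 0) = f (Ψ p))
    (hβf : ∀ᶠ y in 𝓝 y₀, β y (f y) = 1) (hdβ : ∀ w, extDerivOneForm β y₀ (f y₀) w = 0) (w : E) :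
    HasDerivAt (fun s => β (Ψ (s, y₀)) (fderiv ℝ Ψ (s, y₀) (0, w))) 0 0 := by
  have hp : Ψ (0, y₀) = y₀ := hΨ0.self_of_nhds
  have hd1 : DifferentiableAt ℝ Ψ (0, y₀) := hΨ.differentiableAt (by simp)
  have hd2 : DifferentiableAt ℝ (fderiv ℝ Ψ) (0, y₀) :=
    (hΨ.fderiv_right (m := 1) (by norm_num)).differentiableAt (by simp)
  have hsymm : fderiv ℝ (fderiv ℝ Ψ) (0, y₀) (1, 0) (0, w) =
      fderiv ℝ (fderiv ℝ Ψ) (0, y₀) (0, w) (1, 0) :=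
    (hΨ.isSymmSndFDerivAt (by simp)).eq _ _
  have hw : fderiv ℝ Ψ (0, y₀) (0, w) = w := by
    have hl : HasFDerivAt (fun y : E => ((0 : ℝ), y)) (ContinuousLinearMap.inr ℝ ℝ E) y₀ :=
      hasFDerivAt_prodMk_right _ _
    have h1 := HasFDerivAt.comp y₀ hd1.hasFDerivAt hl
    have h2 : HasFDerivAt (Ψ ∘ fun y : E => ((0 : ℝ), y)) (ContinuousLinearMap.id ℝ E) y₀ :=
      (hasFDerivAt_id y₀).congr_of_eventuallyEq hΨ0
    exact DFunLike.congr_fun (h1.unique h2) w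
  have hmixed : fderiv ℝ (fderiv ℝ Ψ) (0, y₀) (0, w) (1, 0) = fderiv ℝ f y₀ w := by
    have hfd : DifferentiableAt ℝ f (Ψ (0, y₀)) := by rwa [hp]
    have h1 := HasFDerivAt.comp ((0 : ℝ), y₀) hfd.hasFDerivAt hd1.hasFDerivAt
    have h2 := hd2.hasFDerivAt.clm_apply (hasFDerivAt_const ((1 : ℝ), (0 : E)) ((0 : ℝ), y₀))
    have h3 := (h2.congr_of_eventuallyEq (f₁ := f ∘ Ψ) (hflow.mono fun p h => h.symm)).unique h1
    have h4 := DFunLike.congr_fun h3 ((0 : ℝ), w)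
    simpa [hp, hw] using h4
  have hl : HasDerivAt (fun s : ℝ => (s, y₀)) ((1 : ℝ), (0 : E)) 0 :=
    (hasDerivAt_id (0 : ℝ)).prodMk (hasDerivAt_const _ _)
  have hΨs : HasDerivAt (fun s : ℝ => Ψ (s, y₀)) (f y₀) 0 := by
    have h : HasDerivAt (fun s : ℝ => Ψ (s, y₀)) (fderiv ℝ Ψ (0, y₀) (1, 0)) 0 :=
      HasFDerivAt.comp_hasDerivAt (f := fun s : ℝ => (s, y₀)) (0 : ℝ) hd1.hasFDerivAt hl
    rwa [hflow.self_of_nhds, hp] at h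
  have hDs : HasDerivAt (fun s : ℝ => fderiv ℝ Ψ (s, y₀) (0, w)) (fderiv ℝ f y₀ w) 0 := by
    have h1 : HasDerivAt (fun s : ℝ => fderiv ℝ Ψ (s, y₀))
        (fderiv ℝ (fderiv ℝ Ψ) (0, y₀) (1, 0)) 0 :=
      HasFDerivAt.comp_hasDerivAt (f := fun s : ℝ => (s, y₀)) (0 : ℝ) hd2.hasFDerivAt hl
    have h2 := h1.clm_apply (hasDerivAt_const (0 : ℝ) ((0 : ℝ), w))
    rw [map_zero, add_zero, hsymm, hmixed] at h2
    exact h2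
  have hβs : HasDerivAt (fun s : ℝ => β (Ψ (s, y₀))) (fderiv ℝ β y₀ (f y₀)) 0 := by
    have hβ' : HasFDerivAt β (fderiv ℝ β y₀) (Ψ (0, y₀)) := by rw [hp]; exact hβ.hasFDerivAt
    exact HasFDerivAt.comp_hasDerivAt (f := fun s : ℝ => Ψ (s, y₀)) (0 : ℝ) hβ' hΨs
  have hone : fderiv ℝ β y₀ w (f y₀) + β y₀ (fderiv ℝ f y₀ w) = 0 := by
    have h1 := hβ.hasFDerivAt.clm_apply hf.hasFDerivAt
    have h2 : HasFDerivAt (fun y => β y (f y)) (0 : E →L[ℝ] ℝ) y₀ :=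
      (hasFDerivAt_const (1 : ℝ) y₀).congr_of_eventuallyEq hβf
    have h3 := DFunLike.congr_fun (h1.unique h2) w
    simpa [add_comm] using h3
  have h := hβs.clm_apply hDs
  rw [hp, hw] at h
  have h5 := hdβ w
  rw [extDerivOneForm_apply] at h5
  exact h.congr_deriv (by linarith)

variable {m : ℕ} {M : Type*} [TopologicalSpace M] [ChartedSpace (EuclideanSpace ℝ (Fin m)) M]
  [IsManifold (𝓡 m) ∞ M]

/-- The infinitesimal form of the invariance of the contact form under the Reeb flow, obtained in
the preferred chart at `x`. -/
theorem hasDerivAt_zero_pullback_reebFlow {α : OneForm m M} (hα : α.IsSmooth)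
    {V : ∀ x : M, TangentSpace (𝓡 m) x} (hVα : IsReebField α V)
    (hV : ContMDiff (𝓡 m) (𝓡 m).tangent ∞ (fun x => (⟨x, V x⟩ : TangentBundle (𝓡 m) M)))
    {Φ : ℝ × M → M} (hΦ : ContMDiff (𝓘(ℝ, ℝ).prod (𝓡 m)) (𝓡 m) ∞ Φ) (hΦ0 : ∀ x, Φ (0, x) = x)
    (hΦV : ∀ x, IsMIntegralCurve (fun t => Φ (t, x)) V) (x : M) (v : TangentSpace (𝓡 m) x) :
    HasDerivAt (fun s => α (Φ (s, x)) (mfderiv (𝓡 m) (𝓡 m) (fun x => Φ (s, x)) x v)) 0 0 := by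
  set φ := extChartAt (𝓡 m) x with hφ
  let Ψ : ℝ × EuclideanSpace ℝ (Fin m) → EuclideanSpace ℝ (Fin m) :=
    fun p => φ (Φ (p.1, φ.symm p.2))
  have hy₀ : φ x ∈ φ.target := mem_extChartAt_target x
  have hx₀ : φ.symm (φ x) = x := φ.left_inv (mem_extChartAt_source x)
  have hto : IsOpen φ.target := isOpen_extChartAt_target x
  have hso : IsOpen φ.source := isOpen_extChartAt_source x
  -- `Ψ` is the expression of the flow in the chart; it is smooth where it makes sense
  have hΨat : ∀ p : ℝ × EuclideanSpace ℝ (Fin m), p.2 ∈ φ.target →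
      Φ (p.1, φ.symm p.2) ∈ φ.source → ContDiffAt ℝ ∞ Ψ p := by
    rintro ⟨s, y⟩ hy hs
    rw [← contMDiffAt_iff_contDiffAt]
    have h1 : ContMDiffAt 𝓘(ℝ, ℝ × EuclideanSpace ℝ (Fin m)) (𝓘(ℝ, ℝ).prod (𝓡 m)) ∞
        (fun p : ℝ × EuclideanSpace ℝ (Fin m) => (p.1, φ.symm p.2)) (s, y) := by
      refine ContMDiffAt.prodMk contDiff_fst.contMDiff.contMDiffAt ?_
      exact ContMDiffAt.comp (s, y) (g := φ.symm) (contMDiffAt_chart_symm hy)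
        contDiff_snd.contMDiff.contMDiffAt
    have h2 : ContMDiffAt 𝓘(ℝ, ℝ × EuclideanSpace ℝ (Fin m)) (𝓡 m) ∞
        (fun p : ℝ × EuclideanSpace ℝ (Fin m) => Φ (p.1, φ.symm p.2)) (s, y) :=
      ContMDiffAt.comp (s, y) (g := Φ) hΦ.contMDiffAt h1
    exact ContMDiffAt.comp (s, y) (g := φ) (contMDiffAt_chart hs) h2
  have hgood : ∀ᶠ p in 𝓝 ((0 : ℝ), φ x), p.2 ∈ φ.target ∧ Φ (p.1, φ.symm p.2) ∈ φ.source := by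
    have hc : ContinuousAt (fun p : ℝ × EuclideanSpace ℝ (Fin m) => Φ (p.1, φ.symm p.2))
        (0, φ x) := by
      refine hΦ.continuous.continuousAt.comp (continuousAt_fst.prodMk ?_)
      exact ContinuousAt.comp (f := Prod.snd) (g := φ.symm) (x := ((0 : ℝ), φ x))
        (contMDiffAt_chart_symm hy₀).continuousAt continuousAt_snd
    refine (continuousAt_snd.eventually_mem (hto.mem_nhds hy₀)).and
      (hc.eventually_mem (hso.mem_nhds ?_))
    simp only [hx₀, hΦ0]
    exact mem_extChartAt_source x
  have hΨ : ContDiffAt ℝ ∞ Ψ (0, φ x) :=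
    hΨat _ hgood.self_of_nhds.1 hgood.self_of_nhds.2
  have hΨ0 : ∀ᶠ y in 𝓝 (φ x), Ψ (0, y) = y := by
    filter_upwards [hto.mem_nhds hy₀] with y hy
    change φ (Φ (0, φ.symm y)) = y
    rw [hΦ0, φ.right_inv hy]
  let T : M → EuclideanSpace ℝ (Fin m) →L[ℝ] EuclideanSpace ℝ (Fin m) :=
    fun z => mfderiv (𝓡 m) 𝓘(ℝ, EuclideanSpace ℝ (Fin m)) φ z
  have hflow : ∀ᶠ p in 𝓝 ((0 : ℝ), φ x), fderiv ℝ Ψ p (1, 0) = fieldInChart V x (Ψ p) := by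
    filter_upwards [hgood] with p hp
    obtain ⟨s, y⟩ := p
    have hl : HasDerivAt (fun s : ℝ => (s, y)) ((1 : ℝ), (0 : EuclideanSpace ℝ (Fin m))) s :=
      (hasDerivAt_id s).prodMk (hasDerivAt_const _ _)
    have h1 := HasFDerivAt.comp_hasDerivAt s
      ((hΨat _ hp.1 hp.2).differentiableAt (by simp)).hasFDerivAt hl
    have h2 := HasMFDerivAt.comp s
      ((contMDiffAt_chart hp.2).mdifferentiableAt (by simp)).hasMFDerivAt (hΦV (φ.symm y) s)
    have h3 := DFunLike.congr_fun (h1.hasFDerivAt.unique h2.hasFDerivAt) (1 : ℝ)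
    have h4 : fderiv ℝ Ψ (s, y) (1, 0) = T (Φ (s, φ.symm y)) (V (Φ (s, φ.symm y))) := by
      have e1 : ContinuousLinearMap.toSpanSingleton ℝ (fderiv ℝ Ψ (s, y) (1, 0)) 1 =
        fderiv ℝ Ψ (s, y) (1, 0) := by simp
      have e2 : ContinuousLinearMap.smulRight (1 : ℝ →L[ℝ] ℝ) (V (Φ (s, φ.symm y))) 1 =
        V (Φ (s, φ.symm y)) := by simp
      exact e1.symm.trans (h3.trans (congrArg (T (Φ (s, φ.symm y))) e2))
    rw [h4]
    exact congrArg (fun z => T z (V z)) (φ.left_inv hp.2).symm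
  have hβf : ∀ᶠ y in 𝓝 (φ x), α.inChart x y (fieldInChart V x y) = 1 := by
    filter_upwards [hto.mem_nhds hy₀] with y hy using (hVα.fieldInChart hα hy).1
  have hmain := hasDerivAt_pullback_oneForm_flow (hΨ.of_le ENat.LEInfty.out)
    (((contDiffOn_fieldInChart hV x).contDiffAt (hto.mem_nhds hy₀)).differentiableAt (by simp))
    ((hα.contDiffAt_inChart hy₀).differentiableAt (by simp)) hΨ0 hflow hβf
    (hVα.fieldInChart hα hy₀).2 (T x v)
  refine hmain.congr_of_eventuallyEq ?_
  have hl : ContinuousAt (fun s : ℝ => (s, φ x)) 0 := by fun_prop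
  filter_upwards [hl.eventually hgood] with s hs
  have hs2 : Φ (s, x) ∈ φ.source := by simpa only [hx₀] using hs.2
  rw [α.apply_eq_inChart hs2]
  have hr : HasFDerivAt (fun y : EuclideanSpace ℝ (Fin m) => (s, y))
      (ContinuousLinearMap.inr ℝ ℝ (EuclideanSpace ℝ (Fin m))) (φ x) := hasFDerivAt_prodMk_right _ _
  have h1 := HasFDerivAt.comp (φ x)
    ((hΨat _ hs.1 hs.2).differentiableAt (by simp)).hasFDerivAt hr
  have hΦs : ContMDiff (𝓡 m) (𝓡 m) ∞ (fun x => Φ (s, x)) :=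
    hΦ.comp (contMDiff_const.prodMk contMDiff_id)
  have h2 : HasMFDerivAt 𝓘(ℝ, EuclideanSpace ℝ (Fin m)) (𝓡 m) (fun y => Φ (s, φ.symm y)) (φ x) _ :=
    HasMFDerivAt.comp (f := φ.symm) (φ x) (hΦs.mdifferentiableAt (by simp)).hasMFDerivAt
      ((contMDiffAt_chart_symm hy₀).mdifferentiableAt (by simp)).hasMFDerivAt
  have h3 := HasMFDerivAt.comp (φ x)
    ((contMDiffAt_chart hs.2).mdifferentiableAt (by simp)).hasMFDerivAt h2
  have h4 := DFunLike.congr_fun (h1.unique h3.hasFDerivAt) (T x v)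
  have h5 : fderiv ℝ Ψ (s, φ x) (0, T x v) =
      mfderiv (𝓡 m) 𝓘(ℝ, EuclideanSpace ℝ (Fin m)) φ (Φ (s, φ.symm (φ x)))
        (mfderiv (𝓡 m) (𝓡 m) (fun x => Φ (s, x)) (φ.symm (φ x))
          (mfderiv 𝓘(ℝ, EuclideanSpace ℝ (Fin m)) (𝓡 m) φ.symm (φ x) (T x v))) := h4
  have h6 : mfderiv 𝓘(ℝ, EuclideanSpace ℝ (Fin m)) (𝓡 m) φ.symm (φ x) (T x v) = v :=
    mfderiv_chart_symm_mfderiv_chart (mem_extChartAt_source x) v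
  let S : M → EuclideanSpace ℝ (Fin m) →L[ℝ] EuclideanSpace ℝ (Fin m) :=
    fun z => mfderiv (𝓡 m) (𝓡 m) (fun x => Φ (s, x)) z
  have h7 : fderiv ℝ Ψ (s, φ x) (0, T x v) = T (Φ (s, x)) (S x v) := by
    rw [h5]
    refine (congrArg (fun u => T (Φ (s, φ.symm (φ x))) (S (φ.symm (φ x)) u)) h6).trans ?_
    simp only [hx₀]
  rw [h7]
  change _ = α.inChart x (φ (Φ (s, φ.symm (φ x)))) _
  rw [hx₀]
  rfl

/-- The flow of the Reeb vector field preserves the contact form. -/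
theorem pullback_reebFlow_eq {α : OneForm m M} (hα : α.IsSmooth)
    {V : ∀ x : M, TangentSpace (𝓡 m) x} (hVα : IsReebField α V)
    (hV : ContMDiff (𝓡 m) (𝓡 m).tangent ∞ (fun x => (⟨x, V x⟩ : TangentBundle (𝓡 m) M)))
    {Φ : ℝ × M → M} (hΦ : ContMDiff (𝓘(ℝ, ℝ).prod (𝓡 m)) (𝓡 m) ∞ Φ) (hΦ0 : ∀ x, Φ (0, x) = x)
    (hΦadd : ∀ s t x, Φ (s + t, x) = Φ (s, Φ (t, x)))
    (hΦV : ∀ x, IsMIntegralCurve (fun t => Φ (t, x)) V) (t : ℝ) (x : M)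
    (v : TangentSpace (𝓡 m) x) :
    α (Φ (t, x)) (mfderiv (𝓡 m) (𝓡 m) (fun x => Φ (t, x)) x v) = α x v := by
  let h : ∀ x : M, TangentSpace (𝓡 m) x → ℝ → ℝ := fun x v t =>
    α (Φ (t, x)) (mfderiv (𝓡 m) (𝓡 m) (fun x => Φ (t, x)) x v)
  have hΦs : ∀ s, ContMDiff (𝓡 m) (𝓡 m) ∞ (fun x => Φ (s, x)) := fun s =>
    hΦ.comp (contMDiff_const.prodMk contMDiff_id)
  have hshift : ∀ s t, h x v (s + t) =
      h (Φ (t, x)) (mfderiv (𝓡 m) (𝓡 m) (fun x => Φ (t, x)) x v) s := by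
    intro s t
    have e : (fun x => Φ (s + t, x)) = (fun x => Φ (s, x)) ∘ fun x => Φ (t, x) :=
      funext fun x => hΦadd s t x
    have h1 := mfderiv_comp x ((hΦs s).mdifferentiableAt (by simp))
      ((hΦs t).mdifferentiableAt (x := x) (by simp))
    refine (congrArg (fun f : M → M => α (f x) (mfderiv (𝓡 m) (𝓡 m) f x v)) e).trans ?_
    exact congrArg (α (Φ (s, Φ (t, x)))) (DFunLike.congr_fun h1 v)
  have hder : ∀ t, HasDerivAt (h x v) 0 t := by
    intro t
    have h1 := hasDerivAt_zero_pullback_reebFlow hα hVα hV hΦ hΦ0 hΦV (Φ (t, x))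
      (mfderiv (𝓡 m) (𝓡 m) (fun x => Φ (t, x)) x v)
    have h2 : h x v = fun τ =>
        h (Φ (t, x)) (mfderiv (𝓡 m) (𝓡 m) (fun x => Φ (t, x)) x v) (τ - t) := by
      funext τ
      rw [← hshift, sub_add_cancel]
    rw [h2]
    exact HasDerivAt.comp_sub_const t t (by rw [sub_self]; exact h1)
  have hconst := is_const_of_deriv_eq_zero (fun t => (hder t).differentiableAt)
    (fun t => (hder t).deriv) t 0
  refine hconst.trans ?_
  have e : (fun x => Φ (0, x)) = id := funext hΦ0
  refine (congrArg (fun f : M → M => α (f x) (mfderiv (𝓡 m) (𝓡 m) f x v)) e).trans ?_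
  rw [mfderiv_id]
  rfl

end ReebFlow

/-! ### Conformal exponents of families of contactomorphisms -/

section ConformalExponents

variable {m : ℕ} {M : Type*} [TopologicalSpace M] [ChartedSpace (EuclideanSpace ℝ (Fin m)) M]

theorem IsConformalExponent.unique {α : OneForm m M} (hα : ∀ x, α x ≠ 0) {φ : Equiv.Perm M}
    {g g' : M → ℝ} (h : IsConformalExponent α φ g) (h' : IsConformalExponent α φ g') : g = g' := by
  funext x
  obtain ⟨v, hv⟩ := DFunLike.ne_iff.1 (hα x)
  exact Real.exp_injective (mul_right_cancel₀ hv ((h x v).symm.trans (h' x v)))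

theorem IsConformalExponent.mul {α : OneForm m M} {φ ψ : Equiv.Perm M} {g g' : M → ℝ}
    (h : IsConformalExponent α φ g) (h' : IsConformalExponent α ψ g')
    (d : MDifferentiable (𝓡 m) (𝓡 m) φ) (d' : MDifferentiable (𝓡 m) (𝓡 m) ψ) :
    IsConformalExponent α (φ * ψ) (fun x => g (ψ x) + g' x) := by
  intro x v
  have e : mfderiv (𝓡 m) (𝓡 m) (φ * ψ) x
      = (mfderiv (𝓡 m) (𝓡 m) φ (ψ x)).comp (mfderiv (𝓡 m) (𝓡 m) ψ x) :=
    mfderiv_comp x (d (ψ x)) (d' x)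
  rw [e, Real.exp_add, mul_assoc, ← h' x v, ← h (ψ x)]
  rfl

theorem isConformalExponent_one (α : OneForm m M) : IsConformalExponent α 1 (fun _ => 0) := by
  intro x v
  have e : mfderiv (𝓡 m) (𝓡 m) ((1 : Equiv.Perm M) : M → M) x
      = ContinuousLinearMap.id ℝ (TangentSpace (𝓡 m) x) := mfderiv_id
  rw [e, Real.exp_zero, one_mul]
  rfl

theorem IsConformalExponent.inv {α : OneForm m M} {φ : Equiv.Perm M} {g : M → ℝ}
    (h : IsConformalExponent α φ g) (d : MDifferentiable (𝓡 m) (𝓡 m) φ)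
    (d' : MDifferentiable (𝓡 m) (𝓡 m) (φ⁻¹ : Equiv.Perm M)) :
    IsConformalExponent α φ⁻¹ (fun x => -g (φ⁻¹ x)) := by
  intro x v
  have e : mfderiv (𝓡 m) (𝓡 m) (φ * φ⁻¹ : Equiv.Perm M) x
      = (mfderiv (𝓡 m) (𝓡 m) φ (φ⁻¹ x)).comp
        (mfderiv (𝓡 m) (𝓡 m) (φ⁻¹ : Equiv.Perm M) x) :=
    mfderiv_comp x (d _) (d' _)
  have h1 := h (φ⁻¹ x) (mfderiv (𝓡 m) (𝓡 m) (φ⁻¹ : Equiv.Perm M) x v)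
  have h2 := isConformalExponent_one α x v
  rw [← mul_inv_cancel φ, e, Real.exp_zero, one_mul] at h2
  have h3 : α x v = Real.exp (g (φ⁻¹ x)) *
      α (φ⁻¹ x) (mfderiv (𝓡 m) (𝓡 m) (φ⁻¹ : Equiv.Perm M) x v) := by
    rw [← h1, ← h2]
    rfl
  rw [h3, ← mul_assoc, ← Real.exp_add, neg_add_cancel, Real.exp_zero, one_mul]

variable [IsManifold (𝓡 m) ∞ M]

section Families

variable {F K P : Type*} [NormedAddCommGroup F] [NormedSpace ℝ F] [TopologicalSpace K]
  {J : ModelWithCorners ℝ F K} [TopologicalSpace P] [ChartedSpace K P] [IsManifold J 1 P]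

/-- A smooth 1-form evaluated on the image of a product of smooth vector fields under the
differential of a smooth family of maps is smooth. -/
theorem OneForm.IsSmooth.contMDiff_apply_mfderiv {α : OneForm m M} (hα : α.IsSmooth)
    {f : P × M → M} (hf : ContMDiff (J.prod (𝓡 m)) (𝓡 m) ∞ f)
    {A : ∀ p : P, TangentSpace J p}
    (hA : ContMDiff J J.tangent ∞ (fun p => (⟨p, A p⟩ : TangentBundle J P)))
    {B : ∀ x : M, TangentSpace (𝓡 m) x}
    (hB : ContMDiff (𝓡 m) (𝓡 m).tangent ∞ (fun x => (⟨x, B x⟩ : TangentBundle (𝓡 m) M))) :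
    ContMDiff (J.prod (𝓡 m)) 𝓘(ℝ, ℝ) ∞
      (fun p : P × M => α (f p) (mfderiv J (𝓡 m) (fun t => f (t, p.2)) p.1 (A p.1) +
        mfderiv (𝓡 m) (𝓡 m) (fun x => f (p.1, x)) p.2 (B p.2))) := by
  have : IsManifold (𝓡 m) 1 M := IsManifold.of_le (n := ∞) (by simp)
  have h1 : ContMDiff (J.prod (𝓡 m)) (J.prod (𝓡 m)).tangent ∞ (fun p : P × M =>
      (equivTangentBundleProd J P (𝓡 m) M).symm (⟨p.1, A p.1⟩, ⟨p.2, B p.2⟩)) :=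
    contMDiff_equivTangentBundleProd_symm.comp
      ((hA.comp contMDiff_fst).prodMk (hB.comp contMDiff_snd))
  have h2 := ContMDiff.comp hα ((hf.contMDiff_tangentMap (m := ∞) (by simp)).comp h1)
  refine h2.congr fun p => ?_
  exact congrArg (α (f p)) (mfderiv_prod_eq_add_apply (p := p)
    (v := show TangentSpace (J.prod (𝓡 m)) p from (A p.1, B p.2)) (hf.mdifferentiableAt (by simp))).symm

theorem OneForm.IsSmooth.contMDiff_apply_mfderiv_right {α : OneForm m M} (hα : α.IsSmooth)
    {f : P × M → M} (hf : ContMDiff (J.prod (𝓡 m)) (𝓡 m) ∞ f)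
    {B : ∀ x : M, TangentSpace (𝓡 m) x}
    (hB : ContMDiff (𝓡 m) (𝓡 m).tangent ∞ (fun x => (⟨x, B x⟩ : TangentBundle (𝓡 m) M))) :
    ContMDiff (J.prod (𝓡 m)) 𝓘(ℝ, ℝ) ∞
      (fun p : P × M => α (f p) (mfderiv (𝓡 m) (𝓡 m) (fun x => f (p.1, x)) p.2 (B p.2))) := by
  have h := hα.contMDiff_apply_mfderiv hf (A := fun _ => 0)
    (Bundle.contMDiff_zeroSection ℝ (TangentSpace J)) hB
  refine h.congr fun p => congrArg (α (f p)) ?_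
  rw [map_zero, zero_add]

theorem OneForm.IsSmooth.contMDiff_apply_velocity {α : OneForm m M} (hα : α.IsSmooth)
    {f : ℝ × M → M} (hf : ContMDiff (𝓘(ℝ, ℝ).prod (𝓡 m)) (𝓡 m) ∞ f) :
    ContMDiff (𝓘(ℝ, ℝ).prod (𝓡 m)) 𝓘(ℝ, ℝ) ∞
      (fun p : ℝ × M => α (f p) (mfderiv 𝓘(ℝ, ℝ) (𝓡 m) (fun t => f (t, p.2)) p.1 (1 : ℝ))) := by
  have : IsManifold (𝓡 m) 1 M := IsManifold.of_le (n := ∞) (by simp)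
  have h := hα.contMDiff_apply_mfderiv hf (A := fun _ => (1 : ℝ))
    (contMDiff_vectorSpace_iff_contDiff.2 contDiff_const) (B := fun _ => 0)
    (Bundle.contMDiff_zeroSection ℝ (TangentSpace (𝓡 m)))
  refine h.congr fun p => congrArg (α (f p)) ?_
  rw [map_zero, add_zero]

/-- The differential of a contactomorphism rescales the contact form. -/
theorem PreservesDistribution.apply_mfderiv_eq {ξ : TangentDistribution m M} {α : OneForm m M}
    (hα : IsContactFormFor ξ α) {V : ∀ x : M, TangentSpace (𝓡 m) x} (hV : IsReebField α V)
    {φ : Equiv.Perm M} (hφ : PreservesDistribution ξ φ) (x : M) (v : TangentSpace (𝓡 m) x) :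
    α (φ x) (mfderiv (𝓡 m) (𝓡 m) φ x v) =
      α (φ x) (mfderiv (𝓡 m) (𝓡 m) φ x (V x)) * α x v := by
  have h1 : v - α x v • V x ∈ ξ x := by
    rw [hα.ker_eq, map_sub, map_smul, (hV x).1, smul_eq_mul, mul_one, sub_self]
  have h2 := (hα.ker_eq _ _).1 ((hφ x _).2 h1)
  rw [map_sub, map_sub, map_smul, map_smul, sub_eq_zero] at h2
  rw [h2, smul_eq_mul, mul_comm]

theorem PreservesDistribution.apply_mfderiv_reeb_ne_zero {ξ : TangentDistribution m M}
    {α : OneForm m M} (hα : IsContactFormFor ξ α) {V : ∀ x : M, TangentSpace (𝓡 m) x}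
    (hV : IsReebField α V) {φ : Equiv.Perm M} (hφ : PreservesDistribution ξ φ) (x : M) :
    α (φ x) (mfderiv (𝓡 m) (𝓡 m) φ x (V x)) ≠ 0 := by
  intro h
  have h1 := (hα.ker_eq _ _).1 ((hφ x _).1 ((hα.ker_eq _ _).2 h))
  rw [(hV x).1] at h1
  exact one_ne_zero h1

theorem IsConformalExponent.preservesDistribution {ξ : TangentDistribution m M} {α : OneForm m M}
    (hα : IsContactFormFor ξ α) {φ : Equiv.Perm M} {g : M → ℝ} (h : IsConformalExponent α φ g) :
    PreservesDistribution ξ φ := by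
  intro x v
  rw [hα.ker_eq, hα.ker_eq, h x v, mul_eq_zero, or_iff_right (Real.exp_pos _).ne']

/-- A smooth connected family of contactomorphisms, one of which preserves the coorientation, has
smooth conformal exponents. -/
theorem exists_smooth_conformalExponent [PreconnectedSpace P] {ξ : TangentDistribution m M}
    {α : OneForm m M} (hα : IsContactFormFor ξ α) {φ : P → Equiv.Perm M}
    (hφ : IsSmoothFamily m J φ) (hξ : ∀ p, PreservesDistribution ξ (φ p)) {p₀ : P} {g₀ : M → ℝ}
    (h₀ : IsConformalExponent α (φ p₀) g₀) :
    ∃ g : P → M → ℝ, ContMDiff (J.prod (𝓡 m)) 𝓘(ℝ, ℝ) ∞ (fun p : P × M => g p.1 p.2) ∧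
      ∀ p, IsConformalExponent α (φ p) (g p) := by
  obtain ⟨V, hV⟩ := hα.exists_isReebField
  let h : P → M → ℝ := fun p x => α (φ p x) (mfderiv (𝓡 m) (𝓡 m) (φ p) x (V x))
  have hh : ContMDiff (J.prod (𝓡 m)) 𝓘(ℝ, ℝ) ∞ (fun p : P × M => h p.1 p.2) :=
    hα.smooth.contMDiff_apply_mfderiv_right hφ.1 (hV.contMDiff hα)
  have hne : ∀ p x, h p x ≠ 0 := fun p x => (hξ p).apply_mfderiv_reeb_ne_zero hα hV x
  have hpos : ∀ p x, 0 < h p x := by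
    intro p x
    by_contra hp
    have hc : Continuous (fun p => h p x) :=
      hh.continuous.comp (continuous_id.prodMk continuous_const)
    have h0 : 0 ≤ h p₀ x := by
      rw [show h p₀ x = Real.exp (g₀ x) * α x (V x) from h₀ x (V x), (hV x).1, mul_one]
      exact (Real.exp_pos _).le
    obtain ⟨q, hq⟩ := mem_range_of_exists_le_of_exists_ge hc ⟨p, not_lt.1 hp⟩ ⟨p₀, h0⟩
    exact hne q x hq
  refine ⟨fun p x => Real.log (h p x), ?_, fun p x v => ?_⟩
  · intro p
    exact ContMDiffAt.comp p (g := Real.log)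
      (Real.contDiffAt_log.2 (hne p.1 p.2)).contMDiffAt (hh p)
  · rw [Real.exp_log (hpos p x)]
    exact (hξ p).apply_mfderiv_eq hα hV x v

end Families

end ConformalExponents

/-! ### Embedded families -/

section EmbeddedFamilies

variable {m : ℕ} {M : Type*} [TopologicalSpace M] [ChartedSpace (EuclideanSpace ℝ (Fin m)) M]

/-- On a compact manifold, a piece of a contact isotopy is embedded if and only if the graphs in it
are pairwise disjoint. -/
theorem isEmbeddedOn_iff [T2Space M] [CompactSpace M] {α : OneForm m M} (hα : ∀ x, α x ≠ 0)
    {φ : I → Equiv.Perm M} (hφ : Continuous (fun p : I × M => φ p.1 p.2)) {g : I → M → ℝ}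
    (hg : Continuous (fun p : I × M => g p.1 p.2)) (h : ∀ t, IsConformalExponent α (φ t) (g t))
    (a b : I) :
    IsEmbeddedOn α φ a b ↔ ∀ s ∈ Icc a b, ∀ t ∈ Icc a b, ∀ q, φ s q = φ t q → g s q = g t q →
      s = t := by
  constructor
  · rintro ⟨g', hg', hemb⟩ s hs t ht q h1 h2
    obtain rfl : g' = g := funext fun t => (hg' t).unique hα (h t)
    have := hemb.injective (a₁ := ⟨(s, q), hs, trivial⟩) (a₂ := ⟨(t, q), ht, trivial⟩)
      (by simp only [domRestrict_apply, graphMap, h1, h2])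
    exact congrArg (fun z => z.1.1) this
  · intro hinj
    refine ⟨g, h, ?_⟩
    have : CompactSpace (Icc a b ×ˢ (univ : Set M) : Set (I × M)) :=
      isCompact_iff_compactSpace.1 (isCompact_Icc.prod isCompact_univ)
    refine (Continuous.isClosedEmbedding ?_ ?_).isEmbedding
    · exact (continuous_snd.prodMk (hφ.prodMk hg)).comp continuous_subtype_val
    · intro ⟨⟨s, q⟩, hs, _⟩ ⟨⟨t, q'⟩, ht, _⟩ he
      simp only [graphMap, domRestrict_apply, Prod.mk.injEq] at he
      obtain ⟨rfl, h1, h2⟩ := he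
      obtain rfl := hinj s hs t ht q h1 h2
      rfl

theorem injective_mfderiv_affine_unitInterval {c d : ℝ} (hcd : c < d) (s : I) :
    Function.Injective (mfderiv (𝓡∂ 1) 𝓘(ℝ, ℝ) (fun s : I => c + (s : ℝ) * (d - c)) s) := by
  rw [injective_iff_map_eq_zero]
  intro ζ hζ
  have h1 : HasMFDerivAt (𝓡∂ 1) 𝓘(ℝ, ℝ) (Subtype.val : I → ℝ) s _ :=
    ((contMDiff_subtypeVal_Icc (n := 1)).mdifferentiableAt (by simp)).hasMFDerivAt
  have h2 : HasFDerivAt (fun r : ℝ => c + r * (d - c))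
      (ContinuousLinearMap.toSpanSingleton ℝ (d - c)) (s : ℝ) := by
    have := (((hasDerivAt_id (s : ℝ)).mul_const (d - c)).const_add c).hasFDerivAt
    simpa using this
  have h3 := h2.hasMFDerivAt.comp s h1
  have h4 : mfderiv (𝓡∂ 1) 𝓘(ℝ, ℝ) (fun s : I => c + (s : ℝ) * (d - c)) s ζ =
      (show ℝ from mfderiv (𝓡∂ 1) 𝓘(ℝ, ℝ) (Subtype.val : I → ℝ) s ζ) * (d - c) :=
    DFunLike.congr_fun h3.mfderiv ζ
  rw [hζ] at h4
  have h5 : mfderiv (𝓡∂ 1) 𝓘(ℝ, ℝ) (Subtype.val : I → ℝ) s ζ = (0 : ℝ) :=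
    (mul_eq_zero.1 h4.symm).resolve_right (sub_pos.2 hcd).ne'
  have h6 := mfderiv_subtypeVal_Icc_one s
  have hone : (1 : TangentSpace (𝓡∂ 1) s) ≠ 0 := by
    intro h
    rw [h, map_zero] at h6
    exact zero_ne_one (α := ℝ) h6
  obtain ⟨r, rfl⟩ := (finrank_eq_one_iff_of_nonzero' (K := ℝ) (1 : TangentSpace (𝓡∂ 1) s) hone).1
    (by exact finrank_euclideanSpace_fin) ζ
  rw [map_smul, h6] at h5
  have h7 : r = 0 := (mul_one r).symm.trans h5
  rw [h7, zero_smul]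

/-- A piece of an isotopy that is a reparametrization, not necessarily regular at the ends, of a
piece `[c, d]` of a smooth family without stationary or returning points is embedded, and the union
of its graphs is a smooth submanifold, parametrized by means of that family. -/
theorem isEmbeddedOn_and_hasSmoothGraphUnionOn_of_reparam [T2Space M] [CompactSpace M]
    {α : OneForm m M} (hα : ∀ x, α x ≠ 0) {φ : I → Equiv.Perm M}
    (hφ : Continuous (fun p : I × M => φ p.1 p.2)) {g : I → M → ℝ}
    (hg : Continuous (fun p : I × M => g p.1 p.2)) (h : ∀ t, IsConformalExponent α (φ t) (g t))
    {θ : ℝ → Equiv.Perm M} (hθ : ContMDiff (𝓘(ℝ, ℝ).prod (𝓡 m)) (𝓡 m) ∞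
      (fun p : ℝ × M => θ p.1 p.2)) {γ : ℝ → M → ℝ}
    (hγ : ContMDiff (𝓘(ℝ, ℝ).prod (𝓡 m)) 𝓘(ℝ, ℝ) ∞ (fun p : ℝ × M => γ p.1 p.2))
    (hγθ : ∀ t, IsConformalExponent α (θ t) (γ t)) {c d : ℝ} (hcd : c < d)
    (hvel : ∀ t ∈ Icc c d, ∀ q,
      mfderiv 𝓘(ℝ, ℝ) (𝓡 m) (fun t => θ t q) t (1 : ℝ) ≠ 0)
    (hinj : ∀ s ∈ Icc c d, ∀ t ∈ Icc c d, ∀ q, θ s q = θ t q → s = t)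
    {a b : I} {u : I → ℝ} (hu : BijOn u (Icc a b) (Icc c d)) (hφθ : ∀ t ∈ Icc a b, φ t = θ (u t)) :
    IsEmbeddedOn α φ a b ∧ HasSmoothGraphUnionOn α φ a b := by
  refine ⟨?_, g, h, fun p => (p.2, θ (c + (p.1 : ℝ) * (d - c)) p.2,
    γ (c + (p.1 : ℝ) * (d - c)) p.2), ?_, ?_, ?_, ?_⟩
  · rw [isEmbeddedOn_iff hα hφ hg h]
    intro s hs t ht q hst _
    rw [hφθ s hs, hφθ t ht] at hst
    exact hu.injOn hs ht (hinj _ (hu.mapsTo hs) _ (hu.mapsTo ht) q hst)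
  all_goals
    have haff : ContMDiff (𝓡∂ 1) 𝓘(ℝ, ℝ) ∞ (fun s : I => c + (s : ℝ) * (d - c)) := by
      have h1 : ContDiff ℝ ∞ (fun r : ℝ => c + r * (d - c)) := by fun_prop
      exact h1.contMDiff.comp contMDiff_subtypeVal_Icc
    have hΘ : ContMDiff ((𝓡∂ 1).prod (𝓡 m)) (𝓡 m) ∞
        (fun p : I × M => θ (c + (p.1 : ℝ) * (d - c)) p.2) :=
      hθ.comp ((haff.comp contMDiff_fst).prodMk contMDiff_snd)
    have hΓ : ContMDiff ((𝓡∂ 1).prod (𝓡 m)) 𝓘(ℝ, ℝ) ∞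
        (fun p : I × M => γ (c + (p.1 : ℝ) * (d - c)) p.2) :=
      hγ.comp ((haff.comp contMDiff_fst).prodMk contMDiff_snd)
    have hmem : ∀ s : I, c + (s : ℝ) * (d - c) ∈ Icc c d := by
      intro s
      have h0 := s.2.1
      have h1 := s.2.2
      constructor <;> nlinarith
  · exact contMDiff_snd.prodMk (hΘ.prodMk hΓ)
  · rintro ⟨s, q⟩
    rw [injective_iff_map_eq_zero]
    rintro ⟨ζ, v⟩ hζ
    have hd1 : HasMFDerivAt ((𝓡∂ 1).prod (𝓡 m)) (𝓡 m) (Prod.snd : I × M → M) (s, q) _ :=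
      hasMFDerivAt_snd _
    have hd2 := (hΘ.mdifferentiableAt (x := (s, q)) (by simp)).hasMFDerivAt
    have hd3 := (hΓ.mdifferentiableAt (x := (s, q)) (by simp)).hasMFDerivAt
    have hd := (hd1.prodMk (hd2.prodMk hd3)).mfderiv
    rw [hd] at hζ
    obtain rfl : v = 0 := congrArg Prod.fst hζ
    have hζ2 : mfderiv ((𝓡∂ 1).prod (𝓡 m)) (𝓡 m)
        (fun p : I × M => θ (c + (p.1 : ℝ) * (d - c)) p.2) (s, q) (ζ, 0) = 0 :=
      congrArg (fun u : _ × _ × _ => u.2.1) hζ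
    have hadd := (mfderiv_prod_eq_add_apply (p := (s, q))
      (v := show TangentSpace ((𝓡∂ 1).prod (𝓡 m)) (s, q) from (ζ, 0))
      (hΘ.mdifferentiableAt (by simp))).symm.trans hζ2
    have hζ2' : mfderiv (𝓡∂ 1) (𝓡 m) (fun s : I => θ (c + (s : ℝ) * (d - c)) q) s ζ = 0 := by
      refine Eq.trans ?_ hadd
      refine (add_zero _).symm.trans (congrArg _ ?_)
      exact (map_zero _).symm
    have hθq : ContMDiff 𝓘(ℝ, ℝ) (𝓡 m) ∞ (fun t => θ t q) :=
      hθ.comp (contMDiff_id.prodMk contMDiff_const)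
    have hcomp := mfderiv_comp (g := fun t => θ t q) (f := fun s : I => c + (s : ℝ) * (d - c)) s
      (hθq.mdifferentiableAt (by simp)) (haff.mdifferentiableAt (by simp))
    have hζ3 := (DFunLike.congr_fun hcomp ζ).symm.trans hζ2'
    let r : ℝ := mfderiv (𝓡∂ 1) 𝓘(ℝ, ℝ) (fun s : I => c + (s : ℝ) * (d - c)) s ζ
    have hζ4 : r • mfderiv 𝓘(ℝ, ℝ) (𝓡 m) (fun t => θ t q) (c + (s : ℝ) * (d - c)) (1 : ℝ) = 0 := by
      refine Eq.trans ?_ hζ3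
      refine ((mfderiv 𝓘(ℝ, ℝ) (𝓡 m) (fun t => θ t q)
        (c + (s : ℝ) * (d - c))).map_smul r _).symm.trans ?_
      exact congrArg _ (mul_one r)
    have hr : r = 0 := (smul_eq_zero.1 hζ4).resolve_right (hvel _ (hmem s) q)
    have hζ0 : ζ = 0 := injective_mfderiv_affine_unitInterval hcd s (hr.trans (map_zero _).symm)
    rw [hζ0]
    rfl
  · refine (Continuous.isClosedEmbedding ?_ ?_).isEmbedding
    · exact continuous_snd.prodMk (hΘ.continuous.prodMk hΓ.continuous)
    · rintro ⟨s, q⟩ ⟨t, q'⟩ he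
      simp only [Prod.mk.injEq] at he
      obtain ⟨rfl, h1, -⟩ := he
      have h2 := hinj _ (hmem s) _ (hmem t) q h1
      have h3 : (s : ℝ) = t := mul_right_cancel₀ (sub_pos.2 hcd).ne' (add_left_cancel h2)
      rw [Subtype.ext h3]
  · have hgγ : ∀ t ∈ Icc a b, g t = γ (u t) := fun t ht =>
      (h t).unique hα (by rw [hφθ t ht]; exact hγθ _)
    ext z
    constructor
    · rintro ⟨⟨s, q⟩, rfl⟩
      obtain ⟨t, ht, hts⟩ := hu.surjOn (hmem s)
      refine ⟨(t, q), ⟨ht, trivial⟩, ?_⟩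
      simp only [graphMap, hφθ t ht, hgγ t ht, hts]
    · rintro ⟨⟨t, q⟩, ⟨ht, -⟩, rfl⟩
      have h1 := hu.mapsTo ht
      have hdc := sub_pos.2 hcd
      refine ⟨(⟨(u t - c) / (d - c), div_nonneg (by linarith [h1.1]) hdc.le,
        (div_le_one hdc).2 (by linarith [h1.2])⟩, q), ?_⟩
      simp only [graphMap, hφθ t ht, hgγ t ht, div_mul_cancel₀ _ hdc.ne', add_sub_cancel]

end EmbeddedFamilies

/-! ### Families without stationary points, and the Reeb flow -/

section MovingFamilies

variable {m : ℕ} {M : Type*} [TopologicalSpace M] [ChartedSpace (EuclideanSpace ℝ (Fin m)) M]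

/-- A family of maps does not return to the same point within a short time near a point at which
its velocity does not vanish. -/
theorem eventually_eq_zero_of_velocity_ne_zero {f : ℝ × M → M}
    (hf : ContMDiff (𝓘(ℝ, ℝ).prod (𝓡 m)) (𝓡 m) ∞ f) {t₀ : ℝ} {q₀ : M}
    (hv : mfderiv 𝓘(ℝ, ℝ) (𝓡 m) (fun t => f (t, q₀)) t₀ (1 : ℝ) ≠ 0) :
    ∀ᶠ z : ℝ × ℝ × M in 𝓝 (0, t₀, q₀), f (z.2.1 + z.1, z.2.2) = f z.2 → z.1 = 0 := by
  set p₀ : ℝ × M := (t₀, q₀) with hp₀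
  set J := 𝓘(ℝ, ℝ).prod (𝓡 m) with hJ
  set K := writtenInExtChartAt J (𝓡 m) p₀ f with hK
  set ψ := extChartAt J p₀ with hψ
  have hKs : ContDiffAt ℝ ∞ K (ψ p₀) := by
    have := (contMDiffAt_iff.1 (hf p₀)).2
    rwa [ModelWithCorners.range_eq_univ, contDiffWithinAt_univ] at this
  have hKd : HasStrictFDerivAt K (fderiv ℝ K (ψ p₀)) (ψ p₀) := hKs.hasStrictFDerivAt (by simp)
  have hL : fderiv ℝ K (ψ p₀) (1, 0) ≠ 0 := by
    intro h0
    apply hv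
    have h1 : mfderiv J (𝓡 m) f p₀ = fderiv ℝ K (ψ p₀) := by
      have h3 : fderivWithin ℝ K (range J) (ψ p₀) = fderiv ℝ K (ψ p₀) := by
        rw [ModelWithCorners.range_eq_univ, fderivWithin_univ]
      unfold mfderiv
      exact (if_pos (hf.mdifferentiableAt (by simp))).trans h3
    have h2 : mfderiv J (𝓡 m) f p₀ (1, 0) = 0 := (DFunLike.congr_fun h1 (1, 0)).trans h0
    have h3 := (mfderiv_prod_eq_add_apply (p := p₀)
      (v := show TangentSpace J p₀ from ((1 : ℝ), 0)) (hf.mdifferentiableAt (by simp))).symm.trans h2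
    refine Eq.trans ?_ h3
    refine (add_zero _).symm.trans (congrArg _ ?_)
    exact (map_zero _).symm
  have hbound := hKd.isLittleO.def (half_pos (norm_pos_iff.2 hL))
  have hψc : ContinuousAt ψ p₀ := continuousAt_extChartAt p₀
  have hcont : ContinuousAt (fun z : ℝ × ℝ × M => (ψ (z.2.1 + z.1, z.2.2), ψ z.2)) (0, t₀, q₀) := by
    have h1 : ContinuousAt (fun z : ℝ × ℝ × M => ((z.2.1 + z.1, z.2.2) : ℝ × M)) (0, t₀, q₀) := by
      fun_prop
    refine ContinuousAt.prodMk (ContinuousAt.comp (g := ψ) ?_ h1)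
      (ContinuousAt.comp (g := ψ) ?_ continuousAt_snd)
    · simpa [← hp₀] using hψc
    · exact hψc
  have hsource : ∀ᶠ z : ℝ × ℝ × M in 𝓝 (0, t₀, q₀), (z.2.1 + z.1, z.2.2) ∈ ψ.source ∧
      z.2 ∈ ψ.source := by
    have hs : ψ.source ∈ 𝓝 p₀ := extChartAt_source_mem_nhds p₀
    refine Filter.Eventually.and ?_ ?_
    · have h1 : ContinuousAt (fun z : ℝ × ℝ × M => ((z.2.1 + z.1, z.2.2) : ℝ × M)) (0, t₀, q₀) := by
        fun_prop
      refine h1.preimage_mem_nhds ?_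
      simpa [← hp₀] using hs
    · exact (continuousAt_snd (p := ((0 : ℝ), p₀))).preimage_mem_nhds hs
  have hb := hcont.eventually (p := fun w => ‖K w.1 - K w.2 - fderiv ℝ K (ψ p₀) (w.1 - w.2)‖ ≤
      ‖fderiv ℝ K (ψ p₀) (1, 0)‖ / 2 * ‖w.1 - w.2‖) (by simpa [← hp₀] using hbound)
  filter_upwards [hb, hsource] with z hz hzs heq
  have hKeq : K (ψ (z.2.1 + z.1, z.2.2)) = K (ψ z.2) := by
    simp only [hK, writtenInExtChartAt, Function.comp_apply]
    rw [ψ.left_inv hzs.1, ψ.left_inv hzs.2, heq]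
  have hdiff : ψ (z.2.1 + z.1, z.2.2) - ψ z.2 = z.1 • ((1 : ℝ), (0 : EuclideanSpace ℝ (Fin m))) := by
    rw [hψ, hJ, extChartAt_prod]
    ext <;> simp [chartAt_self_eq]
  rw [hKeq, hdiff, sub_self, zero_sub, norm_neg, map_smul, norm_smul, norm_smul] at hz
  have h1 : ‖((1 : ℝ), (0 : EuclideanSpace ℝ (Fin m)))‖ = 1 := by simp [Prod.norm_def]
  rw [h1, mul_one] at hz
  have h2 := norm_pos_iff.2 hL
  by_contra hne
  have h3 : 0 < ‖z.1‖ := norm_pos_iff.2 hne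
  nlinarith

/-- If the velocity of a family of maps of a compact manifold does not vanish at times in `[0, 1]`,
then there is a positive lower bound for the times within which points return. -/
theorem exists_pos_forall_eq_of_velocity_ne_zero [CompactSpace M] {f : ℝ × M → M}
    (hf : ContMDiff (𝓘(ℝ, ℝ).prod (𝓡 m)) (𝓡 m) ∞ f)
    (hv : ∀ t ∈ Icc (0 : ℝ) 1, ∀ q,
      mfderiv 𝓘(ℝ, ℝ) (𝓡 m) (fun t => f (t, q)) t (1 : ℝ) ≠ 0) :
    ∃ δ > 0, ∀ s ∈ Icc (0 : ℝ) 1, ∀ t ∈ Icc (0 : ℝ) 1, |s - t| < δ →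
      ∀ q, f (s, q) = f (t, q) → s = t := by
  have h := (isCompact_Icc.prod isCompact_univ :
    IsCompact (Icc (0 : ℝ) 1 ×ˢ (univ : Set M))).eventually_forall_of_forall_eventually
    (x₀ := (0 : ℝ)) (P := fun e p => f (p.1 + e, p.2) = f p → e = 0)
    (fun p hp => eventually_eq_zero_of_velocity_ne_zero hf (hv p.1 hp.1 p.2))
  obtain ⟨δ, hδ, hball⟩ := Metric.eventually_nhds_iff.1 h
  refine ⟨δ, hδ, fun s hs t ht hst q hq => ?_⟩
  have := hball (y := s - t) (by simpa [Real.dist_eq] using hst) (t, q) ⟨ht, trivial⟩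
    (by simpa using hq)
  exact sub_eq_zero.1 this

variable [IsManifold (𝓡 m) ∞ M]

/-- The Reeb flow consists of strict contactomorphisms. -/
theorem IsContactFormFor.exists_reebFlow [T2Space M] [CompactSpace M]
    {ξ : TangentDistribution m M} {α : OneForm m M} (hα : IsContactFormFor ξ α)
    {V : ∀ x : M, TangentSpace (𝓡 m) x} (hV : IsReebField α V) :
    ∃ ρ : ℝ → Equiv.Perm M, IsSmoothFamily m 𝓘(ℝ, ℝ) ρ ∧ ρ 0 = 1 ∧
      (∀ s t, ρ (s + t) = ρ s * ρ t) ∧ (∀ t, IsConformalExponent α (ρ t) 0) ∧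
      ∀ t q, HasMFDerivAt 𝓘(ℝ, ℝ) (𝓡 m) (fun t => ρ t q) t
        (ContinuousLinearMap.toSpanSingleton ℝ (V (ρ t q))) := by
  obtain ⟨Φ, hΦ, hΦ0, hΦadd, hΦV⟩ := exists_smooth_flow (hV.contMDiff hα)
  let ρ : ℝ → Equiv.Perm M := fun t => ⟨fun x => Φ (t, x), fun x => Φ (-t, x),
    fun x => (hΦadd _ _ _).symm.trans (by rw [neg_add_cancel, hΦ0]),
    fun x => (hΦadd _ _ _).symm.trans (by rw [add_neg_cancel, hΦ0])⟩
  have hneg : ContMDiff (𝓘(ℝ, ℝ).prod (𝓡 m)) 𝓘(ℝ, ℝ) ∞ (fun p : ℝ × M => -p.1) :=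
    (contDiff_neg.contMDiff (n := ∞)).comp contMDiff_fst
  refine ⟨ρ, ⟨hΦ, hΦ.comp (hneg.prodMk contMDiff_snd)⟩, Equiv.ext hΦ0,
    fun s t => Equiv.ext (hΦadd s t), fun t x v => ?_, fun t q => hΦV q t⟩
  rw [Pi.zero_apply, Real.exp_zero, one_mul]
  exact pullback_reebFlow_eq hα.smooth hV (hV.contMDiff hα) hΦ hΦ0 hΦadd hΦV t x v

/-- Precomposing a family of contactomorphisms with the Reeb flow run at a sufficiently high speed
makes it positively transverse to the contact structure. -/
theorem exists_velocity_comp_reebFlow_ne_zero [CompactSpace M]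
    {ξ : TangentDistribution m M} {α : OneForm m M} (hα : IsContactFormFor ξ α)
    {V : ∀ x : M, TangentSpace (𝓡 m) x} (hV : IsReebField α V) {ρ : ℝ → Equiv.Perm M}
    (hρV : ∀ t q, HasMFDerivAt 𝓘(ℝ, ℝ) (𝓡 m) (fun t => ρ t q) t
        (ContinuousLinearMap.toSpanSingleton ℝ (V (ρ t q))))
    {φ : ℝ → Equiv.Perm M} (hφ : IsSmoothFamily m 𝓘(ℝ, ℝ) φ) {g : ℝ → M → ℝ}
    (hg : ∀ t, IsConformalExponent α (φ t) (g t)) :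
    ∃ C : ℝ, 0 < C ∧ ∀ t ∈ Icc (0 : ℝ) 1, ∀ q,
      mfderiv 𝓘(ℝ, ℝ) (𝓡 m) (fun t => φ t (ρ (C * t) q)) t (1 : ℝ) ≠ 0 := by
  let a : ℝ × M → ℝ := fun p =>
    α (φ p.1 p.2) (mfderiv 𝓘(ℝ, ℝ) (𝓡 m) (fun t => φ t p.2) p.1 (1 : ℝ))
  let h : ℝ × M → ℝ := fun p => α (φ p.1 p.2) (mfderiv (𝓡 m) (𝓡 m) (φ p.1) p.2 (V p.2))
  have ha : Continuous a := (hα.smooth.contMDiff_apply_velocity hφ.1).continuous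
  have hh : Continuous h :=
    (hα.smooth.contMDiff_apply_mfderiv_right hφ.1 (hV.contMDiff hα)).continuous
  have hpos : ∀ p, 0 < h p := by
    intro p
    rw [show h p = Real.exp (g p.1 p.2) * α p.2 (V p.2) from hg p.1 p.2 (V p.2), (hV p.2).1, mul_one]
    exact Real.exp_pos _
  obtain ⟨B, hB⟩ := (isCompact_Icc.prod isCompact_univ :
    IsCompact (Icc (0 : ℝ) 1 ×ˢ (univ : Set M))).exists_bound_of_continuousOn
    (ha.div hh fun p => (hpos p).ne').continuousOn
  refine ⟨|B| + 1, by positivity, fun t ht q h0 => ?_⟩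
  set C := |B| + 1
  set x := ρ (C * t) q with hx
  have hd1 : HasMFDerivAt 𝓘(ℝ, ℝ) (𝓡 m) (fun t => ρ (C * t) q) t
      (ContinuousLinearMap.toSpanSingleton ℝ (C • V x)) := by
    have h1 : HasFDerivAt (fun t : ℝ => C * t) (ContinuousLinearMap.toSpanSingleton ℝ C) t := by
      simpa using ((hasDerivAt_id t).const_mul C).hasFDerivAt
    have h2 := (hρV (C * t) q).comp t h1.hasMFDerivAt
    refine h2.congr_mfderiv ?_
    ext
    exact congrArg (fun r : ℝ => r • V x) (one_mul C) |>.trans (one_smul ℝ _).symm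
  have hd2 := (hφ.1.mdifferentiableAt (x := (t, x)) (by simp)).hasMFDerivAt
  have hd3 : HasMFDerivAt 𝓘(ℝ, ℝ) (𝓘(ℝ, ℝ).prod (𝓡 m)) (fun t => (t, ρ (C * t) q)) t _ :=
    (hasMFDerivAt_id t).prodMk hd1
  have hd4 := (hd2.comp t hd3).mfderiv
  have h1 := (DFunLike.congr_fun hd4 (1 : ℝ)).symm.trans h0
  have h2 := (mfderiv_prod_eq_add_apply (p := (t, x))
    (v := show TangentSpace (𝓘(ℝ, ℝ).prod (𝓡 m)) (t, x) from ((1 : ℝ), (1 : ℝ) • C • V x))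
    (hφ.1.mdifferentiableAt (by simp))).symm.trans h1
  have h3 := congrArg (α (φ t x)) h2
  rw [map_zero] at h3
  have h4 : a (t, x) + C * h (t, x) = 0 := by
    refine Eq.trans ?_ h3
    refine Eq.trans ?_ (map_add _ _ _).symm
    refine congrArg (fun r : ℝ => a (t, x) + r) ?_
    have h5 : mfderiv (𝓡 m) (𝓡 m) (φ t) x ((1 : ℝ) • C • V x) =
        C • mfderiv (𝓡 m) (𝓡 m) (φ t) x (V x) := by
      rw [one_smul, map_smul]
    exact ((congrArg (α (φ t x)) h5).trans (map_smul _ _ _)).symm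
  have h5 : ‖a (t, x) / h (t, x)‖ ≤ B := hB (t, x) ⟨ht, trivial⟩
  have h6 : a (t, x) / h (t, x) = -C := by
    rw [div_eq_iff (hpos _).ne']
    linarith
  rw [h6, norm_neg, Real.norm_eq_abs] at h5
  have h7 := le_abs_self C
  have h8 := le_abs_self B
  have : C = |B| + 1 := rfl
  linarith

end MovingFamilies

/-! ### Homotopies of contact isotopies -/

section UnitInterval

/-- The point `(1 - s) a + s b` of the unit interval. -/
def unitInterval.convexComb (s a b : I) : I :=
  ⟨(1 - s) * a + s * b, convex_Icc (0 : ℝ) 1 a.2 b.2 (sub_nonneg.2 s.2.2) s.2.1 (sub_add_cancel _ _)⟩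

open unitInterval

@[simp]
theorem unitInterval.convexComb_zero (a b : I) : convexComb 0 a b = a := by
  simp [convexComb]

@[simp]
theorem unitInterval.convexComb_one (a b : I) : convexComb 1 a b = b := by
  simp [convexComb]

@[simp]
theorem unitInterval.convexComb_self (s a : I) : convexComb s a a = a := by
  ext
  simp only [convexComb]
  ring

theorem unitInterval.convexComb_mem_Icc {a b : I} (hab : a ≤ b) (s : I) :
    convexComb s a b ∈ Icc a b := by
  have h1 : (a : ℝ) ≤ b := hab
  have h2 := s.2.1
  have h3 := s.2.2
  constructor
  · change (a : ℝ) ≤ (1 - s) * a + s * b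
    nlinarith
  · change (1 - s) * a + s * b ≤ (b : ℝ)
    nlinarith

theorem unitInterval.convexComb_injective {a b : I} (hab : a < b) :
    Function.Injective (fun s => convexComb s a b) := by
  intro s t hst
  have h1 : (1 - s : ℝ) * a + s * b = (1 - t) * a + t * b := congrArg Subtype.val hst
  have h2 : (0 : ℝ) < b - a := sub_pos.2 hab
  ext
  exact mul_right_cancel₀ h2.ne' (by linarith)

/-- Mathlib's smooth transition function, as a map to the unit interval. -/
noncomputable def smoothStep (t : ℝ) : I :=
  ⟨Real.smoothTransition t, Real.smoothTransition.nonneg t, Real.smoothTransition.le_one t⟩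

theorem contMDiff_smoothStep : ContMDiff 𝓘(ℝ, ℝ) (𝓡∂ 1) ∞ smoothStep :=
  contMDiff_iff_comp_subtypeVal_Icc.2
    ⟨Real.smoothTransition.continuous.subtype_mk _, Real.smoothTransition.contDiff.contMDiff⟩

@[simp]
theorem smoothStep_zero : smoothStep 0 = 0 := Subtype.ext Real.smoothTransition.zero

@[simp]
theorem smoothStep_one : smoothStep 1 = 1 := Subtype.ext Real.smoothTransition.one

theorem Real.smoothTransition.strictMonoOn : StrictMonoOn Real.smoothTransition (Icc 0 1) := by
  intro x hx y hy hxy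
  have hx' : expNegInvGlue x < expNegInvGlue y := by
    rcases hx.1.eq_or_lt with rfl | hx0
    · rw [expNegInvGlue.zero]
      exact expNegInvGlue.pos_of_pos hxy
    · simp only [expNegInvGlue, not_le.2 hx0, not_le.2 (hx0.trans hxy), if_false, Real.exp_lt_exp,
        neg_lt_neg_iff]
      exact inv_strictAnti₀ hx0 hxy
  have h1 : expNegInvGlue (1 - y) ≤ expNegInvGlue (1 - x) := expNegInvGlue.monotone (by linarith)
  have h2 : 0 < expNegInvGlue (1 - x) := expNegInvGlue.pos_of_pos (by linarith [hy.2])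
  have h3 := expNegInvGlue.nonneg x
  rw [Real.smoothTransition, Real.smoothTransition,
    div_lt_div_iff₀ (Real.smoothTransition.pos_denom x) (Real.smoothTransition.pos_denom y)]
  nlinarith

variable {F K P : Type*} [NormedAddCommGroup F] [NormedSpace ℝ F] [TopologicalSpace K]
  {J : ModelWithCorners ℝ F K} [TopologicalSpace P] [ChartedSpace K P]

theorem ContMDiff.coe_unitInterval {f : P → I} (hf : ContMDiff J (𝓡∂ 1) ∞ f) :
    ContMDiff J 𝓘(ℝ, ℝ) ∞ (fun p => (f p : ℝ)) :=
  contMDiff_subtypeVal_Icc.comp hf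

theorem ContMDiff.lineMap {r f g : P → ℝ} (hr : ContMDiff J 𝓘(ℝ, ℝ) ∞ r)
    (hf : ContMDiff J 𝓘(ℝ, ℝ) ∞ f) (hg : ContMDiff J 𝓘(ℝ, ℝ) ∞ g) :
    ContMDiff J 𝓘(ℝ, ℝ) ∞ (fun p => (1 - r p) * f p + r p * g p) := by
  have h : ContDiff ℝ ∞ (fun x : ℝ × ℝ × ℝ => (1 - x.1) * x.2.1 + x.1 * x.2.2) := by fun_prop
  exact h.contMDiff.comp (hr.prodMk_space (hf.prodMk_space hg))

theorem ContMDiff.convexComb {r f g : P → I} (hr : ContMDiff J (𝓡∂ 1) ∞ r)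
    (hf : ContMDiff J (𝓡∂ 1) ∞ f) (hg : ContMDiff J (𝓡∂ 1) ∞ g) :
    ContMDiff J (𝓡∂ 1) ∞ (fun p => convexComb (r p) (f p) (g p)) := by
  have h := hr.coe_unitInterval.lineMap hf.coe_unitInterval hg.coe_unitInterval
  exact contMDiff_iff_comp_subtypeVal_Icc.2 ⟨h.continuous.subtype_mk _, h⟩

end UnitInterval

section Homotopies

open unitInterval

variable {m : ℕ} {M : Type*} [TopologicalSpace M] [ChartedSpace (EuclideanSpace ℝ (Fin m)) M]
  {ξ : TangentDistribution m M}

namespace ContactIsotopy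

theorem isSmoothFamily (φ : ContactIsotopy ξ) : IsSmoothFamily m (𝓡∂ 1) φ.1 := φ.2.1

theorem preservesDistribution (φ : ContactIsotopy ξ) (t : I) : PreservesDistribution ξ (φ.1 t) :=
  φ.2.2.1 t

@[simp]
theorem apply_zero (φ : ContactIsotopy ξ) : φ.1 0 = 1 := φ.2.2.2

theorem inv_preservesDistribution (φ : ContactIsotopy ξ) (t : I) :
    PreservesDistribution ξ (φ.1 t)⁻¹ :=
  (φ⁻¹).preservesDistribution t

theorem mdifferentiable (φ : ContactIsotopy ξ) (t : I) : MDifferentiable (𝓡 m) (𝓡 m) (φ.1 t) :=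
  φ.isSmoothFamily.mdifferentiable t

theorem inv_mdifferentiable (φ : ContactIsotopy ξ) (t : I) :
    MDifferentiable (𝓡 m) (𝓡 m) ((φ.1 t)⁻¹ : Equiv.Perm M) :=
  (φ⁻¹).mdifferentiable t

theorem mul_inv_preservesDistribution (φ : ContactIsotopy ξ) (s t : I) :
    PreservesDistribution ξ (φ.1 s * (φ.1 t)⁻¹) :=
  (φ.preservesDistribution s).mul (φ.inv_preservesDistribution t) (φ.mdifferentiable s)
    (φ.inv_mdifferentiable t)

theorem toUniversalCover_mul (φ ψ : ContactIsotopy ξ) :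
    (φ * ψ).toUniversalCover = φ.toUniversalCover * ψ.toUniversalCover := rfl

theorem toUniversalCover_one : (1 : ContactIsotopy ξ).toUniversalCover = 1 := rfl

theorem toUniversalCover_surjective :
    Function.Surjective (toUniversalCover : ContactIsotopy ξ → UniversalCoverCont ξ) :=
  Con.mk'_surjective

theorem Homotopic.toUniversalCover_eq {φ ψ : ContactIsotopy ξ} (h : φ.Homotopic ψ) :
    φ.toUniversalCover = ψ.toUniversalCover :=
  ((homotopyCon ξ).eq).2 h

theorem homotopic_of_family {F : I × I → Equiv.Perm M}
    (hF : IsSmoothFamily m ((𝓡∂ 1).prod (𝓡∂ 1)) F) (hξ : ∀ p, PreservesDistribution ξ (F p))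
    (h0 : ∀ s, F (s, 0) = 1) (h1 : ∀ s, F (s, 1) = F (0, 1)) {φ ψ : ContactIsotopy ξ}
    (hφ : ∀ t, φ.1 t = F (0, t)) (hψ : ∀ t, ψ.1 t = F (1, t)) : φ.Homotopic ψ := by
  refine ⟨fun s => ⟨fun t => F (s, t),
    hF.comp_param (u := fun t : I => (s, t)) (contMDiff_const.prodMk contMDiff_id),
    fun _ => hξ _, h0 s⟩, hF, Subtype.ext (funext fun t => (hφ t).symm),
    Subtype.ext (funext fun t => (hψ t).symm), fun s => (h1 s).trans (hφ 1).symm⟩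

theorem exists_homotopic_of_family {F : I × I → Equiv.Perm M}
    (hF : IsSmoothFamily m ((𝓡∂ 1).prod (𝓡∂ 1)) F) (hξ : ∀ p, PreservesDistribution ξ (F p))
    (h0 : ∀ s, F (s, 0) = 1) (h1 : ∀ s, F (s, 1) = F (0, 1)) {φ : ContactIsotopy ξ}
    (hφ : ∀ t, φ.1 t = F (0, t)) : ∃ ψ : ContactIsotopy ξ, φ.Homotopic ψ ∧ ∀ t, ψ.1 t = F (1, t) :=
  ⟨⟨fun t => F (1, t),
    hF.comp_param (u := fun t : I => (1, t)) (contMDiff_const.prodMk contMDiff_id),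
    fun _ => hξ _, h0 1⟩, homotopic_of_family hF hξ h0 h1 hφ fun _ => rfl, fun _ => rfl⟩

/-- The piece of a contact isotopy between the times `a` and `b`, reparametrized by `[0, 1]` and
translated so as to start at the identity. -/
def piece (φ : ContactIsotopy ξ) (a b : I) : ContactIsotopy ξ :=
  ⟨fun s => φ.1 (convexComb s a b) * (φ.1 a)⁻¹,
    (φ.isSmoothFamily.comp_param (u := fun s => convexComb s a b)
        (contMDiff_id.convexComb contMDiff_const contMDiff_const)).mul
      (φ.isSmoothFamily.inv.comp_param (u := fun _ => a) contMDiff_const),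
    fun _ => φ.mul_inv_preservesDistribution _ _, by simp⟩

theorem piece_self (φ : ContactIsotopy ξ) (a : I) : φ.piece a a = 1 := by
  ext1
  funext s
  simp [piece]

theorem piece_zero_one (φ : ContactIsotopy ξ) : φ.piece 0 1 = φ := by
  ext1
  funext s
  have : convexComb s 0 1 = s := by
    ext
    simp [convexComb]
  simp [piece, this]

/-- Consecutive pieces multiply up to the piece of the union of the time intervals. The homotopy
moves the intermediate time from `a` to `b`. -/
theorem toUniversalCover_piece (φ : ContactIsotopy ξ) (a b c : I) :
    (φ.piece a c).toUniversalCover =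
      (φ.piece b c).toUniversalCover * (φ.piece a b).toUniversalCover := by
  rw [← toUniversalCover_mul]
  have hb : ContMDiff ((𝓡∂ 1).prod (𝓡∂ 1)) (𝓡∂ 1) ∞ (fun p : I × I => convexComb p.1 a b) :=
    contMDiff_fst.convexComb contMDiff_const contMDiff_const
  have h1 := φ.isSmoothFamily.comp_param (contMDiff_snd.convexComb hb contMDiff_const :
    ContMDiff _ _ _ (fun p : I × I => convexComb p.2 (convexComb p.1 a b) c))
  have h2 := φ.isSmoothFamily.inv.comp_param hb
  have h3 := φ.isSmoothFamily.comp_param (contMDiff_snd.convexComb contMDiff_const hb :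
    ContMDiff _ _ _ (fun p : I × I => convexComb p.2 a (convexComb p.1 a b)))
  have h4 : IsSmoothFamily m ((𝓡∂ 1).prod (𝓡∂ 1)) (fun _ : I × I => (φ.1 a)⁻¹) :=
    φ.isSmoothFamily.inv.comp_param (u := fun _ : I × I => a) contMDiff_const
  refine (homotopic_of_family ((h1.mul h2).mul (h3.mul h4)) (fun p => ?_) (fun s => ?_)
    (fun s => ?_) (fun t => ?_) fun t => ?_).toUniversalCover_eq
  · exact (φ.mul_inv_preservesDistribution _ _).mul (φ.mul_inv_preservesDistribution _ _)
      ((h1.mul h2).mdifferentiable p) ((h3.mul h4).mdifferentiable p)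
  · simp
  · simp
  · simp [piece]
  · simp only [piece, Pi.mul_apply, Function.comp_apply, convexComb_one, Pi.inv_apply]
    rfl

/-- Conjugating by an isotopy `ψ` is homotopic to conjugating by the end `ψ_1` of it, through
conjugation by `ψ` at the time `(1 - s) t + s`. -/
theorem homotopic_conj (φ ψ : ContactIsotopy ξ) :
    ∃ χ : ContactIsotopy ξ, (ψ * φ * ψ⁻¹).Homotopic χ ∧
      ∀ t, χ.1 t = ψ.1 1 * φ.1 t * (ψ.1 1)⁻¹ := by
  have h : ContMDiff ((𝓡∂ 1).prod (𝓡∂ 1)) (𝓡∂ 1) ∞ (fun p : I × I => convexComb p.1 p.2 1) :=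
    contMDiff_fst.convexComb contMDiff_snd contMDiff_const
  have h1 := ψ.isSmoothFamily.comp_param h
  have h2 := φ.isSmoothFamily.comp_param
    (contMDiff_snd : ContMDiff ((𝓡∂ 1).prod (𝓡∂ 1)) (𝓡∂ 1) ∞ (Prod.snd : I × I → I))
  have h3 := ψ.isSmoothFamily.inv.comp_param h
  have h4 := exists_homotopic_of_family (ξ := ξ) (φ := ψ * φ * ψ⁻¹) ((h1.mul h2).mul h3)
    (fun p => ((ψ.preservesDistribution _).mul (φ.preservesDistribution _) (h1.mdifferentiable p)
      (h2.mdifferentiable p)).mul (ψ.inv_preservesDistribution _) ((h1.mul h2).mdifferentiable p)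
      (h3.mdifferentiable p))
    (fun s => by simp) (fun s => by simp) (fun t => by simp)
  simpa using h4

end ContactIsotopy

end Homotopies

/-! ### Word norms -/

section WordNorms

variable {G : Type*} [Group G] {S : Set G}

theorem IsGeneratingSet.mem_pow_wordNorm (hS : IsGeneratingSet S) (x : G) : x ∈ S ^ wordNorm S x := by
  have hx : x ∈ ⋃ k : ℕ, S ^ k := by
    rw [hS]
    trivial
  exact Nat.sInf_mem (s := {k : ℕ | x ∈ S ^ k}) (mem_iUnion.1 hx)

theorem wordNorm_le {k : ℕ} {x : G} (hx : x ∈ S ^ k) : wordNorm S x ≤ k := Nat.sInf_le hx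

theorem conj_mem_pow (hconj : ∀ x y : G, x ∈ S → y * x * y⁻¹ ∈ S) (y : G) {k : ℕ} {x : G}
    (hx : x ∈ S ^ k) : y * x * y⁻¹ ∈ S ^ k := by
  induction k generalizing x with
  | zero =>
    rw [pow_zero, mem_one] at hx ⊢
    rw [hx, mul_one, mul_inv_cancel]
  | succ k ih =>
    rw [pow_succ] at hx ⊢
    obtain ⟨a, ha, b, hb, rfl⟩ := hx
    exact ⟨_, ih ha, _, hconj b y hb, by simp [mul_assoc]⟩

theorem inv_mem_pow (hinv : S⁻¹ = S) {k : ℕ} {x : G} (hx : x ∈ S ^ k) : x⁻¹ ∈ S ^ k := by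
  rw [← Set.mem_inv, ← inv_pow, hinv]
  exact hx

/-- The word norm of a symmetric, conjugation-invariant generating set. -/
theorem isConjInvariantNorm_wordNorm (hS : IsGeneratingSet S) (hinv : S⁻¹ = S)
    (hconj : ∀ x y : G, x ∈ S → y * x * y⁻¹ ∈ S) :
    IsConjInvariantNorm (fun x => (wordNorm S x : ℝ)) where
  nonneg x := Nat.cast_nonneg _
  eq_zero_iff x := by
    rw [Nat.cast_eq_zero]
    refine ⟨fun h => ?_, fun h => ?_⟩
    · have := hS.mem_pow_wordNorm x
      rwa [h, pow_zero, mem_one] at this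
    · refine Nat.le_zero.1 (wordNorm_le ?_)
      rw [pow_zero, h]
      exact one_mem_one
  inv x := by
    refine congrArg _ (le_antisymm (wordNorm_le (inv_mem_pow hinv (hS.mem_pow_wordNorm x))) ?_)
    have := wordNorm_le (inv_mem_pow hinv (hS.mem_pow_wordNorm x⁻¹))
    rwa [inv_inv] at this
  mul_le x y := by
    rw [← Nat.cast_add, Nat.cast_le]
    refine wordNorm_le ?_
    rw [pow_add]
    exact mul_mem_mul (hS.mem_pow_wordNorm x) (hS.mem_pow_wordNorm y)
  conj x y := by
    refine congrArg _ (le_antisymm (wordNorm_le (conj_mem_pow hconj y (hS.mem_pow_wordNorm x))) ?_)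
    have := wordNorm_le (conj_mem_pow hconj y⁻¹ (hS.mem_pow_wordNorm (y * x * y⁻¹)))
    simpa [mul_assoc] using this

theorem IsConjInvariantNorm.isBiinvariantMetric {ν : G → ℝ} (hν : IsConjInvariantNorm ν) :
    IsBiinvariantMetric (fun x y => ν (x⁻¹ * y)) where
  eq_zero_iff x y := by rw [hν.eq_zero_iff, inv_mul_eq_one]
  symm x y := by rw [← hν.inv, mul_inv_rev, inv_inv]
  triangle x y z := by
    have := hν.mul_le (x⁻¹ * y) (y⁻¹ * z)
    rwa [mul_assoc, mul_inv_cancel_left] at this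
  mul_left z x y := by simp [mul_assoc]
  mul_right z x y := by
    rw [← hν.conj _ z]
    congr 1
    group

end WordNorms

/-! ### Embedded isotopies -/

section EmbeddedIsotopies

open unitInterval

variable {m : ℕ} {M : Type*} [TopologicalSpace M] [ChartedSpace (EuclideanSpace ℝ (Fin m)) M]
  [IsManifold (𝓡 m) ∞ M] {ξ : TangentDistribution m M} {α : OneForm m M}

namespace ContactIsotopy

theorem exists_conformalExponent (hα : IsContactFormFor ξ α) (φ : ContactIsotopy ξ) :
    ∃ g : I → M → ℝ, Continuous (fun p : I × M => g p.1 p.2) ∧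
      ∀ t, IsConformalExponent α (φ.1 t) (g t) := by
  obtain ⟨g, hg, h⟩ := exists_smooth_conformalExponent hα φ.isSmoothFamily φ.preservesDistribution
    (p₀ := 0) (g₀ := 0) (by rw [φ.apply_zero]; exact isConformalExponent_one α)
  exact ⟨g, hg.continuous, h⟩

variable [T2Space M] [CompactSpace M]

theorem isEmbeddedOn_iff_of_conformalExponent (hα : IsContactFormFor ξ α) (φ : ContactIsotopy ξ)
    {g : I → M → ℝ} (hg : ∀ t, IsConformalExponent α (φ.1 t) (g t)) (a b : I) :
    IsEmbeddedOn α φ.1 a b ↔ ∀ s ∈ Icc a b, ∀ t ∈ Icc a b, ∀ q, φ.1 s q = φ.1 t q →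
      g s q = g t q → s = t := by
  obtain ⟨g', hg', h⟩ := φ.exists_conformalExponent hα
  obtain rfl : g = g' := funext fun t => (hg t).unique hα.ne_zero (h t)
  exact isEmbeddedOn_iff hα.ne_zero φ.isSmoothFamily.1.continuous hg' h a b

theorem isEmbeddedOn_piece (hα : IsContactFormFor ξ α) (φ : ContactIsotopy ξ) {a b : I}
    (hab : a < b) (h : IsEmbeddedOn α φ.1 a b) : IsEmbeddedOn α (φ.piece a b).1 0 1 := by
  obtain ⟨g, -, hg⟩ := φ.exists_conformalExponent hα
  rw [φ.isEmbeddedOn_iff_of_conformalExponent hα hg] at h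
  rw [isEmbeddedOn_iff_of_conformalExponent hα _ fun t =>
    (hg (convexComb t a b)).mul ((hg a).inv (φ.mdifferentiable a) (φ.inv_mdifferentiable a))
      (φ.mdifferentiable _) (φ.inv_mdifferentiable a)]
  intro s _ t _ q h1 h2
  exact convexComb_injective hab (h _ (convexComb_mem_Icc hab.le s) _
    (convexComb_mem_Icc hab.le t) ((φ.1 a)⁻¹ q) h1 (add_right_cancel h2))

theorem isEmbeddedOn_inv (hα : IsContactFormFor ξ α) (φ : ContactIsotopy ξ) {a b : I}
    (h : IsEmbeddedOn α φ.1 a b) : IsEmbeddedOn α (φ⁻¹).1 a b := by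
  obtain ⟨g, -, hg⟩ := φ.exists_conformalExponent hα
  rw [φ.isEmbeddedOn_iff_of_conformalExponent hα hg] at h
  rw [isEmbeddedOn_iff_of_conformalExponent hα _ fun t =>
    (hg t).inv (φ.mdifferentiable t) (φ.inv_mdifferentiable t)]
  intro s hs t ht q h1 h2
  have h1' : (φ.1 s)⁻¹ q = (φ.1 t)⁻¹ q := h1
  refine h s hs t ht ((φ.1 s)⁻¹ q) ?_ ?_
  · exact ((φ.1 s).apply_symm_apply q).trans (h1' ▸ ((φ.1 t).apply_symm_apply q).symm)
  · conv_rhs => rw [h1']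
    exact neg_injective h2

/-- If `φ_s` and `φ_t` agree at `p`, the conformal exponents of their conjugates by `ψ_1` at `ψ_1(p)`
differ by as much as those of `φ_s` and `φ_t` at `p`. -/
theorem isEmbeddedOn_conj (hα : IsContactFormFor ξ α) (φ ψ χ : ContactIsotopy ξ)
    (hχ : ∀ t, χ.1 t = ψ.1 1 * φ.1 t * (ψ.1 1)⁻¹) {a b : I} (h : IsEmbeddedOn α φ.1 a b) :
    IsEmbeddedOn α χ.1 a b := by
  obtain ⟨g, -, hg⟩ := φ.exists_conformalExponent hα
  obtain ⟨k, -, hk⟩ := ψ.exists_conformalExponent hα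
  rw [φ.isEmbeddedOn_iff_of_conformalExponent hα hg] at h
  have hd := ψ.inv_mdifferentiable 1
  rw [isEmbeddedOn_iff_of_conformalExponent hα _ fun t => by
    rw [hχ]
    exact ((hk 1).mul (hg t) (ψ.mdifferentiable 1) (φ.mdifferentiable t)).mul
      ((hk 1).inv (ψ.mdifferentiable 1) hd)
      ((ψ.mdifferentiable 1).comp (φ.mdifferentiable t)) hd]
  intro s hs t ht q h1 h2
  rw [hχ, hχ] at h1
  have h1' : φ.1 s ((ψ.1 1)⁻¹ q) = φ.1 t ((ψ.1 1)⁻¹ q) := (ψ.1 1).injective h1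
  refine h s hs t ht _ h1' ?_
  have h3 := add_right_cancel h2
  rw [h1'] at h3
  exact add_left_cancel h3

end ContactIsotopy

variable [T2Space M] [CompactSpace M]

theorem inv_embeddedClasses (hα : IsContactFormFor ξ α) :
    (embeddedClasses ξ α)⁻¹ = embeddedClasses ξ α := by
  have h : ∀ x ∈ embeddedClasses ξ α, x⁻¹ ∈ embeddedClasses ξ α := by
    rintro _ ⟨hx, φ, rfl, hφ⟩
    exact ⟨inv_ne_one.2 hx, φ⁻¹, rfl, φ.isEmbeddedOn_inv hα hφ⟩
  ext x
  exact ⟨fun hx => inv_inv x ▸ h _ hx, h x⟩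

theorem conj_mem_embeddedClasses (hα : IsContactFormFor ξ α) (x y : UniversalCoverCont ξ)
    (hx : x ∈ embeddedClasses ξ α) : y * x * y⁻¹ ∈ embeddedClasses ξ α := by
  obtain ⟨hx1, φ, rfl, hφ⟩ := hx
  obtain ⟨ψ, rfl⟩ := ContactIsotopy.toUniversalCover_surjective y
  obtain ⟨χ, h1, h2⟩ := φ.homotopic_conj ψ
  refine ⟨fun h => hx1 (conj_eq_one_iff.1 h), χ, ?_, ContactIsotopy.isEmbeddedOn_conj hα φ ψ χ h2 hφ⟩
  rw [← h1.toUniversalCover_eq]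
  rfl

/-- A contact isotopy that is cut into embedded pieces represents a product of classes of embedded
isotopies. -/
theorem toUniversalCover_mem_iUnion_pow (hα : IsContactFormFor ξ α) (ψ : ContactIsotopy ξ) {N : ℕ}
    (t : Fin (N + 1) → I) (ht : StrictMono t) (h0 : t 0 = 0) (h1 : t (Fin.last N) = 1)
    (hemb : ∀ i : Fin N, IsEmbeddedOn α ψ.1 (t i.castSucc) (t i.succ)) :
    ψ.toUniversalCover ∈ ⋃ k : ℕ, embeddedClasses ξ α ^ k := by
  have key : ∀ i, (ψ.piece (t 0) (t i)).toUniversalCover ∈ ⋃ k : ℕ, embeddedClasses ξ α ^ k := by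
    intro i
    induction i using Fin.induction with
    | zero =>
      rw [ContactIsotopy.piece_self, ContactIsotopy.toUniversalCover_one]
      exact mem_iUnion.2 ⟨0, by rw [pow_zero]; exact one_mem_one⟩
    | succ i ih =>
      rw [ψ.toUniversalCover_piece _ (t i.castSucc)]
      by_cases h : (ψ.piece (t i.castSucc) (t i.succ)).toUniversalCover = 1
      · rwa [h, one_mul]
      · obtain ⟨k, hk⟩ := mem_iUnion.1 ih
        refine mem_iUnion.2 ⟨k + 1, ?_⟩
        rw [pow_succ']
        exact mul_mem_mul ⟨h, _, rfl,
          ψ.isEmbeddedOn_piece hα (ht Fin.castSucc_lt_succ) (hemb i)⟩ hk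
  have := key (Fin.last N)
  rwa [h0, h1, ψ.piece_zero_one] at this

/-- If `α' = f α` and `φ_t^* α = e^{g_t} α`, then `φ_t^* α' = e^{g'_t} α'` with
`e^{g'_t} f = (f ∘ φ_t) e^{g_t}`. Hence, where `φ_s` and `φ_t` agree, `g_s = g_t` is
equivalent to `g'_s = g'_t`. -/
theorem isEmbeddedOn_of_isContactFormFor {α' : OneForm m M} (hα : IsContactFormFor ξ α)
    (hα' : IsContactFormFor ξ α') (φ : ContactIsotopy ξ) {a b : I} (h : IsEmbeddedOn α φ.1 a b) :
    IsEmbeddedOn α' φ.1 a b := by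
  obtain ⟨V, hV⟩ := hα.exists_isReebField
  obtain ⟨g, -, hg⟩ := φ.exists_conformalExponent hα
  obtain ⟨g', -, hg'⟩ := φ.exists_conformalExponent hα'
  rw [φ.isEmbeddedOn_iff_of_conformalExponent hα hg] at h
  rw [φ.isEmbeddedOn_iff_of_conformalExponent hα' hg']
  have hf : ∀ x v, α' x v = α x v * α' x (V x) := by
    intro x v
    have h1 : v - α x v • V x ∈ ξ x := by
      rw [hα.ker_eq, map_sub, map_smul, (hV x).1, smul_eq_mul, mul_one, sub_self]
    have h2 := (hα'.ker_eq _ _).1 h1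
    rwa [map_sub, map_smul, sub_eq_zero, smul_eq_mul] at h2
  have hne : ∀ x, α' x (V x) ≠ 0 := by
    intro x h0
    refine hα'.ne_zero x (ContinuousLinearMap.ext fun v => ?_)
    rw [hf, h0, mul_zero]
    rfl
  have hexp : ∀ t q, Real.exp (g' t q) * α' q (V q) =
      Real.exp (g t q) * α' (φ.1 t q) (V (φ.1 t q)) := by
    intro t q
    have h1 := (hf _ _).symm.trans (hg' t q (V q))
    rw [hg t q (V q), (hV q).1, mul_one] at h1
    exact h1.symm
  intro s hs t ht q h1 h2
  refine h s hs t ht q h1 (Real.exp_injective ?_)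
  have h3 := hexp s q
  rw [h2, hexp t q, h1] at h3
  exact (mul_right_cancel₀ (hne _) h3).symm

theorem embeddedClasses_eq {α' : OneForm m M} (hα : IsContactFormFor ξ α)
    (hα' : IsContactFormFor ξ α') : embeddedClasses ξ α' = embeddedClasses ξ α := by
  ext x
  constructor
  · rintro ⟨hx, φ, hφ, h⟩
    exact ⟨hx, φ, hφ, isEmbeddedOn_of_isContactFormFor hα' hα φ h⟩
  · rintro ⟨hx, φ, hφ, h⟩
    exact ⟨hx, φ, hφ, isEmbeddedOn_of_isContactFormFor hα hα' φ h⟩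

end EmbeddedIsotopies

/-! ### Decomposition into embedded pieces -/

section Decomposition

open unitInterval

variable {m : ℕ} {M : Type*} [TopologicalSpace M] [ChartedSpace (EuclideanSpace ℝ (Fin m)) M]

theorem StrictMonoOn.bijOn_Icc_unitInterval {u : I → ℝ} {a b : I} (hu : StrictMonoOn u (Icc a b))
    (hc : Continuous u) (hab : a ≤ b) : BijOn u (Icc a b) (Icc (u a) (u b)) :=
  ⟨fun _ ht => ⟨hu.monotoneOn ⟨le_rfl, hab⟩ ht ht.1, hu.monotoneOn ht ⟨hab, le_rfl⟩ ht.2⟩,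
    hu.injOn, intermediate_value_Icc hab hc.continuousOn⟩

/-- Continuous functions on `[0, 1]` vary little on the pieces of a sufficiently fine uniform
subdivision into an even number of pieces. -/
theorem exists_subdivision_dist_lt {u : I → ℝ × ℝ} (hu : Continuous u) {δ : ℝ} (hδ : 0 < δ) :
    ∃ (K : ℕ) (t : Fin (K + K + 1) → I), 0 < K ∧ (∀ i, (t i : ℝ) = i / (2 * K)) ∧
      ∀ i : Fin (K + K), dist (u (t i.succ)) (u (t i.castSucc)) < δ := by
  obtain ⟨ε, hε, h⟩ := Metric.uniformContinuous_iff.1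
    (CompactSpace.uniformContinuous_of_continuous hu) δ hδ
  obtain ⟨K, hK⟩ := exists_nat_gt (1 / ε)
  have hK0 : (0 : ℝ) < K := (by positivity : 0 < 1 / ε).trans hK
  refine ⟨K, fun i => ⟨i / (2 * K), by positivity, (div_le_one (by positivity)).2 ?_⟩,
    Nat.cast_pos.1 hK0, fun i => rfl, fun i => h ?_⟩
  · have : (i : ℕ) ≤ K + K := Nat.lt_succ_iff.1 i.2
    have : ((i : ℕ) : ℝ) ≤ K + K := by exact_mod_cast this
    linarith
  · rw [Subtype.dist_eq, Real.dist_eq]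
    have h1 : ((i.succ : ℕ) : ℝ) / (2 * K) - ((i.castSucc : ℕ) : ℝ) / (2 * K) = 1 / (2 * K) := by
      rw [← sub_div]
      simp
    refine (congrArg abs h1).trans_lt ?_
    rw [abs_of_pos (by positivity), div_lt_iff₀ (by positivity)]
    rw [div_lt_iff₀ hε] at hK
    nlinarith

variable [IsManifold (𝓡 m) ∞ M] [T2Space M] [CompactSpace M] {ξ : TangentDistribution m M}
  {α : OneForm m M}

/-- The isotopy `φ_t` is homotopic to the concatenation of the isotopy `ρ_{-Ct}`, where `ρ` is the
Reeb flow, with `φ_t ρ_{Ct} ρ_{-C}`. For large `C` the first one is negatively transverse and the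
second one positively transverse to the contact structure, so that neither has stationary points
and short pieces of them are embedded. The concatenation is smoothed by slowing down at the ends of
both isotopies. -/
theorem ContactIsotopy.exists_homotopic_subdivision (hα : IsContactFormFor ξ α)
    (φ : ContactIsotopy ξ) : ∃ ψ : ContactIsotopy ξ, φ.Homotopic ψ ∧
      ∃ (N : ℕ) (t : Fin (N + 1) → I), 0 < N ∧ StrictMono t ∧ t 0 = 0 ∧ t (Fin.last N) = 1 ∧
        ∀ i : Fin N, IsEmbeddedOn α ψ.1 (t i.castSucc) (t i.succ) ∧
          HasSmoothGraphUnionOn α ψ.1 (t i.castSucc) (t i.succ) := by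
  obtain ⟨V, hV⟩ := hα.exists_isReebField
  obtain ⟨ρ, hρ, hρ0, hρadd, hρα, hρV⟩ := hα.exists_reebFlow hV
  have hρξ : ∀ t, PreservesDistribution ξ (ρ t) := fun t => (hρα t).preservesDistribution hα
  have hρsub : ∀ t, ρ t * ρ (-t) = 1 := fun t => by rw [← hρadd, add_neg_cancel, hρ0]
  -- The isotopy, extended to all real times and constant outside of `[0, 1]`.
  have hφ' : IsSmoothFamily m 𝓘(ℝ, ℝ) (φ.1 ∘ smoothStep) :=
    φ.isSmoothFamily.comp_param contMDiff_smoothStep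
  obtain ⟨g', -, hg'⟩ := exists_smooth_conformalExponent hα hφ'
    (fun t => φ.preservesDistribution (smoothStep t)) (p₀ := 0) (g₀ := 0) (by
      rw [Function.comp_apply, smoothStep_zero, φ.apply_zero]
      exact isConformalExponent_one α)
  obtain ⟨C, hC, hCvel⟩ := exists_velocity_comp_reebFlow_ne_zero hα hV hρV hφ' hg'
  have hlin : ∀ c : ℝ, ContMDiff 𝓘(ℝ, ℝ) 𝓘(ℝ, ℝ) ∞ (fun t : ℝ => c * t) := fun c =>
    (contDiff_const.mul contDiff_id).contMDiff
  -- The two families without stationary points.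
  let θ₁ : ℝ → Equiv.Perm M := fun t => ρ (-C * t)
  let θ₂ : ℝ → Equiv.Perm M := fun t => φ.1 (smoothStep t) * ρ (C * t) * ρ (-C)
  have hθ₁ : IsSmoothFamily m 𝓘(ℝ, ℝ) θ₁ := hρ.comp_param (hlin (-C))
  have hθ₂' : IsSmoothFamily m 𝓘(ℝ, ℝ) (fun t => φ.1 (smoothStep t) * ρ (C * t)) :=
    hφ'.mul (hρ.comp_param (hlin C))
  have hρC : IsSmoothFamily m 𝓘(ℝ, ℝ) (fun _ : ℝ => ρ (-C)) :=
    hρ.comp_param (u := fun _ : ℝ => -C) contMDiff_const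
  have hθ₂ : IsSmoothFamily m 𝓘(ℝ, ℝ) θ₂ := hθ₂'.mul hρC
  have hθ₁ξ : ∀ t, PreservesDistribution ξ (θ₁ t) := fun t => hρξ _
  have hθ₂ξ : ∀ t, PreservesDistribution ξ (θ₂ t) := fun t =>
    ((φ.preservesDistribution _).mul (hρξ _) (φ.mdifferentiable _) (hρ.mdifferentiable _)).mul
      (hρξ _) (hθ₂'.mdifferentiable t) (hρ.mdifferentiable _)
  have hvel₁ : ∀ t ∈ Icc (0 : ℝ) 1, ∀ q,
      mfderiv 𝓘(ℝ, ℝ) (𝓡 m) (fun t => θ₁ t q) t (1 : ℝ) ≠ 0 := by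
    intro t _ q h0
    have h1 : HasFDerivAt (fun t : ℝ => -C * t) (ContinuousLinearMap.toSpanSingleton ℝ (-C)) t := by
      simpa using ((hasDerivAt_id t).const_mul (-C)).hasFDerivAt
    have h2 := ((hρV (-C * t) q).comp t h1.hasMFDerivAt).mfderiv
    have h3 : ((1 : ℝ) * -C) • V (θ₁ t q) = 0 := (DFunLike.congr_fun h2 (1 : ℝ)).symm.trans h0
    have h4 := congrArg (α (θ₁ t q)) h3
    rw [map_smul, (hV _).1, map_zero, smul_eq_mul, mul_one, one_mul, neg_eq_zero] at h4
    exact hC.ne' h4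
  have hvel₂ : ∀ t ∈ Icc (0 : ℝ) 1, ∀ q,
      mfderiv 𝓘(ℝ, ℝ) (𝓡 m) (fun t => θ₂ t q) t (1 : ℝ) ≠ 0 := fun t ht q =>
    hCvel t ht (ρ (-C) q)
  obtain ⟨γ₁, hγ₁, hγθ₁⟩ := exists_smooth_conformalExponent hα hθ₁ hθ₁ξ (p₀ := 0) (g₀ := 0)
    (hρα _)
  obtain ⟨γ₂, hγ₂, hγθ₂⟩ := exists_smooth_conformalExponent hα hθ₂ hθ₂ξ (p₀ := 0) (g₀ := 0) (by
    have : θ₂ 0 = ρ (-C) := by simp [θ₂, hρ0]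
    rw [this]
    exact hρα _)
  obtain ⟨δ₁, hδ₁, hinj₁⟩ := exists_pos_forall_eq_of_velocity_ne_zero hθ₁.1 hvel₁
  obtain ⟨δ₂, hδ₂, hinj₂⟩ := exists_pos_forall_eq_of_velocity_ne_zero hθ₂.1 hvel₂
  -- The time functions of the concatenation: `u` increases on `[0, 1/2]`, and `w` on `[1/2, 1]`.
  let u : I → ℝ := fun t => Real.smoothTransition (2 * t)
  let w : I → ℝ := fun t => Real.smoothTransition (2 * t - 1)
  have hu : ContMDiff (𝓡∂ 1) 𝓘(ℝ, ℝ) ∞ u :=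
    (Real.smoothTransition.contDiff.comp (contDiff_const.mul contDiff_id)).contMDiff.comp
      contMDiff_subtypeVal_Icc
  have hw : ContMDiff (𝓡∂ 1) 𝓘(ℝ, ℝ) ∞ w :=
    (Real.smoothTransition.contDiff.comp
      ((contDiff_const.mul contDiff_id).sub contDiff_const)).contMDiff.comp contMDiff_subtypeVal_Icc
  have hu0 : u 0 = 0 := by simp [u]
  have hw0 : w 0 = 0 := Real.smoothTransition.zero_of_nonpos (by simp)
  have hu1 : u 1 = 1 := Real.smoothTransition.one_of_one_le (by simp)
  have hw1 : w 1 = 1 := Real.smoothTransition.one_of_one_le (by norm_num)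
  have hI : ∀ x, Real.smoothTransition x ∈ Icc (0 : ℝ) 1 := fun x =>
    ⟨Real.smoothTransition.nonneg x, Real.smoothTransition.le_one x⟩
  have hfst : ContMDiff ((𝓡∂ 1).prod (𝓡∂ 1)) (𝓡∂ 1) ∞ (Prod.fst : I × I → I) := contMDiff_fst
  have hsnd : ContMDiff ((𝓡∂ 1).prod (𝓡∂ 1)) (𝓡∂ 1) ∞ (Prod.snd : I × I → I) := contMDiff_snd
  have hF₁ := φ.isSmoothFamily.comp_param
    (hfst.convexComb hsnd ((contMDiff_smoothStep.comp hw).comp hsnd))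
  have hF₂ := hρ.comp_param ((hlin C).comp
    (hfst.coe_unitInterval.lineMap hsnd.coe_unitInterval (hw.comp hsnd)))
  have hF₃ := hρ.comp_param ((hlin (-C)).comp
    (hfst.coe_unitInterval.lineMap hsnd.coe_unitInterval (hu.comp hsnd)))
  obtain ⟨ψ, hφψ, hψ⟩ := ContactIsotopy.exists_homotopic_of_family (ξ := ξ) (φ := φ)
    ((hF₁.mul hF₂).mul hF₃)
    (fun p => ((φ.preservesDistribution _).mul (hρξ _) (hF₁.mdifferentiable p)
      (hF₂.mdifferentiable p)).mul (hρξ _) ((hF₁.mul hF₂).mdifferentiable p)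
      (hF₃.mdifferentiable p))
    (fun s => by simp [hu0, hw0, hρ0]) (fun s => by simp [hu1, hw1])
    (fun t => by simp [mul_assoc, hρsub])
  have hψ' : ∀ t, ψ.1 t = φ.1 (smoothStep (w t)) * ρ (C * w t) * ρ (-C * u t) := by
    intro t
    rw [hψ]
    simp
  have hψ₁ : ∀ t : I, (t : ℝ) ≤ 1 / 2 → ψ.1 t = θ₁ (u t) := by
    intro t ht
    have h1 : w t = 0 := Real.smoothTransition.zero_of_nonpos (by linarith)
    rw [hψ', h1]
    simp [hρ0, θ₁]
  have hψ₂ : ∀ t : I, 1 / 2 ≤ (t : ℝ) → ψ.1 t = θ₂ (w t) := by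
    intro t ht
    have h1 : u t = 1 := Real.smoothTransition.one_of_one_le (by linarith)
    rw [hψ', h1, mul_one]
  obtain ⟨g, hg, hgψ⟩ := ψ.exists_conformalExponent hα
  obtain ⟨K, t, hK, ht, hdist⟩ := exists_subdivision_dist_lt
    (hu.continuous.prodMk hw.continuous) (lt_min hδ₁ hδ₂)
  have hK' : (0 : ℝ) < K := Nat.cast_pos.2 hK
  have htmono : StrictMono t := by
    intro i j hij
    change (t i : ℝ) < t j
    rw [ht, ht]
    have : ((i : ℕ) : ℝ) < (j : ℕ) := Nat.cast_lt.2 hij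
    gcongr
  refine ⟨ψ, hφψ, K + K, t, by omega, htmono, Subtype.ext ?_, Subtype.ext ?_, fun i => ?_⟩
  · rw [ht]
    simp
  · rw [ht]
    simp only [Fin.val_last, Nat.cast_add, Icc.coe_one]
    field_simp
    norm_num
  have hlt : t i.castSucc < t i.succ := htmono Fin.castSucc_lt_succ
  have hdist' := hdist i
  rw [Prod.dist_eq, max_lt_iff, lt_min_iff, lt_min_iff, Real.dist_eq, Real.dist_eq] at hdist'
  have hshort : ∀ {c d δ : ℝ}, |d - c| < δ → ∀ x ∈ Icc c d, ∀ y ∈ Icc c d, |x - y| < δ := by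
    intro c d δ h x hx y hy
    exact ((Real.dist_le_of_mem_Icc hx hy).trans (le_abs_self _)).trans_lt h
  have hsub : ∀ {x y : ℝ}, Icc (Real.smoothTransition x) (Real.smoothTransition y) ⊆ Icc 0 1 :=
    fun {x y} z hz => ⟨(hI x).1.trans hz.1, hz.2.trans (hI y).2⟩
  rcases lt_or_ge (i : ℕ) K with hi | hi
  · have hhalf : (t i.succ : ℝ) ≤ 1 / 2 := by
      rw [ht, Fin.val_succ, div_le_div_iff₀ (by positivity) two_pos]
      have : ((i + 1 : ℕ) : ℝ) ≤ K := Nat.cast_le.2 hi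
      linarith
    have hmono : StrictMonoOn u (Icc (t i.castSucc) (t i.succ)) := by
      intro x hx y hy hxy
      have hx2 : (x : ℝ) ≤ t i.succ := hx.2
      have hy2 : (y : ℝ) ≤ t i.succ := hy.2
      have hxy' : (x : ℝ) < y := hxy
      exact Real.smoothTransition.strictMonoOn ⟨by linarith [x.2.1], by linarith⟩
        ⟨by linarith [y.2.1], by linarith⟩ (by linarith)
    exact isEmbeddedOn_and_hasSmoothGraphUnionOn_of_reparam hα.ne_zero
      ψ.isSmoothFamily.1.continuous hg hgψ hθ₁.1 hγ₁ hγθ₁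
      (hmono ⟨le_rfl, hlt.le⟩ ⟨hlt.le, le_rfl⟩ hlt) (fun s hs => hvel₁ s (hsub hs))
      (fun x hx y hy => hinj₁ x (hsub hx) y (hsub hy) (hshort hdist'.1.1 x hx y hy))
      (hmono.bijOn_Icc_unitInterval hu.continuous hlt.le)
      (fun s hs => hψ₁ s (le_trans (show (s : ℝ) ≤ t i.succ from hs.2) hhalf))
  · have hhalf : 1 / 2 ≤ (t i.castSucc : ℝ) := by
      rw [ht, Fin.val_castSucc, div_le_div_iff₀ two_pos (by positivity)]
      have : (K : ℝ) ≤ (i : ℕ) := Nat.cast_le.2 hi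
      linarith
    have hmono : StrictMonoOn w (Icc (t i.castSucc) (t i.succ)) := by
      intro x hx y hy hxy
      have hx1 : (t i.castSucc : ℝ) ≤ x := hx.1
      have hy1 : (t i.castSucc : ℝ) ≤ y := hy.1
      have hxy' : (x : ℝ) < y := hxy
      exact Real.smoothTransition.strictMonoOn ⟨by linarith, by linarith [x.2.2]⟩
        ⟨by linarith, by linarith [y.2.2]⟩ (by linarith)
    exact isEmbeddedOn_and_hasSmoothGraphUnionOn_of_reparam hα.ne_zero
      ψ.isSmoothFamily.1.continuous hg hgψ hθ₂.1 hγ₂ hγθ₂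
      (hmono ⟨le_rfl, hlt.le⟩ ⟨hlt.le, le_rfl⟩ hlt) (fun s hs => hvel₂ s (hsub hs))
      (fun x hx y hy => hinj₂ x (hsub hx) y (hsub hy) (hshort hdist'.2.2 x hx y hy))
      (hmono.bijOn_Icc_unitInterval hw.continuous hlt.le)
      (fun s hs => hψ₂ s (le_trans hhalf (show (t i.castSucc : ℝ) ≤ s from hs.1)))

theorem isGeneratingSet_embeddedClasses (hα : IsContactFormFor ξ α) :
    IsGeneratingSet (embeddedClasses ξ α) := by
  refine eq_univ_of_forall fun x => ?_
  obtain ⟨φ, rfl⟩ := ContactIsotopy.toUniversalCover_surjective x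
  obtain ⟨ψ, hψ, N, t, -, ht, h0, h1, h⟩ := φ.exists_homotopic_subdivision hα
  rw [hψ.toUniversalCover_eq]
  exact toUniversalCover_mem_iUnion_pow hα ψ t ht h0 h1 fun i => (h i).1

end Decomposition
theorem lemma2p1 (n : ℕ) {M : Type*} [TopologicalSpace M] [T2Space M] [CompactSpace M]
    [ChartedSpace (EuclideanSpace ℝ (Fin (2 * n + 1))) M] [IsManifold (𝓡 (2 * n + 1)) ∞ M]
    (ξ : TangentDistribution (2 * n + 1) M) (α : OneForm (2 * n + 1) M)
    (hα : IsContactFormFor ξ α) :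
    -- every contact isotopy is homotopic with fixed endpoints to one that can be cut into finitely
    -- many embedded pieces
    (∀ φ : ContactIsotopy ξ, ∃ ψ : ContactIsotopy ξ, φ.Homotopic ψ ∧
      ∃ (N : ℕ) (t : Fin (N + 1) → unitInterval), 0 < N ∧ StrictMono t ∧
        t 0 = 0 ∧ t (Fin.last N) = 1 ∧
        ∀ i : Fin N, IsEmbeddedOn α ψ.1 (t i.castSucc) (t i.succ) ∧
          HasSmoothGraphUnionOn α ψ.1 (t i.castSucc) (t i.succ)) ∧
    -- the embedded classes form a symmetric, conjugation-invariant generating set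
    IsGeneratingSet (embeddedClasses ξ α) ∧
    (embeddedClasses ξ α)⁻¹ = embeddedClasses ξ α ∧
    (∀ x y : UniversalCoverCont ξ, x ∈ embeddedClasses ξ α →
      y * x * y⁻¹ ∈ embeddedClasses ξ α) ∧
    -- the word norm is a non-degenerate conjugation-invariant norm, and the associated metric is
    -- a non-degenerate bi-invariant metric
    IsConjInvariantNorm (fun x : UniversalCoverCont ξ => (discriminantNorm ξ α x : ℝ)) ∧
    IsBiinvariantMetric (discriminantDist ξ α) ∧
    -- none of this depends on the contact form
    (∀ α' : OneForm (2 * n + 1) M, IsContactFormFor ξ α' →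
      embeddedClasses ξ α' = embeddedClasses ξ α ∧
      discriminantNorm ξ α' = discriminantNorm ξ α ∧
      discriminantDist ξ α' = discriminantDist ξ α) := by

  have hgen := isGeneratingSet_embeddedClasses hα
  have hinv := inv_embeddedClasses hα
  have hconj := conj_mem_embeddedClasses hα
  have hnorm := isConjInvariantNorm_wordNorm hgen hinv hconj
  refine ⟨fun φ => φ.exists_homotopic_subdivision hα, hgen, hinv, hconj, hnorm,
    hnorm.isBiinvariantMetric, fun α' hα' => ?_⟩
  have h := embeddedClasses_eq hα hα'
  have h' : discriminantNorm ξ α' = discriminantNorm ξ α := by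
    funext x
    exact congrArg (fun S => wordNorm S x) h
  refine ⟨h, h', ?_⟩
  funext x y
  exact congrArg (fun ν : UniversalCoverCont ξ → ℕ => (ν (x⁻¹ * y) : ℝ)) h'
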